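/- **Setting.** Formulae are built from literals (also called atoms: propositional variables and their duals; $\bar a$ is the dual of $a$) and the units $\top,\bot$ with $\wedge,\vee$. The rules of $\mathsf{KS}$, written premiss $\to$ conclusion, with $a$ a literal and $A,B,C,D$ formulae, are $\mathsf{ai}{\downarrow}:\ \top\to a\vee\bar a$; $\ \mathsf{aw}{\downarrow}:\ \bot\to a$; $\ \mathsf{ac}{\downarrow}:\ a\vee a\to a$; $\ \mathsf{s}:\ A\wedge(B\vee C)\to(A\wedge B)\vee C$; $\ \mathsf{m}:\ (A\wedge B)\vee(C\wedge D)\to(A\vee C)\wedge(B\vee D)$. $\mathsf{KS}^+$ has in addition $\mathsf{aw}{\uparrow}:\ a\to\top$ and $\mathsf{ac}{\uparrow}:\ a\to a\wedge a$. Both systems also contain the rule $=$: the closure under reflexivity, symmetry, transitivity and contexts of commutativity and associativity of $\wedge,\vee$ and of $A\vee\bot=A$, $A\wedge\top=A$, $\top\vee\top=\top$, $\bot\wedge\bot=\bot$. A step $=$ comes with the tracing of the atom occurrences of its conclusion to those of its premiss. Derivations are generated as follows. A formula $A$ is a derivation with premiss and conclusion $A$. If $\Phi,\Psi$ are derivations,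 then so are $\Phi\wedge\Psi$ and $\Phi\vee\Psi$, whose premiss and conclusion are formed with the same connective from those of $\Phi$ and $\Psi$. If the conclusion of $\Phi$ and the premiss of $\Psi$ are the premiss and the conclusion of an instance of a rule, then $\Phi$ above $\Psi$ is a derivation, with the premiss of $\Phi$ and the conclusion of $\Psi$. A proof is a derivation with premiss $\top$. $|\Phi|$ is the number of atom occurrences in $\Phi$, and $\|\Phi\|$ is the length of $\Phi$ written out as data (with names of variables in binary). The atomic flow $\varphi$ of $\Phi$ is the vertically directed graph obtained by tracing the atoms through $\Phi$: its edges are the traced atoms, and each atomic structural step ($\mathsf{ai}{\downarrow},\mathsf{aw}{\downarrow},\mathsf{ac}{\downarrow},\mathsf{aw}{\uparrow},\mathsf{ac}{\uparrow}$) gives a node, which joins the edges of the atoms of its premiss (above) to those of its conclusion (below). Ends of edges that are at no node are pending. An open $\mathsf{ai}$-path is a simple path in $\varphi$ that begins and ends at a pending end of an edge and changes its vertical direction only at $\mathsf{ai}{\downarrow}$ nodes; $\ulcorner\varphi\urcorner$ is the number of open $\mathsf{ai}$-paths of $\varphi$, where a path and its reverse count as one. **Theorem.** There are an algorithm and a polynomial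 $p$ such that, for every $\mathsf{KS}^+$ proof $\Phi$ with atomic flow $\varphi$, the algorithm transforms $\Phi$ into a $\mathsf{KS}$ proof $\Psi$ of the same conclusion in time at most $p(\|\Phi\|+\ulcorner\varphi\urcorner)$; moreover $|\Psi|\le p(|\Phi|+\ulcorner\varphi\urcorner)$. -/

import Mathlib

namespace DeepInference

/-! ## Formulae -/

/-- Literals (also called atoms): a propositional variable or its dual. -/
structure Lit where
  var : ℕ
  pos : Bool

/-- The dual of a literal. -/
def Lit.dual (a : Lit) : Lit := ⟨a.var, !a.pos⟩

/-- Formulae over `⊤, ⊥, ∧, ∨` whose leaves (besides the units) are taken from `α`.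
Ordinary formulae are `Fm Lit`; other choices of `α` serve to name atom occurrences. -/
inductive Fm (α : Type) where
  | top : Fm α
  | bot : Fm α
  | atom (a : α) : Fm α
  | and (A B : Fm α) : Fm α
  | or (A B : Fm α) : Fm α

/-- The atom occurrences of a formula, from left to right. -/
def Fm.atoms {α : Type} : Fm α → List α
  | .top => []
  | .bot => []
  | .atom a => [a]
  | .and A B => A.atoms ++ B.atoms
  | .or A B => A.atoms ++ B.atoms

/-- Replacement of the atoms of a formula. -/
def Fm.map {α β : Type} (f : α → β) : Fm α → Fm β
  | .top => .top
  | .bot => .bot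
  | .atom a => .atom (f a)
  | .and A B => .and (A.map f) (B.map f)
  | .or A B => .or (A.map f) (B.map f)

/-- The number of atom occurrences of a formula. -/
def Fm.size {α : Type} (A : Fm α) : ℕ := A.atoms.length

/-- The logical equality of formulae: the closure of commutativity, associativity and the unit
equations under reflexivity, symmetry, transitivity and contexts. -/
inductive Fm.Eqv {α : Type} : Fm α → Fm α → Prop where
  | or_comm (A B : Fm α) : Fm.Eqv (.or A B) (.or B A)
  | and_comm (A B : Fm α) : Fm.Eqv (.and A B) (.and B A)
  | or_assoc (A B C : Fm α) : Fm.Eqv (.or (.or A B) C) (.or A (.or B C))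
  | and_assoc (A B C : Fm α) : Fm.Eqv (.and (.and A B) C) (.and A (.and B C))
  | or_bot (A : Fm α) : Fm.Eqv (.or A .bot) A
  | and_top (A : Fm α) : Fm.Eqv (.and A .top) A
  | top_or_top : Fm.Eqv (.or .top .top) .top
  | bot_and_bot : Fm.Eqv (.and .bot .bot) .bot
  | refl (A : Fm α) : Fm.Eqv A A
  | symm {A B : Fm α} : Fm.Eqv A B → Fm.Eqv B A
  | trans {A B C : Fm α} : Fm.Eqv A B → Fm.Eqv B C → Fm.Eqv A C
  | and_ctx (C : Fm α) {A B : Fm α} : Fm.Eqv A B → Fm.Eqv (.and C A) (.and C B)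
  | or_ctx (C : Fm α) {A B : Fm α} : Fm.Eqv A B → Fm.Eqv (.or C A) (.or C B)

/-! ## Rules and systems -/

/-- The inference rules. As two occurrences of the same atom can be exchanged by commutativity,
premiss and conclusion of an `=` step do not determine how atoms are traced through it; the step
therefore records the tracing: the `j`-th atom occurrence of the conclusion comes from the
`σ[j]`-th atom occurrence of the premiss (counted from `0`, left to right). -/
inductive Rule where
  | aid | aiu | awd | awu | acd | acu | swi | med
  | eq (σ : List ℕ)

/-- `EqTrace A B σ`: the formulae `A` and `B` are logically equal, with the tracing `σ`.
That is, when the atom occurrences of `A` get the distinct names `0, 1, 2, …` and those of `B` the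
names in `σ`, then `A` and `B` are equal as formulae with named atom occurrences. -/
def EqTrace (A B : Fm Lit) (σ : List ℕ) : Prop :=
  ∃ A' B' : Fm (Lit × ℕ),
    A'.map Prod.fst = A ∧ A'.atoms.map Prod.snd = List.range A.size ∧
    B'.map Prod.fst = B ∧ B'.atoms.map Prod.snd = σ ∧
    A'.Eqv B'

/-- `Inst ρ A B`: there is an instance of the rule `ρ` with premiss `A` and conclusion `B`. -/
inductive Inst : Rule → Fm Lit → Fm Lit → Prop where
  | aid (a : Lit) : Inst .aid .top (.or (.atom a) (.atom a.dual))
  | aiu (a : Lit) : Inst .aiu (.and (.atom a) (.atom a.dual)) .bot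
  | awd (a : Lit) : Inst .awd .bot (.atom a)
  | awu (a : Lit) : Inst .awu (.atom a) .top
  | acd (a : Lit) : Inst .acd (.or (.atom a) (.atom a)) (.atom a)
  | acu (a : Lit) : Inst .acu (.atom a) (.and (.atom a) (.atom a))
  | swi (A B C : Fm Lit) : Inst .swi (.and A (.or B C)) (.or (.and A B) C)
  | med (A B C D : Fm Lit) :
      Inst .med (.or (.and A B) (.and C D)) (.and (.or A C) (.or B D))
  | eq {A B : Fm Lit} {σ : List ℕ} : EqTrace A B σ → Inst (.eq σ) A B

/-- The system `KS`. The rule `=` belongs to every system. -/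
def KS : Set Rule :=
  {Rule.aid, Rule.awd, Rule.acd, Rule.swi, Rule.med} ∪ Set.range Rule.eq

/-- The system `KS⁺`. -/
def KSplus : Set Rule := KS ∪ {Rule.awu, Rule.acu}

/-! ## Derivations -/

/-- Pre-derivations: formulae, closed under `∧`, `∨` and vertical composition, where
`step ρ Φ Ψ` is `Φ` above `Ψ`, joined by an inference step `ρ`. -/
inductive Der where
  | fm (A : Fm Lit) : Der
  | and (Φ Ψ : Der) : Der
  | or (Φ Ψ : Der) : Der
  | step (ρ : Rule) (Φ Ψ : Der) : Der

/-- The premiss of a derivation. -/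
def Der.pr : Der → Fm Lit
  | .fm A => A
  | .and Φ Ψ => .and Φ.pr Ψ.pr
  | .or Φ Ψ => .or Φ.pr Ψ.pr
  | .step _ Φ _ => Φ.pr

/-- The conclusion of a derivation. -/
def Der.cn : Der → Fm Lit
  | .fm A => A
  | .and Φ Ψ => .and Φ.cn Ψ.cn
  | .or Φ Ψ => .or Φ.cn Ψ.cn
  | .step _ _ Ψ => Ψ.cn

/-- `Φ` is a derivation in the system `S`: all its steps are instances of rules of `S`. -/
def Der.IsDerivation (S : Set Rule) : Der → Prop
  | .fm _ => True
  | .and Φ Ψ => Φ.IsDerivation S ∧ Ψ.IsDerivation S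
  | .or Φ Ψ => Φ.IsDerivation S ∧ Ψ.IsDerivation S
  | .step ρ Φ Ψ => Φ.IsDerivation S ∧ Ψ.IsDerivation S ∧ ρ ∈ S ∧ Inst ρ Φ.cn Ψ.pr

/-- `Φ` is a proof in the system `S`: a derivation in `S` with premiss `⊤`. -/
def Der.IsProof (S : Set Rule) (Φ : Der) : Prop :=
  Φ.IsDerivation S ∧ Φ.pr = .top

/-- The size of a derivation: its number of atom occurrences. -/
def Der.size : Der → ℕ
  | .fm A => A.size
  | .and Φ Ψ => Φ.size + Ψ.size
  | .or Φ Ψ => Φ.size + Ψ.size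
  | .step _ Φ Ψ => Φ.size + Ψ.size

/-! ## Atomic flows -/

/-- The six types of nodes of a flow, each with the names of its edges: in each case first the
edges above the node, then those below it. -/
inductive Node where
  | aid (l r : ℕ)
  | aiu (l r : ℕ)
  | awd (e : ℕ)
  | awu (e : ℕ)
  | acd (l r e : ℕ)
  | acu (e l r : ℕ)

/-- The edges above a node, i.e. those whose lower end is at the node. -/
def Node.upper : Node → List ℕ
  | .aid _ _ => []
  | .aiu l r => [l, r]
  | .awd _ => []
  | .awu e => [e]
  | .acd l r _ => [l, r]
  | .acu e _ _ => [e]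

/-- The edges below a node, i.e. those whose upper end is at the node. -/
def Node.lower : Node → List ℕ
  | .aid l r => [l, r]
  | .aiu _ _ => []
  | .awd e => [e]
  | .awu _ => []
  | .acd _ _ e => [e]
  | .acu _ l r => [l, r]

/-- An atomic flow: a vertically directed graph with edges `0, …, edges - 1` and nodes of the six
types. Ends of edges that are at no node are pending. -/
structure Flow where
  edges : ℕ
  nodes : List Node

/-- Tracing of atoms through an inference step with the premiss `A`. Given the edges `es` of the
atom occurrences of `A` and the least unused edge name `k`, it returns the node created by the step,
the edges of the atom occurrences of the conclusion, and the least edge name that is then unused. -/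
def Rule.trace (ρ : Rule) (A : Fm Lit) (es : List ℕ) (k : ℕ) : List Node × List ℕ × ℕ :=
  match ρ, A, es with
  | .aid, _, _ => ([.aid k (k + 1)], [k, k + 1], k + 2)
  | .aiu, _, [l, r] => ([.aiu l r], [], k)
  | .awd, _, _ => ([.awd k], [k], k + 1)
  | .awu, _, [e] => ([.awu e], [], k)
  | .acd, _, [l, r] => ([.acd l r k], [k], k + 1)
  | .acu, _, [e] => ([.acu e k (k + 1)], [k, k + 1], k + 2)
  | .swi, _, es => ([], es, k)
  | .med, .or (.and A B) (.and C _), es =>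
      let as := es.take A.size
      let bs := (es.drop A.size).take B.size
      let cs := (es.drop (A.size + B.size)).take C.size
      let ds := es.drop (A.size + B.size + C.size)
      ([], as ++ cs ++ bs ++ ds, k)
  | .eq σ, _, es => ([], σ.map fun i => es.getD i 0, k)
  | _, _, es => ([], es, k)

/-- Tracing of atoms through a derivation: given the edges `es` of the atom occurrences of the
premiss and the least unused edge name `k`, it returns the nodes, the edges of the atom occurrences
of the conclusion, and the least edge name that is then unused. -/
def Der.trace : Der → List ℕ → ℕ → List Node × List ℕ × ℕ
  | .fm _, es, k => ([], es, k)
  | .and Φ Ψ, es, k =>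
      let (ns₁, bs₁, k₁) := Φ.trace (es.take Φ.pr.size) k
      let (ns₂, bs₂, k₂) := Ψ.trace (es.drop Φ.pr.size) k₁
      (ns₁ ++ ns₂, bs₁ ++ bs₂, k₂)
  | .or Φ Ψ, es, k =>
      let (ns₁, bs₁, k₁) := Φ.trace (es.take Φ.pr.size) k
      let (ns₂, bs₂, k₂) := Ψ.trace (es.drop Φ.pr.size) k₁
      (ns₁ ++ ns₂, bs₁ ++ bs₂, k₂)
  | .step ρ Φ Ψ, es, k =>
      let (ns₁, bs₁, k₁) := Φ.trace es k
      let (ns₂, bs₂, k₂) := ρ.trace Φ.cn bs₁ k₁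
      let (ns₃, bs₃, k₃) := Ψ.trace bs₂ k₂
      (ns₁ ++ ns₂ ++ ns₃, bs₃, k₃)

/-- The atomic flow of a derivation. -/
def Der.flow (Φ : Der) : Flow :=
  let (ns, _, k) := Φ.trace (List.range Φ.pr.size) Φ.pr.size
  ⟨k, ns⟩

/-! ## Open `ai`-paths -/

/-- The two vertical directions in which a path may traverse an edge. -/
inductive Dir where
  | down | up

/-- The opposite direction. -/
def Dir.flip : Dir → Dir
  | .down => .up
  | .up => .down

/-- `φ.Next x y`: an `ai`-path that traverses the edge `x.1` in the direction `x.2` may continue by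
traversing the edge `y.1` in the direction `y.2`. The direction changes only at `aid` and `aiu`
nodes. -/
def Flow.Next (φ : Flow) : ℕ × Dir → ℕ × Dir → Prop
  | (e, .down), (f, .down) => ∃ ν ∈ φ.nodes, e ∈ ν.upper ∧ f ∈ ν.lower
  | (e, .up), (f, .up) => ∃ ν ∈ φ.nodes, e ∈ ν.lower ∧ f ∈ ν.upper
  | (e, .up), (f, .down) => Node.aid e f ∈ φ.nodes ∨ Node.aid f e ∈ φ.nodes
  | (e, .down), (f, .up) => Node.aiu e f ∈ φ.nodes ∨ Node.aiu f e ∈ φ.nodes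

/-- A simple `ai`-path, given by the edges that it traverses and their directions.
As each passage through a node uses the only edge on one side of it (at contraction nodes) or both
its edges (at identity and cut nodes), nodes cannot repeat where edges do not. -/
structure Flow.IsAiPath (φ : Flow) (π : List (ℕ × Dir)) : Prop where
  ne_nil : π ≠ []
  edge_lt : ∀ x ∈ π, x.1 < φ.edges
  simple : (π.map Prod.fst).Nodup
  chain : π.IsChain φ.Next

/-- The end of the edge `x.1` at which a traversal in the direction `x.2` starts is pending. -/
def Flow.StartPending (φ : Flow) : ℕ × Dir → Prop
  | (e, .down) => ∀ ν ∈ φ.nodes, e ∉ ν.lower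
  | (e, .up) => ∀ ν ∈ φ.nodes, e ∉ ν.upper

/-- The inversion of a path: the same path in the reverse direction. -/
def inversion (π : List (ℕ × Dir)) : List (ℕ × Dir) :=
  (π.map fun x => (x.1, x.2.flip)).reverse

/-- An open `ai`-path begins and ends at a pending end of an edge. -/
def Flow.IsOpenAiPath (φ : Flow) (π : List (ℕ × Dir)) : Prop :=
  φ.IsAiPath π ∧ (∀ x ∈ π.head?, φ.StartPending x) ∧
    (∀ x ∈ (inversion π).head?, φ.StartPending x)

/-- The number of open `ai`-paths of a flow, modulo inversion. -/
noncomputable def Flow.numOpenAiPaths (φ : Flow) : ℕ :=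
  Set.ncard ((fun π => s(π, inversion π)) '' {π | φ.IsOpenAiPath π})

/-! ## Algorithms and their running time

Algorithms are programs of a first-order functional language with recursive procedures, working on
binary trees (the core of LISP). The time charged for an operation is at least the size of the value
it produces, so that time in this model and time on Turing machines are polynomially related. -/

/-- Binary trees, the data of programs. -/
inductive Tree where
  | nil : Tree
  | cons (x y : Tree) : Tree

/-- The number of nodes and leaves of a binary tree. -/
def Tree.size : Tree → ℕ
  | .nil => 1
  | .cons x y => x.size + y.size + 1

/-- First component; that of `nil` is `nil`. -/
def Tree.head : Tree → Tree
  | .nil => .nil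
  | .cons x _ => x

/-- Second component; that of `nil` is `nil`. -/
def Tree.tail : Tree → Tree
  | .nil => .nil
  | .cons _ y => y

/-- Expressions, each a partial function of one argument. -/
inductive Expr where
  /-- the argument itself -/
  | arg : Expr
  /-- the constant `nil` -/
  | nil : Expr
  /-- first component of the argument -/
  | head : Expr
  /-- second component of the argument -/
  | tail : Expr
  /-- the pair of the values of `f` and `g` -/
  | cons (f g : Expr) : Expr
  /-- `f` applied to the value of `g` -/
  | comp (f g : Expr) : Expr
  /-- `f` if the value of `c` is not `nil`, and `g` otherwise -/
  | ite (c f g : Expr) : Expr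
  /-- call of the procedure with the number `i` -/
  | call (i : ℕ) : Expr

/-- A program: the bodies of its procedures, of which number `0` is the main one. -/
abbrev Program := List Expr

/-- `Eval P f x y t`: in the program `P`, the evaluation of the expression `f` on the argument `x`
terminates with the value `y`, in time `t`. -/
inductive Eval (P : Program) : Expr → Tree → Tree → ℕ → Prop where
  | arg (x : Tree) : Eval P .arg x x (1 + x.size)
  | nil (x : Tree) : Eval P .nil x .nil (1 + Tree.nil.size)
  | head (x : Tree) : Eval P .head x x.head (1 + x.head.size)
  | tail (x : Tree) : Eval P .tail x x.tail (1 + x.tail.size)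
  | cons {f g : Expr} {x y z : Tree} {s t : ℕ} : Eval P f x y s → Eval P g x z t →
      Eval P (.cons f g) x (.cons y z) (s + t + (1 + (Tree.cons y z).size))
  | comp {f g : Expr} {x y z : Tree} {s t : ℕ} : Eval P g x y s → Eval P f y z t →
      Eval P (.comp f g) x z (s + t + 1)
  | ite_true {c f g : Expr} {x u v y : Tree} {s t : ℕ} : Eval P c x (.cons u v) s →
      Eval P f x y t → Eval P (.ite c f g) x y (s + t + 1)
  | ite_false {c f g : Expr} {x y : Tree} {s t : ℕ} : Eval P c x .nil s →
      Eval P g x y t → Eval P (.ite c f g) x y (s + t + 1)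
  | call {i : ℕ} {f : Expr} {x y : Tree} {t : ℕ} : P[i]? = some f → Eval P f x y t →
      Eval P (.call i) x y (t + 1)

/-- On the input `x`, the program `P` terminates with the output `y`, in time `t`. -/
def Program.Outputs (P : Program) (x y : Tree) (t : ℕ) : Prop := Eval P (.call 0) x y t

/-! ## Derivations as data -/

/-- Lists as trees. -/
def Tree.ofList : List Tree → Tree
  | [] => .nil
  | x :: xs => .cons x (Tree.ofList xs)

/-- Bits as trees. -/
def Tree.ofBool : Bool → Tree
  | false => .nil
  | true => .cons .nil .nil

/-- Natural numbers in unary as trees. -/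
def Tree.ofNat (n : ℕ) : Tree := Tree.ofList (List.replicate n .nil)

/-- A literal as a tree, its variable being written in binary. -/
def Lit.code (a : Lit) : Tree :=
  .cons (Tree.ofBool a.pos) (Tree.ofList (a.var.bits.map Tree.ofBool))

/-- A formula as a tree. -/
def Fm.code : Fm Lit → Tree
  | .top => .cons (Tree.ofNat 0) .nil
  | .bot => .cons (Tree.ofNat 1) .nil
  | .atom a => .cons (Tree.ofNat 2) a.code
  | .and A B => .cons (Tree.ofNat 3) (.cons A.code B.code)
  | .or A B => .cons (Tree.ofNat 4) (.cons A.code B.code)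

/-- A rule as a tree. -/
def Rule.code : Rule → Tree
  | .aid => .cons (Tree.ofNat 0) .nil
  | .aiu => .cons (Tree.ofNat 1) .nil
  | .awd => .cons (Tree.ofNat 2) .nil
  | .awu => .cons (Tree.ofNat 3) .nil
  | .acd => .cons (Tree.ofNat 4) .nil
  | .acu => .cons (Tree.ofNat 5) .nil
  | .swi => .cons (Tree.ofNat 6) .nil
  | .med => .cons (Tree.ofNat 7) .nil
  | .eq σ => .cons (Tree.ofNat 8) (Tree.ofList (σ.map Tree.ofNat))

/-- A derivation as a tree. -/
def Der.code : Der → Tree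
  | .fm A => .cons (Tree.ofNat 0) A.code
  | .and Φ Ψ => .cons (Tree.ofNat 1) (.cons Φ.code Ψ.code)
  | .or Φ Ψ => .cons (Tree.ofNat 2) (.cons Φ.code Ψ.code)
  | .step ρ Φ Ψ => .cons (Tree.ofNat 3) (.cons ρ.code (.cons Φ.code Ψ.code))

/-- The length of a derivation as a piece of data: the size of the tree that encodes it. -/
def Der.length (Φ : Der) : ℕ := Φ.code.size

end DeepInference

/-! Coweakenings and cocontractions are removed by substituting a formula for each atom occurrence,
chosen along the atomic flow. The tree of an edge is a conjunction of copies of its literal with one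
leaf for each path that descends from the edge to the conclusion. The three edges of a contraction
have the same tree, the tree above a cocontraction is the conjunction of the two trees below it, and
an edge that ends in a coweakening has no tree. An edge is dead if it does not descend from an
identity whose other edge has a tree. The value of an edge (`Deco.val`) is ⊤ if it has no tree, ⊥ if
it has a tree but is dead, and its tree otherwise.

After each atom has been replaced by the value of its edge, every step can be filled in KS
(`loc_runs`). Switch, medial and `=` are schematic, so they survive the substitution; only the
tracing of `=` has to be expanded to blocks (`EqSkel.eqTrace`). Cocontractions and coweakenings
become equations between formulae. A contraction becomes an equation for units, or the contraction
of a conjunction, which medial reduces to atoms (`contr`). A weakening becomes ⊥ → ⊥, or ⊥ → ⊤,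
which a switch yields. At an identity, either one edge has no tree, and the disjunction of the two
values equals ⊤; or the values are conjunctions of copies of dual literals, whose disjunction is
proved from atomic identities by two nested inductions (`idAtom`, `idConj`), each using switches and
contractions. An edge in the conclusion has its single atom as its tree, so the substituted
conclusion differs from the original one only by ⊥ at dead atoms, and weakenings repair this
(`Deco.Final.weak`).

For the size, consider an identity both edges of which have trees. Ascending along one descending
path and going down along another, starting at the other edge of the identity, gives an open path,
and different pairs give different paths modulo inversion. So the product of the sizes of the two
trees is at most the number `N` of open paths (`mul_le_numOpenAiPaths`). Trees do not grow on the
way down, hence the tree of every edge that is not dead has at most `N` leaves (`decoration_size`).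
Trees of dead edges escape this bound, which is why such edges become ⊥. What replaces a step has
size polynomial in the sizes of the trees involved.

The algorithm `prog` does not build the flow. It annotates formulae: from the bottom up with the
edges that have trees, from the top down with the dead edges, and from the bottom up again with the
values, while it assembles the new proof (`g_runs`). The decoration of the flow serves only to
analyse it. Symbolic evaluation of the program by `wp` gives explicit cost functions, which are
bounded by polynomials in the length of the proof and `N`. -/

namespace DeepInference

/-! ### Substitution into formulae and renaming of their atoms. -/

namespace Fm
variable {α β γ : Type}

/-- Substitution of formulae for the atoms of a formula. -/
def bind (f : α → Fm β) : Fm α → Fm β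
  | .top => .top
  | .bot => .bot
  | .atom a => f a
  | .and A B => .and (A.bind f) (B.bind f)
  | .or A B => .or (A.bind f) (B.bind f)

/-- The equations mention no particular atoms, so they are closed under substitution. This is why an
`=` step stays an `=` step when atoms are replaced by values. -/
theorem Eqv.bind (f : α → Fm β) {A B : Fm α} (h : A.Eqv B) : (A.bind f).Eqv (B.bind f) := by
  induction h with
  | symm _ ih => exact ih.symm
  | trans _ _ ih₁ ih₂ => exact ih₁.trans ih₂
  | and_ctx C _ ih => exact .and_ctx _ ih
  | or_ctx C _ ih => exact .or_ctx _ ih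
  | _ => constructor

theorem map_eq_bind (f : α → β) (A : Fm α) : A.map f = A.bind (fun a => .atom (f a)) := by
  induction A <;> simp_all [Fm.map, Fm.bind]

theorem Eqv.map (f : α → β) {A B : Fm α} (h : A.Eqv B) : (A.map f).Eqv (B.map f) := by
  rw [map_eq_bind, map_eq_bind]; exact h.bind _

/-- Every equation is linear: no atom is lost, created or duplicated. -/
theorem Eqv.perm {A B : Fm α} (h : A.Eqv B) : A.atoms.Perm B.atoms := by
  induction h with
  | symm _ ih => exact ih.symm
  | trans _ _ ih₁ ih₂ => exact ih₁.trans ih₂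
  | and_ctx C _ ih => exact ih.append_left _
  | or_ctx C _ ih => exact ih.append_left _
  | or_comm | and_comm => exact List.perm_append_comm
  | _ => simp [atoms]

theorem Eqv.or_congr {A A' B B' : Fm α} (h : A.Eqv A') (h' : B.Eqv B') :
    (Fm.or A B).Eqv (.or A' B') :=
  (Eqv.or_ctx A h').trans ((Eqv.or_comm _ _).trans ((Eqv.or_ctx B' h).trans (.or_comm _ _)))

theorem atoms_map (f : α → β) (A : Fm α) : (A.map f).atoms = A.atoms.map f := by
  induction A <;> simp_all [Fm.map, atoms]

theorem size_map (f : α → β) (A : Fm α) : (A.map f).size = A.size := by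
  simp [size, atoms_map]

theorem atoms_bind (f : α → Fm β) (A : Fm α) :
    (A.bind f).atoms = A.atoms.flatMap (fun a => (f a).atoms) := by
  induction A <;> simp_all [Fm.bind, atoms]

theorem map_map (f : α → β) (g : β → γ) (A : Fm α) : (A.map f).map g = A.map (g ∘ f) := by
  induction A <;> simp_all [Fm.map]

theorem map_bind (f : α → Fm β) (g : β → γ) (A : Fm α) :
    (A.bind f).map g = A.bind (fun a => (f a).map g) := by
  induction A <;> simp_all [Fm.map, Fm.bind]

theorem bind_map (f : α → β) (g : β → Fm γ) (A : Fm α) :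
    (A.map f).bind g = A.bind (g ∘ f) := by
  induction A <;> simp_all [Fm.map, Fm.bind]

theorem map_congr {f g : α → β} {A : Fm α} (h : ∀ a ∈ A.atoms, f a = g a) :
    A.map f = A.map g := by
  induction A <;> simp_all [Fm.map, atoms]

theorem map_id (A : Fm α) : A.map id = A := by
  induction A <;> simp_all [Fm.map]

@[simp] theorem size_top : (top : Fm α).size = 0 := rfl
@[simp] theorem size_bot : (bot : Fm α).size = 0 := rfl
@[simp] theorem size_atom (a : α) : (atom a).size = 1 := rfl
@[simp] theorem size_and (A B : Fm α) : (and A B).size = A.size + B.size := by simp [size, atoms]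
@[simp] theorem size_or (A B : Fm α) : (or A B).size = A.size + B.size := by simp [size, atoms]

/-- The atom occurrences of a formula, numbered from `k` on. -/
def number : ℕ → Fm α → Fm (α × ℕ)
  | _, .top => .top
  | _, .bot => .bot
  | k, .atom a => .atom (a, k)
  | k, .and A B => .and (number k A) (number (k + A.size) B)
  | k, .or A B => .or (number k A) (number (k + A.size) B)

theorem map_fst_number (k : ℕ) (A : Fm α) : (number k A).map Prod.fst = A := by
  induction A generalizing k <;> simp_all [number, Fm.map]

theorem atoms_number (k : ℕ) (A : Fm α) :
    (number k A).atoms.map Prod.snd = List.range' k A.size := by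
  induction A generalizing k <;> simp_all [number, atoms]

end Fm

/-! ## Tracings of logical equality -/

/-- `X` and `Y` are logically equal formulae with named atom occurrences, with the tracing `σ`. -/
structure EqSkel (σ : List ℕ) (X Y : Fm ℕ) : Prop where
  pr : X.atoms = List.range X.size
  cn : Y.atoms = σ
  eqv : X.Eqv Y

theorem EqSkel.perm {σ : List ℕ} {X Y : Fm ℕ} (h : EqSkel σ X Y) :
    σ.Perm (List.range X.size) := by
  rw [← h.pr, ← h.cn]; exact h.eqv.perm.symm

theorem EqSkel.lt {σ : List ℕ} {X Y : Fm ℕ} (h : EqSkel σ X Y) {i : ℕ} (hi : i ∈ σ) :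
    i < X.size := by
  simpa using h.perm.mem_iff.1 hi

/-- Consecutive intervals of given lengths, from `k` on. -/
def blocks : ℕ → List ℕ → List (List ℕ)
  | _, [] => []
  | k, n :: ns => List.range' k n :: blocks (k + n) ns

/-- The tracing which results from `σ` if formulae `xs` are substituted for the atoms of the
premiss. -/
def expand (σ : List ℕ) (xs : List (Fm Lit)) : List ℕ :=
  σ.flatMap fun i => (blocks 0 (xs.map Fm.size)).getD i []

theorem length_blocks (k : ℕ) (ns : List ℕ) : (blocks k ns).length = ns.length := by
  induction ns generalizing k <;> simp_all [blocks]

theorem flatten_blocks (k : ℕ) (ns : List ℕ) :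
    (blocks k ns).flatten = List.range' k ns.sum := by
  induction ns generalizing k <;> simp_all [blocks]

theorem getD_blocks (k : ℕ) (ns : List ℕ) (i : ℕ) :
    (blocks k ns).getD i [] = List.range' (k + (ns.take i).sum) (ns.getD i 0) := by
  induction ns generalizing k i with
  | nil => simp [blocks]
  | cons n ns ih =>
    cases i with
    | zero => simp [blocks]
    | succ i =>
      have := ih (k + n) i
      simp only [blocks, List.getD_cons_succ, List.take_succ_cons, List.sum_cons, this]
      rw [Nat.add_assoc]

theorem flatMap_range_getD (l : List (List ℕ)) :
    (List.range l.length).flatMap (fun i => l.getD i []) = l.flatten := by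
  rw [List.flatMap_def]
  congr 1
  apply List.ext_getElem <;> simp +contextual

/-- Each named atom of the premiss becomes a block of consecutive occurrences, and the blocks move
as a whole; `expand` lists them in the order of `σ`. -/
theorem EqSkel.eqTrace {σ : List ℕ} {X Y : Fm ℕ} (h : EqSkel σ X Y) (f : ℕ → Fm Lit) :
    EqTrace (X.bind f) (Y.bind f) (expand σ ((List.range X.size).map f)) := by
  set ns := ((List.range X.size).map f).map Fm.size with hns
  -- Numbering `f i` from the total size of the earlier blocks makes the names in the premiss read
  -- `0, 1, 2, …`.
  set g : ℕ → Fm (Lit × ℕ) := fun i => (f i).number (ns.take i).sum with hg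
  have key : ∀ i < X.size, (g i).atoms.map Prod.snd = (blocks 0 ns).getD i [] := by
    intro i hi
    simp only [hg]
    rw [getD_blocks, Fm.atoms_number]
    simp [hns, hi]
  have hl : (blocks 0 ns).length = X.size := by simp [length_blocks, hns]
  have hX : (X.bind g).atoms.map Prod.snd = (blocks 0 ns).flatten := by
    rw [Fm.atoms_bind, h.pr, List.map_flatMap, ← flatMap_range_getD, hl]
    rw [List.flatMap_def, List.flatMap_def]
    congr 1
    exact List.map_congr_left fun i hi => key i (by simpa using hi)
  refine ⟨X.bind g, Y.bind g, ?_, ?_, ?_, ?_, h.eqv.bind g⟩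
  · rw [Fm.map_bind]; simp only [hg, Fm.map_fst_number]
  · rw [hX, flatten_blocks, ← List.range_eq_range']
    congr 1
    rw [Fm.size, Fm.atoms_bind, h.pr, List.length_flatMap, hns, List.map_map]
    rfl
  · rw [Fm.map_bind]; simp only [hg, Fm.map_fst_number]
  · rw [Fm.atoms_bind, h.cn, List.map_flatMap, expand]
    rw [List.flatMap_def, List.flatMap_def]
    congr 1
    exact List.map_congr_left fun i hi => key i (h.lt hi)

/-- The names in the premiss are distinct, so the literal of an occurrence is a function of its
name, and the literals can be split off from the tracing. What remains is a skeleton into which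
anything can be substituted. -/
theorem EqTrace.exists_skel {A B : Fm Lit} {σ : List ℕ} (h : EqTrace A B σ) :
    ∃ (X Y : Fm ℕ) (ℓ : ℕ → Lit), EqSkel σ X Y ∧ X.map ℓ = A ∧ Y.map ℓ = B := by
  obtain ⟨A', B', hA, hA', hB, hB', he⟩ := h
  have hsz : A'.size = A.size := by rw [← hA, Fm.size_map]
  have hex : ∃ ℓ : ℕ → Lit, ∀ x ∈ A'.atoms, ℓ x.2 = x.1 := by
    -- The default literal is only used at names that do not occur.
    refine ⟨fun i => ((A'.atoms[i]?).map Prod.fst).getD ⟨0, true⟩, fun x hx => ?_⟩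
    obtain ⟨j, hj, rfl⟩ := List.mem_iff_getElem.1 hx
    have : (A'.atoms[j]).2 = j := by
      have : (A'.atoms.map Prod.snd)[j]'(by simpa using hj) = j := by simp [hA']
      simpa using this
    simp [this, hj]
  obtain ⟨ℓ, hℓ⟩ := hex
  refine ⟨A'.map Prod.snd, B'.map Prod.snd, ℓ, ⟨?_, ?_, he.map _⟩, ?_, ?_⟩
  · rw [Fm.atoms_map, hA', Fm.size_map, hsz]
  · rw [Fm.atoms_map, hB']
  · rw [Fm.map_map, ← hA]; exact Fm.map_congr fun x hx => hℓ x hx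
  · rw [Fm.map_map, ← hB]; exact Fm.map_congr fun x hx => hℓ x (he.perm.mem_iff.2 hx)

/-! ## Conjunctions of copies of a literal -/

/-- The formula is a conjunction of copies of the literal `a`, bracketed in some way. -/
def Fm.IsConj (a : Lit) : Fm Lit → Prop
  | .atom b => b = a
  | .and X Y => X.IsConj a ∧ Y.IsConj a
  | _ => False

theorem Fm.IsConj.one_le_size {a : Lit} {T : Fm Lit} (h : T.IsConj a) : 1 ≤ T.size := by
  induction T <;> simp_all [Fm.IsConj]
  omega

theorem Fm.size_le_code (A : Fm Lit) : A.size ≤ A.code.size := by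
  induction A <;> simp_all [Fm.code, Tree.size] <;> omega

/-- Contraction of a conjunction of copies of a literal. -/
def contr : Fm Lit → Der
  | .atom a => .step .acd (.fm (.or (.atom a) (.atom a))) (.fm (.atom a))
  | .and X Y => .step .med (.fm (.or (.and X Y) (.and X Y))) (.and (contr X) (contr Y))
  | A => .fm A

theorem contr_pr {a : Lit} {T : Fm Lit} (h : T.IsConj a) : (contr T).pr = .or T T := by
  cases T <;> simp_all [Fm.IsConj, contr, Der.pr]

theorem contr_cn {a : Lit} {T : Fm Lit} (h : T.IsConj a) : (contr T).cn = T := by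
  induction T <;> simp_all [Fm.IsConj, contr, Der.cn]

theorem acd_mem_KS : Rule.acd ∈ KS := by simp [KS]
theorem aid_mem_KS : Rule.aid ∈ KS := by simp [KS]
theorem swi_mem_KS : Rule.swi ∈ KS := by simp [KS]
theorem med_mem_KS : Rule.med ∈ KS := by simp [KS]
theorem eq_mem_KS (σ : List ℕ) : Rule.eq σ ∈ KS := by simp [KS]

theorem contr_isDerivation {a : Lit} {T : Fm Lit} (h : T.IsConj a) :
    (contr T).IsDerivation KS := by
  induction T with
  | atom b => exact ⟨trivial, trivial, acd_mem_KS, .acd b⟩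
  | and X Y ihX ihY =>
    refine ⟨trivial, ⟨ihX h.1, ihY h.2⟩, med_mem_KS, ?_⟩
    simp only [Der.pr, Der.cn, contr_pr h.1, contr_pr h.2]
    exact .med X Y X Y
  | _ => trivial

theorem EqTrace.nil {A B : Fm Lit} (h : A.Eqv B) (hA : A.atoms = []) : EqTrace A B [] := by
  have hB : B.atoms = [] := by simpa [hA] using h.perm
  refine ⟨A.map fun a => (a, 0), B.map fun a => (a, 0), ?_, ?_, ?_, ?_, h.map _⟩ <;>
    simp [Fm.map_map, Fm.atoms_map, Fm.size, hA, hB, Function.comp_def] <;> exact Fm.map_id _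

/-- From proofs of `X ∨ Z` and `Y ∨ Z` to a proof of `(X ∧ Y) ∨ Z`. -/
def meet (Φ Ψ : Der) (X Y Z : Fm Lit) : Der :=
  -- From ⊤ = ⊤ ∧ ⊤ the two proofs run in parallel. Two switches move the two copies of `Z` out of
  -- the conjunction, and `contr` merges them.
  .step (.eq []) (.fm .top) <|
  .step .swi (.and Φ Ψ) <|
  .step (.eq (expand [2, 0, 1, 3] [X, Z, Y, Z])) (.fm (.or (.and (.or X Z) Y) Z)) <|
  .step (.eq (expand [1, 0, 2, 3] [Y, X, Z, Z]))
    (.or (.step .swi (.fm (.and Y (.or X Z))) (.fm (.or (.and Y X) Z))) (.fm Z))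
    (.or (.fm (.and X Y)) (contr Z))

theorem eqTrace_meet₁ (X Y Z : Fm Lit) :
    EqTrace (.or (.and (.or X Z) Y) Z) (.or (.and Y (.or X Z)) Z)
      (expand [2, 0, 1, 3] [X, Z, Y, Z]) :=
  EqSkel.eqTrace
    (X := .or (.and (.or (.atom 0) (.atom 1)) (.atom 2)) (.atom 3))
    (Y := .or (.and (.atom 2) (.or (.atom 0) (.atom 1))) (.atom 3))
    ⟨rfl, rfl, (Fm.Eqv.and_comm _ _).or_congr (.refl _)⟩ (fun i => [X, Z, Y, Z].getD i .top)

theorem eqTrace_meet₂ (X Y Z : Fm Lit) :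
    EqTrace (.or (.or (.and Y X) Z) Z) (.or (.and X Y) (.or Z Z))
      (expand [1, 0, 2, 3] [Y, X, Z, Z]) :=
  EqSkel.eqTrace
    (X := .or (.or (.and (.atom 0) (.atom 1)) (.atom 2)) (.atom 3))
    (Y := .or (.and (.atom 1) (.atom 0)) (.or (.atom 2) (.atom 3)))
    ⟨rfl, rfl, (Fm.Eqv.or_assoc _ _ _).trans ((Fm.Eqv.and_comm _ _).or_congr (.refl _))⟩
    (fun i => [Y, X, Z, Z].getD i .top)

theorem eqTrace_swap (X Y : Fm Lit) :
    EqTrace (.or X Y) (.or Y X) (expand [1, 0] [X, Y]) :=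
  EqSkel.eqTrace (X := .or (.atom 0) (.atom 1)) (Y := .or (.atom 1) (.atom 0))
    ⟨rfl, rfl, .or_comm _ _⟩ (fun i => [X, Y].getD i .top)

theorem meet_isDerivation {Φ Ψ : Der} {X Y Z : Fm Lit} {a : Lit} (hZ : Z.IsConj a)
    (hΦ : Φ.IsProof KS) (hΨ : Ψ.IsProof KS) (hΦc : Φ.cn = .or X Z) (hΨc : Ψ.cn = .or Y Z) :
    (meet Φ Ψ X Y Z).IsProof KS := by
  refine ⟨⟨trivial, ⟨⟨hΦ.1, hΨ.1⟩, ⟨trivial, ⟨⟨⟨trivial, trivial, swi_mem_KS, .swi _ _ _⟩, trivial⟩,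
    ⟨trivial, contr_isDerivation hZ⟩, eq_mem_KS _, .eq ?_⟩, eq_mem_KS _, .eq ?_⟩,
    swi_mem_KS, ?_⟩, eq_mem_KS _, .eq ?_⟩, rfl⟩
  · simp only [Der.cn, Der.pr, contr_pr hZ]; exact eqTrace_meet₂ X Y Z
  · exact eqTrace_meet₁ X Y Z
  · simp only [Der.cn, Der.pr, hΦc, hΨc]; exact .swi _ _ _
  · simp only [Der.cn, Der.pr, hΦ.2, hΨ.2]; exact .nil (.symm (.and_top _)) rfl

theorem meet_cn {Φ Ψ : Der} {X Y Z : Fm Lit} {a : Lit} (hZ : Z.IsConj a) :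
    (meet Φ Ψ X Y Z).cn = .or (.and X Y) Z := by
  simp [meet, Der.cn, contr_cn hZ]

/-- A proof of `Z ∨ b`, where `Z` is a conjunction of copies of the dual of the literal `b`. -/
def idAtom (b : Fm Lit) : Fm Lit → Der
  | .atom a => .step .aid (.fm .top) (.fm (.or (.atom a) b))
  | .and X Y => meet (idAtom b X) (idAtom b Y) X Y b
  | A => .fm A

theorem idAtom_isProof {a : Lit} {T : Fm Lit} (h : T.IsConj a) :
    (idAtom (.atom a.dual) T).IsProof KS ∧ (idAtom (.atom a.dual) T).cn = .or T (.atom a.dual) := by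
  induction T with
  | atom b => cases h; exact ⟨⟨⟨trivial, trivial, aid_mem_KS, .aid _⟩, rfl⟩, rfl⟩
  | and X Y ihX ihY =>
    have hZ : (Fm.atom a.dual).IsConj a.dual := rfl
    exact ⟨meet_isDerivation hZ (ihX h.1).1 (ihY h.2).1 (ihX h.1).2 (ihY h.2).2, meet_cn hZ⟩
  | _ => cases h

/-- A proof of `X ∨ Z`, where `X` and `Z` are conjunctions of copies of dual literals. -/
def idConj (Z : Fm Lit) : Fm Lit → Der
  | .atom a => .step (.eq (expand [1, 0] [Z, .atom a])) (idAtom (.atom a) Z)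
      (.fm (.or (.atom a) Z))
  | .and X Y => meet (idConj Z X) (idConj Z Y) X Y Z
  | A => .fm A

theorem Lit.dual_dual (a : Lit) : a.dual.dual = a := by simp [Lit.dual]

theorem idConj_isProof {a : Lit} {X Z : Fm Lit} (hX : X.IsConj a) (hZ : Z.IsConj a.dual) :
    (idConj Z X).IsProof KS ∧ (idConj Z X).cn = .or X Z := by
  induction X with
  | atom b =>
    cases hX
    have h := idAtom_isProof hZ
    rw [Lit.dual_dual] at h
    refine ⟨⟨⟨h.1.1, trivial, eq_mem_KS _, .eq ?_⟩, h.1.2⟩, rfl⟩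
    rw [h.2]; exact eqTrace_swap _ _
  | and X Y ihX ihY =>
    exact ⟨meet_isDerivation hZ (ihX hX.1).1 (ihY hX.2).1 (ihX hX.1).2 (ihY hX.2).2, meet_cn hZ⟩
  | _ => cases hX

/-! ### Sizes -/

/-- A medial costs `2 * (|X| + |Y|)` atoms, which the cross term of the square pays for; a leaf
costs three. -/
theorem contr_size {a : Lit} {T : Fm Lit} (h : T.IsConj a) :
    (contr T).size ≤ 3 * T.size * T.size := by
  induction T with
  | atom b => simp [contr, Der.size]
  | and X Y ihX ihY =>
    have h1 := ihX h.1
    have h2 := ihY h.2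
    have h3 := h.1.one_le_size
    have h4 := h.2.one_le_size
    simp only [contr, Der.size, Fm.size_or, Fm.size_and]
    nlinarith
  | _ => cases h

theorem meet_size {Φ Ψ : Der} {X Y Z : Fm Lit} {a : Lit} (hZ : Z.IsConj a) {m : ℕ}
    (h₁ : X.size + Y.size ≤ m) (h₂ : Z.size ≤ m) :
    (meet Φ Ψ X Y Z).size ≤ Φ.size + Ψ.size + 12 * m * m := by
  have h := contr_size hZ
  have := hZ.one_le_size
  simp only [meet, Der.size, Fm.size_or, Fm.size_and, Fm.size_top]
  nlinarith

/-- A bracketing with `n` leaves has `2 * n - 1` nodes, each of which costs at most `12 * m * m`.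
The summand on the left is this `-1`, written without subtraction; the later bounds for recursive
constructions have the same form. -/
theorem idAtom_size {a : Lit} {Z : Fm Lit} (h : Z.IsConj a) {m : ℕ} (hm : Z.size ≤ m) :
    (idAtom (.atom a.dual) Z).size + 12 * m * m ≤ 2 * Z.size * (12 * m * m) := by
  induction Z with
  | atom b =>
    simp only [idAtom, Der.size, Fm.size_or, Fm.size_atom, Fm.size_top] at *
    nlinarith
  | and X Y ihX ihY =>
    have h3 := h.1.one_le_size
    have h4 := h.2.one_le_size
    simp only [Fm.size_and] at hm
    have h1 := ihX h.1 (by omega)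
    have h2 := ihY h.2 (by omega)
    have h5 := meet_size (Φ := idAtom (.atom a.dual) X) (Ψ := idAtom (.atom a.dual) Y)
      (X := X) (Y := Y) (Z := .atom a.dual) (a := a.dual) rfl hm (by simp; omega)
    simp only [idAtom, Fm.size_and]
    nlinarith
  | _ => cases h

/-- A leaf now costs a whole `idAtom`, which is cubic in `m`; an inner node still costs one `meet`.
-/
theorem idConj_size {a : Lit} {X Z : Fm Lit} (hX : X.IsConj a) (hZ : Z.IsConj a.dual) {m : ℕ}
    (hm : X.size ≤ m) (hm' : Z.size ≤ m) :
    (idConj Z X).size + 48 * (m * m * m) ≤ 2 * X.size * (48 * (m * m * m)) := by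
  induction X with
  | atom b =>
    cases hX
    have h := idAtom_size hZ hm'
    rw [Lit.dual_dual] at h
    simp only [idConj, Der.size, Fm.size_or, Fm.size_atom] at *
    have : m ≤ m * m := Nat.le_mul_self m
    have h1 : m * m ≤ m * m * m := Nat.le_mul_of_pos_right _ hm
    have h2 : Z.size * (m * m) ≤ m * (m * m) := Nat.mul_le_mul_right _ hm'
    nlinarith
  | and X Y ihX ihY =>
    simp only [Fm.size_and] at hm
    have h1 := ihX hX.1 (by omega)
    have h2 := ihY hX.2 (by omega)
    have h5 := meet_size (Φ := idConj Z X) (Ψ := idConj Z Y) (X := X) (Y := Y) hZ hm hm'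
    have h6 : m * m ≤ m * m * m :=
      Nat.le_mul_of_pos_right _ (by have := hX.1.one_le_size; omega)
    simp only [idConj, Fm.size_and]
    nlinarith
  | _ => cases hX

/-! ### Lengths -/

theorem Tree.one_le_size (x : Tree) : 1 ≤ x.size := by cases x <;> simp [Tree.size]

theorem Tree.size_ofNat (n : ℕ) : (Tree.ofNat n).size = 2 * n + 1 := by
  induction n with
  | zero => rfl
  | succ n ih =>
    simp only [Tree.ofNat, List.replicate_succ, Tree.ofList, Tree.size] at *
    omega

theorem Tree.size_ofList_le (l : List Tree) (c : ℕ) (h : ∀ x ∈ l, x.size ≤ c) :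
    (Tree.ofList l).size ≤ l.length * (c + 1) + 1 := by
  induction l with
  | nil => simp [Tree.ofList, Tree.size]
  | cons x l ih =>
    have h1 := h x (by simp)
    have h2 := ih fun y hy => h y (by simp [hy])
    simp only [Tree.ofList, Tree.size, List.length_cons, Nat.add_mul]
    omega

theorem EqTrace.perm {A B : Fm Lit} {σ : List ℕ} (h : EqTrace A B σ) :
    σ.Perm (List.range A.size) := by
  obtain ⟨X, Y, ℓ, hs, rfl, -⟩ := h.exists_skel
  rw [Fm.size_map]; exact hs.perm

/-- A tracing is a permutation of the positions of the premiss, and each position is written in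
unary, so the code is quadratic. -/
theorem EqTrace.code_size {A B : Fm Lit} {σ : List ℕ} (h : EqTrace A B σ) {m : ℕ}
    (hm : A.size ≤ m) : (Rule.eq σ).code.size ≤ 20 + m * (2 * m + 2) := by
  have h1 := Tree.size_ofList_le (σ.map Tree.ofNat) (2 * m + 1) (by
    simp only [List.mem_map, forall_exists_index, and_imp, forall_apply_eq_imp_iff₂]
    intro i hi
    have := h.perm.mem_iff.1 hi
    rw [Tree.size_ofNat]
    simp only [List.mem_range] at this
    omega)
  rw [List.length_map, h.perm.length_eq, List.length_range] at h1
  have : A.size * (2 * m + 1 + 1) ≤ m * (2 * m + 2) := Nat.mul_le_mul_right _ hm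
  simp only [Rule.code, Tree.size, Tree.size_ofNat]
  omega

theorem Der.length_fm (A : Fm Lit) : (Der.fm A).length = A.code.size + 2 := by
  simp [Der.length, Der.code, Tree.size, Tree.size_ofNat]; omega

theorem Der.length_and (Φ Ψ : Der) : (Der.and Φ Ψ).length = Φ.length + Ψ.length + 5 := by
  simp [Der.length, Der.code, Tree.size, Tree.size_ofNat]; omega

theorem Der.length_or (Φ Ψ : Der) : (Der.or Φ Ψ).length = Φ.length + Ψ.length + 7 := by
  simp [Der.length, Der.code, Tree.size, Tree.size_ofNat]; omega

theorem Der.length_step (ρ : Rule) (Φ Ψ : Der) :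
    (Der.step ρ Φ Ψ).length = Φ.length + Ψ.length + ρ.code.size + 10 := by
  simp [Der.length, Der.code, Tree.size, Tree.size_ofNat]; omega

theorem Fm.code_size_and (A B : Fm Lit) :
    (Fm.and A B).code.size = A.code.size + B.code.size + 9 := by
  simp [Fm.code, Tree.size, Tree.size_ofNat]; omega

theorem Fm.code_size_or (A B : Fm Lit) :
    (Fm.or A B).code.size = A.code.size + B.code.size + 11 := by
  simp [Fm.code, Tree.size, Tree.size_ofNat]; omega

theorem Rule.code_size_lt : Rule.aid.code.size ≤ 20 ∧ Rule.awd.code.size ≤ 20 ∧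
    Rule.acd.code.size ≤ 20 ∧ Rule.swi.code.size ≤ 20 ∧ Rule.med.code.size ≤ 20 := by
  simp [Rule.code, Tree.size, Tree.size_ofNat]

theorem contr_length {a : Lit} {T : Fm Lit} (h : T.IsConj a) {m : ℕ} (hm : T.code.size ≤ m) :
    (contr T).length + (3 * m + 60) ≤ 2 * T.size * (3 * m + 60) := by
  obtain ⟨-, -, r1, -, r2⟩ := Rule.code_size_lt
  induction T with
  | atom b =>
    simp only [contr, Der.length_step, Der.length_fm, Fm.code_size_or, Fm.size_atom]
    omega
  | and X Y ihX ihY =>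
    rw [Fm.code_size_and] at hm
    have h1 := ihX h.1 (by omega)
    have h2 := ihY h.2 (by omega)
    simp only [contr, Der.length_step, Der.length_fm, Der.length_and, Fm.code_size_or,
      Fm.code_size_and, Fm.size_and]
    nlinarith
  | _ => cases h

/-- A bound for the number of nodes that `meet` adds. -/
def meetLength (m : ℕ) : ℕ := 50 * (m * m) + 200 * m + 400

theorem meet_length {Φ Ψ : Der} {X Y Z : Fm Lit} {a : Lit} (hZ : Z.IsConj a) {m : ℕ}
    (h₁ : (Fm.and X Y).code.size ≤ m) (h₂ : Z.code.size ≤ m) :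
    (meet Φ Ψ X Y Z).length ≤ Φ.length + Ψ.length + meetLength m := by
  obtain ⟨-, -, -, r1, -⟩ := Rule.code_size_lt
  have r2 : (Rule.eq []).code.size ≤ 20 := by
    simp [Rule.code, Tree.size, Tree.size_ofNat, Tree.ofList]
  have h := contr_length hZ h₂
  have hz := Z.size_le_code
  have hxy := (Fm.and X Y).size_le_code
  have e1 := (eqTrace_meet₁ X Y Z).code_size (m := 3 * m) (by
    simp only [Fm.size_and, Fm.size_or] at *; omega)
  have e2 := (eqTrace_meet₂ X Y Z).code_size (m := 3 * m) (by
    simp only [Fm.size_and, Fm.size_or] at *; omega)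
  have : 2 * Z.size * (3 * m + 60) ≤ 2 * m * (3 * m + 60) := Nat.mul_le_mul_right _ (by omega)
  have e3 : Fm.code .top = .cons .nil .nil := rfl
  simp only [meet, Der.length_step, Der.length_fm, Der.length_or, Der.length_and,
    Fm.code_size_or, Fm.code_size_and, meetLength, e3, Tree.size] at *
  ring_nf at *
  omega

theorem idAtom_length {a : Lit} {Z : Fm Lit} (h : Z.IsConj a) {m : ℕ} (hm : Z.code.size ≤ m)
    (hm' : (Fm.atom a.dual).code.size ≤ m) :
    (idAtom (.atom a.dual) Z).length + meetLength m ≤ 2 * Z.size * meetLength m := by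
  obtain ⟨r1, -⟩ := Rule.code_size_lt
  have e3 : Fm.code .top = .cons .nil .nil := rfl
  induction Z with
  | atom b =>
    simp only [idAtom, Der.length_step, Der.length_fm, Fm.code_size_or, Fm.size_atom, e3,
      Tree.size, meetLength] at *
    nlinarith
  | and X Y ihX ihY =>
    have hm2 := hm
    rw [Fm.code_size_and] at hm
    have h1 := ihX h.1 (by omega)
    have h2 := ihY h.2 (by omega)
    have h5 := meet_length (Φ := idAtom (.atom a.dual) X) (Ψ := idAtom (.atom a.dual) Y)
      (X := X) (Y := Y) (Z := .atom a.dual) (a := a.dual) rfl hm2 hm'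
    simp only [idAtom, Fm.size_and]
    nlinarith
  | _ => cases h

theorem idConj_length {a : Lit} {X Z : Fm Lit} (hX : X.IsConj a) (hZ : Z.IsConj a.dual) {m : ℕ}
    (hm : X.code.size ≤ m) (hm' : Z.code.size ≤ m) :
    (idConj Z X).length + (2 * m + 2) * meetLength m ≤
      2 * X.size * ((2 * m + 2) * meetLength m) := by
  induction X with
  | atom b =>
    cases hX
    have h := idAtom_length hZ hm' (by rwa [Lit.dual_dual])
    rw [Lit.dual_dual] at h
    have hz := Z.size_le_code
    have h0 := (Fm.atom a).size_le_code
    have e := (eqTrace_swap Z (.atom a)).code_size (m := 2 * m) (by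
      simp only [Fm.size_or] at *; omega)
    have : 2 * Z.size * meetLength m ≤ 2 * m * meetLength m := Nat.mul_le_mul_right _ (by omega)
    have h1 : 20 + 2 * m * (2 * (2 * m) + 2) + 2 * m + 50 ≤ meetLength m := by
      simp only [meetLength]; nlinarith
    simp only [idConj, Der.length_step, Der.length_fm, Fm.code_size_or, Fm.size_atom] at *
    nlinarith
  | and X Y ihX ihY =>
    have hm2 := hm
    rw [Fm.code_size_and] at hm
    have h1 := ihX hX.1 (by omega)
    have h2 := ihY hX.2 (by omega)
    have h5 := meet_length (Φ := idConj Z X) (Ψ := idConj Z Y) (X := X) (Y := Y) hZ hm2 hm'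
    simp only [idConj, Fm.size_and]
    nlinarith
  | _ => cases hX

/-! ## Decorated flows -/

/-- Data for the edges of a flow: the literal of an edge; a tree of copies of the literal which has
one leaf for each descending path from the edge to the conclusion (`none` if there are none); and
whether the edge descends only from weakenings. -/
structure Deco where
  lab : ℕ → Lit
  tree : ℕ → Option (Fm Lit)
  dead : ℕ → Bool

/-- Conjunction of trees that may be missing. -/
def conj : Option (Fm Lit) → Option (Fm Lit) → Option (Fm Lit)
  | none, y => y
  | some x, none => some x
  | some x, some y => some (.and x y)

/-- The compatibility of literals with a node. -/
def Node.LabOk (lab : ℕ → Lit) : Node → Prop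
  | .aid l r => lab r = (lab l).dual
  | .aiu _ _ => False
  | .acd l r e => lab l = lab e ∧ lab r = lab e
  | .acu e l r => lab l = lab e ∧ lab r = lab e
  | _ => True

/-- The compatibility of a decoration with a node. -/
def Deco.Sat (𝔡 : Deco) : Node → Prop
  -- An identity edge is treated like a weakening if its partner leads nowhere: the partner becomes
  -- ⊤, so this edge may become ⊥.
  | .aid l r => 𝔡.lab r = (𝔡.lab l).dual ∧ 𝔡.dead l = (𝔡.tree r).isNone ∧
      𝔡.dead r = (𝔡.tree l).isNone
  | .aiu _ _ => False
  | .awd e => 𝔡.dead e = true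
  | .awu e => 𝔡.tree e = none
  | .acd l r e => (𝔡.lab l = 𝔡.lab e ∧ 𝔡.lab r = 𝔡.lab e) ∧
      (𝔡.tree l = 𝔡.tree e ∧ 𝔡.tree r = 𝔡.tree e) ∧ 𝔡.dead e = (𝔡.dead l && 𝔡.dead r)
  | .acu e l r => (𝔡.lab l = 𝔡.lab e ∧ 𝔡.lab r = 𝔡.lab e) ∧
      𝔡.tree e = conj (𝔡.tree l) (𝔡.tree r) ∧ 𝔡.dead l = 𝔡.dead e ∧ 𝔡.dead r = 𝔡.dead e

/-- An inference step, premiss and conclusion being given by their edges. -/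
inductive Deco.Local (𝔡 : Deco) : Rule → Fm ℕ → Fm ℕ → Prop
  | aid {l r : ℕ} : 𝔡.Sat (.aid l r) → Local 𝔡 .aid .top (.or (.atom l) (.atom r))
  | awd {e : ℕ} : 𝔡.Sat (.awd e) → Local 𝔡 .awd .bot (.atom e)
  | awu {e : ℕ} : 𝔡.Sat (.awu e) → Local 𝔡 .awu (.atom e) .top
  | acd {l r e : ℕ} : 𝔡.Sat (.acd l r e) → Local 𝔡 .acd (.or (.atom l) (.atom r)) (.atom e)
  | acu {e l r : ℕ} : 𝔡.Sat (.acu e l r) → Local 𝔡 .acu (.atom e) (.and (.atom l) (.atom r))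
  | swi (A B C : Fm ℕ) : Local 𝔡 .swi (.and A (.or B C)) (.or (.and A B) C)
  | med (A B C D : Fm ℕ) :
      Local 𝔡 .med (.or (.and A B) (.and C D)) (.and (.or A C) (.or B D))
  | eq {σ : List ℕ} {X Y : Fm ℕ} (h : EqSkel σ X Y) (ε : ℕ → ℕ) :
      Local 𝔡 (.eq σ) (X.map ε) (Y.map ε)

/-- `Traced 𝔡 Φ E E'`: the derivation `Φ`, premiss and conclusion of which have the edges `E` and
`E'`, is compatible with the decoration `𝔡`. -/
inductive Traced (𝔡 : Deco) : Der → Fm ℕ → Fm ℕ → Prop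
  | fm (E : Fm ℕ) : Traced 𝔡 (.fm (E.map 𝔡.lab)) E E
  | and {Φ Ψ : Der} {E E' F F' : Fm ℕ} : Traced 𝔡 Φ E E' → Traced 𝔡 Ψ F F' →
      Traced 𝔡 (.and Φ Ψ) (.and E F) (.and E' F')
  | or {Φ Ψ : Der} {E E' F F' : Fm ℕ} : Traced 𝔡 Φ E E' → Traced 𝔡 Ψ F F' →
      Traced 𝔡 (.or Φ Ψ) (.or E F) (.or E' F')
  | step {ρ : Rule} {Φ Ψ : Der} {E X Y E' : Fm ℕ} : Traced 𝔡 Φ E X → 𝔡.Local ρ X Y →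
      Traced 𝔡 Ψ Y E' → Traced 𝔡 (.step ρ Φ Ψ) E E'

/-! ### Tracing -/

/-- What is known of a piece of a flow: it has the nodes `ns`, enters with the edges `es` and the
least unused name `k`, and exits with `es'` and `k'`. -/
structure TraceOK (es : List ℕ) (k : ℕ) (lab₀ : ℕ → Lit) (ns : List Node) (es' : List ℕ) (k' : ℕ)
    (lab : ℕ → Lit) : Prop where
  le : k ≤ k'
  agree : ∀ e < k, lab e = lab₀ e
  lt : ∀ e ∈ es', e < k'
  upper_lt : ∀ ν ∈ ns, ∀ e ∈ ν.upper, e < k'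
  lower_lt : ∀ ν ∈ ns, ∀ e ∈ ν.lower, e < k'
  lower : ns.flatMap Node.lower = List.range' k (k' - k)
  -- Conservation of edges: each edge that enters or is created is consumed by exactly one node or
  -- leaves. The order is lost at medial and `=`, hence multisets.
  upper : (↑(ns.flatMap Node.upper) : Multiset ℕ) + ↑es' = ↑es + ↑(List.range' k (k' - k))
  labOk : ∀ ν ∈ ns, ν.LabOk lab
  -- Names grow on the way down, so the flow has no directed cycles and descents are finite.
  incr : ∀ ν ∈ ns, ∀ e ∈ ν.upper, ∀ f ∈ ν.lower, e < f

theorem Node.LabOk.congr {lab lab' : ℕ → Lit} {ν : Node} (h : ν.LabOk lab)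
    (hu : ∀ e ∈ ν.upper, lab' e = lab e) (hl : ∀ e ∈ ν.lower, lab' e = lab e) :
    ν.LabOk lab' := by
  cases ν <;> simp_all [Node.LabOk, Node.upper, Node.lower]

theorem range'_split {k k₁ k₂ : ℕ} (h₁ : k ≤ k₁) (h₂ : k₁ ≤ k₂) :
    List.range' k (k₂ - k) = List.range' k (k₁ - k) ++ List.range' k₁ (k₂ - k₁) := by
  have : k₁ = k + 1 * (k₁ - k) := by omega
  conv_rhs => rw [show List.range' k₁ (k₂ - k₁) = List.range' (k + 1 * (k₁ - k)) (k₂ - k₁) by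
    rw [← this]]
  rw [List.range'_append]
  congr 1; omega

theorem TraceOK.refl (es : List ℕ) (k : ℕ) (lab : ℕ → Lit) (h : ∀ e ∈ es, e < k) :
    TraceOK es k lab [] es k lab := by
  constructor <;> simp_all

theorem TraceOK.par {es fs : List ℕ} {k : ℕ} {lab₀ : ℕ → Lit} {ns₁ es' k₁ lab₁ ns₂ fs' k₂ lab₂}
    (h₁ : TraceOK es k lab₀ ns₁ es' k₁ lab₁) (h₂ : TraceOK fs k₁ lab₁ ns₂ fs' k₂ lab₂) :
    TraceOK (es ++ fs) k lab₀ (ns₁ ++ ns₂) (es' ++ fs') k₂ lab₂ where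
  le := h₁.le.trans h₂.le
  agree e he := (h₂.agree e (he.trans_le h₁.le)).trans (h₁.agree e he)
  lt e he := by
    rcases List.mem_append.1 he with he | he
    · exact (h₁.lt e he).trans_le h₂.le
    · exact h₂.lt e he
  upper_lt ν hν e he := by
    rcases List.mem_append.1 hν with hν | hν
    · exact (h₁.upper_lt ν hν e he).trans_le h₂.le
    · exact h₂.upper_lt ν hν e he
  lower_lt ν hν e he := by
    rcases List.mem_append.1 hν with hν | hν
    · exact (h₁.lower_lt ν hν e he).trans_le h₂.le
    · exact h₂.lower_lt ν hν e he
  lower := by rw [List.flatMap_append, h₁.lower, h₂.lower, range'_split h₁.le h₂.le]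
  upper := by
    rw [range'_split h₁.le h₂.le, List.flatMap_append]
    simp only [← Multiset.coe_add]
    have e₁ := h₁.upper
    have e₂ := h₂.upper
    calc _ = ((ns₁.flatMap Node.upper : Multiset ℕ) + es') +
          ((ns₂.flatMap Node.upper : Multiset ℕ) + fs') := by abel
      _ = _ := by rw [e₁, e₂]; abel
  labOk ν hν := by
    rcases List.mem_append.1 hν with hν | hν
    · exact (h₁.labOk ν hν).congr (fun e he => h₂.agree e (h₁.upper_lt ν hν e he))
        fun e he => h₂.agree e (h₁.lower_lt ν hν e he)
    · exact h₂.labOk ν hν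
  incr ν hν := by
    rcases List.mem_append.1 hν with hν | hν
    · exact h₁.incr ν hν
    · exact h₂.incr ν hν

theorem TraceOK.seq {es fs : List ℕ} {k : ℕ} {lab₀ : ℕ → Lit} {ns₁ k₁ lab₁ ns₂ gs k₂ lab₂}
    (h₁ : TraceOK es k lab₀ ns₁ fs k₁ lab₁) (h₂ : TraceOK fs k₁ lab₁ ns₂ gs k₂ lab₂) :
    TraceOK es k lab₀ (ns₁ ++ ns₂) gs k₂ lab₂ where
  le := h₁.le.trans h₂.le
  agree e he := (h₂.agree e (he.trans_le h₁.le)).trans (h₁.agree e he)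
  lt := h₂.lt
  upper_lt := (h₁.par h₂).upper_lt
  lower_lt := (h₁.par h₂).lower_lt
  lower := (h₁.par h₂).lower
  upper := by
    rw [range'_split h₁.le h₂.le, List.flatMap_append]
    simp only [← Multiset.coe_add]
    have e₁ := h₁.upper
    have e₂ := h₂.upper
    -- The edges between the two pieces leave the first and enter the second; they are added on both
    -- sides and cancelled.
    apply add_right_cancel (b := (fs : Multiset ℕ))
    calc _ = ((ns₁.flatMap Node.upper : Multiset ℕ) + fs) +
          ((ns₂.flatMap Node.upper : Multiset ℕ) + gs) := by abel
      _ = _ := by rw [e₁, e₂]; abel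
  labOk := (h₁.par h₂).labOk
  incr := (h₁.par h₂).incr

theorem map_eq_top {α β : Type} {f : α → β} {A : Fm α} (h : A.map f = .top) : A = .top := by
  cases A <;> simp_all [Fm.map]
theorem map_eq_bot {α β : Type} {f : α → β} {A : Fm α} (h : A.map f = .bot) : A = .bot := by
  cases A <;> simp_all [Fm.map]
theorem map_eq_atom {α β : Type} {f : α → β} {A : Fm α} {b : β} (h : A.map f = .atom b) :
    ∃ a, A = .atom a ∧ f a = b := by
  cases A <;> simp_all [Fm.map]
theorem map_eq_and {α β : Type} {f : α → β} {A : Fm α} {B C : Fm β} (h : A.map f = .and B C) :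
    ∃ B' C', A = .and B' C' ∧ B'.map f = B ∧ C'.map f = C := by
  cases A <;> simp_all [Fm.map]
theorem map_eq_or {α β : Type} {f : α → β} {A : Fm α} {B C : Fm β} (h : A.map f = .or B C) :
    ∃ B' C', A = .or B' C' ∧ B'.map f = B ∧ C'.map f = C := by
  cases A <;> simp_all [Fm.map]

/-- Formulae are determined by their shape and their atoms. -/
theorem Fm.ext_map {α β γ : Type} {f : α → γ} {g : β → γ} {A : Fm α} {B : Fm β}
    (h : A.map f = B.map g) {δ : Type} {u : α → δ} {v : β → δ}
    (h' : A.atoms.map u = B.atoms.map v) : A.map u = B.map v := by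
  induction A generalizing B with
  | top => rw [map_eq_top h.symm]; rfl
  | bot => rw [map_eq_bot h.symm]; rfl
  | atom a =>
    obtain ⟨b, rfl, -⟩ := map_eq_atom h.symm
    simpa [Fm.map, atoms] using h'
  | and A₁ A₂ ih₁ ih₂ =>
    obtain ⟨B₁, B₂, rfl, e₁, e₂⟩ := map_eq_and h.symm
    have hl : A₁.atoms.length = B₁.atoms.length := by
      have := congrArg Fm.size e₁; rw [Fm.size_map, Fm.size_map] at this; exact this.symm
    simp only [atoms, List.map_append] at h'
    have := List.append_inj h' (by simp [hl])
    simp [Fm.map, ih₁ e₁.symm this.1, ih₂ e₂.symm this.2]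
  | or A₁ A₂ ih₁ ih₂ =>
    obtain ⟨B₁, B₂, rfl, e₁, e₂⟩ := map_eq_or h.symm
    have hl : A₁.atoms.length = B₁.atoms.length := by
      have := congrArg Fm.size e₁; rw [Fm.size_map, Fm.size_map] at this; exact this.symm
    simp only [atoms, List.map_append] at h'
    have := List.append_inj h' (by simp [hl])
    simp [Fm.map, ih₁ e₁.symm this.1, ih₂ e₂.symm this.2]

/-- The labelling `lab`, with the literal `a` for the edges from `k` on. -/
def extend (lab : ℕ → Lit) (k : ℕ) (f : ℕ → Lit) : ℕ → Lit := fun e => if e < k then lab e else f e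

theorem extend_lt {lab : ℕ → Lit} {k : ℕ} {f : ℕ → Lit} {e : ℕ} (h : e < k) :
    extend lab k f e = lab e := by simp [extend, h]

/-- A formula of edges is carried through one step: a structural rule creates one node and the other
rules create none. The last clause leaves the decoration open; it only has to respect the new nodes.
-/
theorem Inst.trace_spec {ρ : Rule} {A B : Fm Lit} (h : Inst ρ A B) (hρ : ρ ∈ KSplus) (E : Fm ℕ)
    (k : ℕ) (lab₀ : ℕ → Lit) (hE : E.map lab₀ = A) (hk : ∀ e ∈ E.atoms, e < k) :
    ∃ ns E' k' lab, ρ.trace A E.atoms k = (ns, Fm.atoms E', k') ∧ E'.map lab = B ∧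
      TraceOK E.atoms k lab₀ ns E'.atoms k' lab ∧
      ∀ 𝔡 : Deco, (∀ ν ∈ ns, 𝔡.Sat ν) → 𝔡.Local ρ E E' := by
  cases h with
  | aid a =>
    obtain rfl := map_eq_top hE
    refine ⟨_, .or (.atom k) (.atom (k + 1)), _, extend lab₀ k fun e => if e = k then a else a.dual,
      rfl, ?_, ⟨by omega, fun e he => extend_lt he, ?_, ?_, ?_, ?_, ?_, ?_, ?_⟩,
      fun 𝔡 h𝔡 => .aid (h𝔡 _ (by simp))⟩ <;>
      simp [Fm.map, extend, Fm.atoms, Node.lower, Node.upper, Node.LabOk, List.range']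
  | aiu a => simp [KSplus, KS] at hρ
  | awd a =>
    obtain rfl := map_eq_bot hE
    refine ⟨_, .atom k, _, extend lab₀ k fun _ => a,
      rfl, ?_, ⟨by omega, fun e he => extend_lt he, ?_, ?_, ?_, ?_, ?_, ?_, ?_⟩,
      fun 𝔡 h𝔡 => .awd (h𝔡 _ (by simp))⟩ <;>
      simp [Fm.map, extend, Fm.atoms, Node.lower, Node.upper, Node.LabOk]
  | awu a =>
    obtain ⟨e, rfl, rfl⟩ := map_eq_atom hE
    simp only [Fm.atoms, List.mem_singleton, forall_eq] at hk
    refine ⟨_, .top, _, lab₀,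
      rfl, ?_, ⟨le_rfl, fun e he => rfl, ?_, ?_, ?_, ?_, ?_, ?_, ?_⟩,
      fun 𝔡 h𝔡 => .awu (h𝔡 _ (by simp))⟩ <;>
      simp [Fm.map, Fm.atoms, Node.lower, Node.upper, Node.LabOk, hk]
  | acd a =>
    obtain ⟨_, _, rfl, h₁, h₂⟩ := map_eq_or hE
    obtain ⟨l, rfl, rfl⟩ := map_eq_atom h₁
    obtain ⟨r, rfl, h₃⟩ := map_eq_atom h₂
    simp only [Fm.atoms, List.mem_append, List.mem_singleton, forall_eq_or_imp, forall_eq] at hk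
    refine ⟨_, .atom k, _, extend lab₀ k fun _ => lab₀ l,
      rfl, ?_, ⟨by omega, fun e he => extend_lt he, ?_, ?_, ?_, ?_, ?_, ?_, ?_⟩,
      fun 𝔡 h𝔡 => .acd (h𝔡 _ (by simp))⟩ <;>
      simp [Fm.map, extend, Fm.atoms, Node.lower, Node.upper, Node.LabOk, hk, h₃]
    all_goals omega
  | acu a =>
    obtain ⟨e, rfl, rfl⟩ := map_eq_atom hE
    simp only [Fm.atoms, List.mem_singleton, forall_eq] at hk
    refine ⟨_, .and (.atom k) (.atom (k + 1)), _, extend lab₀ k fun _ => lab₀ e,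
      rfl, ?_, ⟨by omega, fun e he => extend_lt he, ?_, ?_, ?_, ?_, ?_, ?_, ?_⟩,
      fun 𝔡 h𝔡 => .acu (h𝔡 _ (by simp))⟩ <;>
      simp [Fm.map, extend, Fm.atoms, Node.lower, Node.upper, Node.LabOk, List.range', hk]
    all_goals omega
  | swi A B C =>
    obtain ⟨X, _, rfl, hX, h₂⟩ := map_eq_and hE
    obtain ⟨Y, Z, rfl, hY, hZ⟩ := map_eq_or h₂
    refine ⟨[], .or (.and X Y) Z, k, lab₀, by simp [Rule.trace, Fm.atoms],
      by simp [Fm.map, hX, hY, hZ], ?_, fun 𝔡 _ => .swi _ _ _⟩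
    have : (Fm.and X (.or Y Z)).atoms = (Fm.or (.and X Y) Z).atoms := by simp [Fm.atoms]
    rw [← this]; exact .refl _ _ _ hk
  | med A B C D =>
    obtain ⟨_, _, rfl, h₁, h₂⟩ := map_eq_or hE
    obtain ⟨X, Y, rfl, hX, hY⟩ := map_eq_and h₁
    obtain ⟨Z, W, rfl, hZ, hW⟩ := map_eq_and h₂
    refine ⟨[], .and (.or X Z) (.or Y W), k, lab₀, ?_,
      by simp [Fm.map, hX, hY, hZ, hW], ?_, fun 𝔡 _ => .med _ _ _ _⟩
    · have sX : A.size = X.atoms.length := by rw [← hX, Fm.size_map]; rfl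
      have sY : B.size = Y.atoms.length := by rw [← hY, Fm.size_map]; rfl
      have sZ : C.size = Z.atoms.length := by rw [← hZ, Fm.size_map]; rfl
      simp [Rule.trace, Fm.atoms, sX, sY, sZ, ← List.drop_drop]
    · constructor <;> try simp
      · simp only [Fm.atoms] at *; simpa [or_assoc, or_left_comm] using hk
      · simp only [Fm.atoms, List.append_assoc]
        have : List.Perm (X.atoms ++ (Z.atoms ++ (Y.atoms ++ W.atoms)))
          (X.atoms ++ (Y.atoms ++ (Z.atoms ++ W.atoms))) := by
          refine List.Perm.append_left _ ?_
          rw [← List.append_assoc, ← List.append_assoc]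
          exact List.Perm.append_right _ List.perm_append_comm
        exact this
  | @eq _ _ σ h =>
    obtain ⟨X, Y, ℓ, hs, rfl, rfl⟩ := h.exists_skel
    -- The skeleton names positions of the premiss, and `ε` sends a position to the edge found
    -- there. Only positions within the premiss occur, so the default `0` is never reached.
    set ε : ℕ → ℕ := fun i => E.atoms.getD i 0 with hε
    have hsz : E.atoms.length = X.size := by
      have := congrArg Fm.size hE; rwa [Fm.size_map, Fm.size_map] at this
    have hX : X.map ε = E := by
      have : X.map ε = E.map id := by
        refine Fm.ext_map hE.symm ?_
        rw [hs.pr, List.map_id, hε]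
        apply List.ext_getElem <;> simp +contextual [hsz]
      rwa [Fm.map_id] at this
    have hlab : ∀ i < X.size, lab₀ (ε i) = ℓ i := by
      intro i hi
      have h1 := congrArg Fm.atoms hE
      rw [Fm.atoms_map, Fm.atoms_map, hs.pr] at h1
      have h2 := congrArg (fun l : List Lit => l[i]?) h1
      simp [hsz, hi] at h2
      simp only [hε]
      rw [← h2]; simp [hsz, hi]
    refine ⟨[], Y.map ε, k, lab₀, ?_, ?_, ?_, fun 𝔡 _ => ?_⟩
    · simp only [Rule.trace, Fm.atoms_map, hs.cn]; rfl
    · rw [Fm.map_map]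
      refine Fm.map_congr fun i hi => hlab i (hs.lt (hs.cn ▸ hi))
    · have hp : (Y.map ε).atoms.Perm E.atoms := by
        have := (hs.eqv.map ε).perm.symm
        rwa [hX] at this
      have := TraceOK.refl E.atoms k lab₀ hk
      constructor <;> try simp
      · intro e he; exact hk e (hp.mem_iff.1 he)
      · exact hp
    · have := Deco.Local.eq (𝔡 := 𝔡) hs ε
      rwa [hX] at this

/-- The decoration is quantified after the trace, because trees depend on what lies below and
deadness on what lies above: it can be chosen only when the whole flow is known. Labels of old edges
persist since new edges get fresh names. -/
theorem Der.trace_spec (Φ : Der) (hΦ : Φ.IsDerivation KSplus) (E : Fm ℕ) (k : ℕ) (lab₀ : ℕ → Lit)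
    (hE : E.map lab₀ = Φ.pr) (hk : ∀ e ∈ E.atoms, e < k) :
    ∃ ns E' k' lab, Φ.trace E.atoms k = (ns, Fm.atoms E', k') ∧ E'.map lab = Φ.cn ∧
      TraceOK E.atoms k lab₀ ns E'.atoms k' lab ∧
      ∀ 𝔡 : Deco, (∀ e < k', 𝔡.lab e = lab e) → (∀ ν ∈ ns, 𝔡.Sat ν) → Traced 𝔡 Φ E E' := by
  induction Φ generalizing E k lab₀ with
  | fm A =>
    refine ⟨[], E, k, lab₀, rfl, hE, .refl _ _ _ hk, fun 𝔡 h𝔡 _ => ?_⟩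
    have : A = E.map 𝔡.lab := by
      have hE' : E.map lab₀ = A := hE
      rw [← hE']; exact Fm.map_congr fun e he => (h𝔡 e (hk e he)).symm
    rw [this]; exact .fm E
  | and Φ Ψ ih₁ ih₂ =>
    obtain ⟨F, G, rfl, hF, hG⟩ := map_eq_and hE
    simp only [Fm.atoms, List.mem_append] at hk
    obtain ⟨ns₁, F', k₁, lab₁, t₁, c₁, o₁, T₁⟩ := ih₁ hΦ.1 F k lab₀ hF fun e he => hk e (.inl he)
    have hG' : G.map lab₁ = Ψ.pr := by
      rw [← hG]; exact Fm.map_congr fun e he => o₁.agree e (hk e (.inr he))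
    obtain ⟨ns₂, G', k₂, lab₂, t₂, c₂, o₂, T₂⟩ := ih₂ hΦ.2 G k₁ lab₁ hG'
      fun e he => (hk e (.inr he)).trans_le o₁.le
    have hs : Φ.pr.size = F.atoms.length := by rw [← hF, Fm.size_map]; rfl
    refine ⟨ns₁ ++ ns₂, .and F' G', k₂, lab₂, ?_, ?_, o₁.par o₂, fun 𝔡 h𝔡 hn => .and ?_ ?_⟩
    · simp [Der.trace, Fm.atoms, hs, t₁, t₂]
    · have : F'.map lab₂ = F'.map lab₁ := Fm.map_congr fun e he => o₂.agree e (o₁.lt e he)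
      simp [Fm.map, Der.cn, c₂, this, c₁]
    · exact T₁ 𝔡 (fun e he => (h𝔡 e (he.trans_le o₂.le)).trans (o₂.agree e he))
        fun ν hν => hn ν (by simp [hν])
    · exact T₂ 𝔡 h𝔡 fun ν hν => hn ν (by simp [hν])
  | or Φ Ψ ih₁ ih₂ =>
    obtain ⟨F, G, rfl, hF, hG⟩ := map_eq_or hE
    simp only [Fm.atoms, List.mem_append] at hk
    obtain ⟨ns₁, F', k₁, lab₁, t₁, c₁, o₁, T₁⟩ := ih₁ hΦ.1 F k lab₀ hF fun e he => hk e (.inl he)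
    have hG' : G.map lab₁ = Ψ.pr := by
      rw [← hG]; exact Fm.map_congr fun e he => o₁.agree e (hk e (.inr he))
    obtain ⟨ns₂, G', k₂, lab₂, t₂, c₂, o₂, T₂⟩ := ih₂ hΦ.2 G k₁ lab₁ hG'
      fun e he => (hk e (.inr he)).trans_le o₁.le
    have hs : Φ.pr.size = F.atoms.length := by rw [← hF, Fm.size_map]; rfl
    refine ⟨ns₁ ++ ns₂, .or F' G', k₂, lab₂, ?_, ?_, o₁.par o₂, fun 𝔡 h𝔡 hn => .or ?_ ?_⟩
    · simp [Der.trace, Fm.atoms, hs, t₁, t₂]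
    · have : F'.map lab₂ = F'.map lab₁ := Fm.map_congr fun e he => o₂.agree e (o₁.lt e he)
      simp [Fm.map, Der.cn, c₂, this, c₁]
    · exact T₁ 𝔡 (fun e he => (h𝔡 e (he.trans_le o₂.le)).trans (o₂.agree e he))
        fun ν hν => hn ν (by simp [hν])
    · exact T₂ 𝔡 h𝔡 fun ν hν => hn ν (by simp [hν])
  | step ρ Φ Ψ ih₁ ih₂ =>
    obtain ⟨d₁, d₂, hρ, hi⟩ := hΦ
    obtain ⟨ns₁, X, k₁, lab₁, t₁, c₁, o₁, T₁⟩ := ih₁ d₁ E k lab₀ hE hk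
    obtain ⟨ns₂, Y, k₂, lab₂, t₂, c₂, o₂, T₂⟩ := hi.trace_spec hρ X k₁ lab₁ c₁ o₁.lt
    obtain ⟨ns₃, Z, k₃, lab₃, t₃, c₃, o₃, T₃⟩ := ih₂ d₂ Y k₂ lab₂ c₂ o₂.lt
    refine ⟨ns₁ ++ ns₂ ++ ns₃, Z, k₃, lab₃, ?_, c₃, (o₁.seq o₂).seq o₃,
      fun 𝔡 h𝔡 hn => .step (T₁ 𝔡 ?_ ?_) (T₂ 𝔡 ?_) (T₃ 𝔡 h𝔡 ?_)⟩
    · simp [Der.trace, t₁, t₂, t₃]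
    · intro e he
      rw [h𝔡 e ((he.trans_le o₂.le).trans_le o₃.le), o₃.agree e (he.trans_le o₂.le), o₂.agree e he]
    all_goals exact fun ν hν => hn ν (by simp [hν])

/-! ### Descending paths -/

/-- Descending paths in a flow with the nodes `ns`, from an edge to a pending lower end. -/
inductive DownPath (ns : List Node) : ℕ → List ℕ → Prop
  | pend {e : ℕ} : (∀ ν ∈ ns, e ∉ ν.upper) → DownPath ns e [e]
  | step {ν : Node} {e f : ℕ} {π : List ℕ} : ν ∈ ns → e ∈ ν.upper → f ∈ ν.lower →
      DownPath ns f π → DownPath ns e (e :: π)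

theorem DownPath.head {ns : List Node} {e : ℕ} {π : List ℕ} (h : DownPath ns e π) :
    ∃ π', π = e :: π' := by
  cases h <;> exact ⟨_, rfl⟩

/-- The tree of an edge, computed by `n` steps down the flow. -/
def treeAux (ns : List Node) (lab : ℕ → Lit) : ℕ → ℕ → Option (Fm Lit)
  -- A junk value: names increase on each descent, so `K` steps are enough for every edge below `K`.
  | 0, _ => none
  | n + 1, e =>
    match ns.find? (fun ν => decide (e ∈ ν.upper)) with
    | none => some (.atom (lab e))
    | some (.acd _ _ x) => treeAux ns lab n x
    | some (.acu _ l r) => conj (treeAux ns lab n l) (treeAux ns lab n r)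
    -- In flows of `KSplus` proofs, only a coweakening can occur here.
    | some _ => none

theorem mem_find {ns : List Node} {e : ℕ} {ν : Node}
    (h : ns.find? (fun ν => decide (e ∈ ν.upper)) = some ν) : ν ∈ ns ∧ e ∈ ν.upper :=
  ⟨List.mem_of_find?_eq_some h, by simpa using List.find?_some h⟩

theorem find_eq_none {ns : List Node} {e : ℕ} :
    ns.find? (fun ν => decide (e ∈ ν.upper)) = none ↔ ∀ ν ∈ ns, e ∉ ν.upper := by
  simp

theorem treeAux_isConj {ns : List Node} {lab : ℕ → Lit} (hl : ∀ ν ∈ ns, ν.LabOk lab) (n e : ℕ)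
    (T : Fm Lit) (h : treeAux ns lab n e = some T) : T.IsConj (lab e) := by
  induction n generalizing e T with
  | zero => simp [treeAux] at h
  | succ n ih =>
    rw [treeAux] at h
    split at h
    · cases h; rfl
    · rename_i l r x hf
      obtain ⟨hm, he⟩ := mem_find hf
      have h1 := hl _ hm
      have h2 := ih _ _ h
      simp only [Node.upper, List.mem_cons, List.not_mem_nil, or_false] at he
      rcases he with rfl | rfl
      · rwa [h1.1]
      · rwa [h1.2]
    · rename_i e' l r hf
      obtain ⟨hm, he⟩ := mem_find hf
      simp only [Node.upper, List.mem_cons, List.not_mem_nil, or_false] at he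
      subst he
      have h1 := hl _ hm
      revert h
      cases h₁ : treeAux ns lab n l <;> cases h₂ : treeAux ns lab n r <;> intro h <;> cases h
      · rw [← h1.2]; exact ih _ _ h₂
      · rw [← h1.1]; exact ih _ _ h₁
      · exact ⟨h1.1 ▸ ih _ _ h₁, h1.2 ▸ ih _ _ h₂⟩
    · cases h

/-- The leaves of the tree correspond to descending paths. At a cocontraction the two families of
paths are disjoint, since their second edges differ. -/
theorem treeAux_paths {ns : List Node} {lab : ℕ → Lit}
    (hl : ∀ ν ∈ ns, ν.lower.Nodup) (n e : ℕ) (T : Fm Lit) (h : treeAux ns lab n e = some T) :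
    ∃ F : Finset (List ℕ), F.card = T.size ∧ ∀ π ∈ F, DownPath ns e π := by
  induction n generalizing e T with
  | zero => simp [treeAux] at h
  | succ n ih =>
    rw [treeAux] at h
    have lift : ∀ (f : ℕ) (ν : Node) (U : Fm Lit), ν ∈ ns → e ∈ ν.upper → f ∈ ν.lower →
        treeAux ns lab n f = some U → ∃ F : Finset (List ℕ), F.card = U.size ∧
          ∀ π ∈ F, DownPath ns e π ∧ ∃ π', π = e :: f :: π' := by
      intro f ν U hν he hf hU
      obtain ⟨F, hF, hp⟩ := ih f U hU
      refine ⟨F.image (List.cons e), ?_, ?_⟩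
      · rw [Finset.card_image_of_injective _ List.cons_injective, hF]
      · intro π hπ
        obtain ⟨π', hπ', rfl⟩ := Finset.mem_image.1 hπ
        obtain ⟨π'', rfl⟩ := (hp _ hπ').head
        exact ⟨.step hν he hf (hp _ hπ'), _, rfl⟩
    split at h
    · rename_i hf
      cases h
      exact ⟨{[e]}, by simp, by simpa using DownPath.pend (find_eq_none.1 hf)⟩
    · rename_i l r x hf
      obtain ⟨hm, he⟩ := mem_find hf
      obtain ⟨F, hF, hp⟩ := lift x _ T hm he (by simp [Node.lower]) h
      exact ⟨F, hF, fun π hπ => (hp π hπ).1⟩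
    · rename_i e' l r hf
      obtain ⟨hm, he⟩ := mem_find hf
      have hlr : l ≠ r := by have := hl _ hm; simpa [Node.lower] using this
      revert h
      cases h₁ : treeAux ns lab n l <;> cases h₂ : treeAux ns lab n r <;> intro h <;> cases h
      · obtain ⟨F, hF, hp⟩ := lift r _ _ hm he (by simp [Node.lower]) h₂
        exact ⟨F, hF, fun π hπ => (hp π hπ).1⟩
      · obtain ⟨F, hF, hp⟩ := lift l _ _ hm he (by simp [Node.lower]) h₁
        exact ⟨F, hF, fun π hπ => (hp π hπ).1⟩
      · obtain ⟨F, hF, hp⟩ := lift l _ _ hm he (by simp [Node.lower]) h₁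
        obtain ⟨G, hG, hq⟩ := lift r _ _ hm he (by simp [Node.lower]) h₂
        refine ⟨F ∪ G, ?_, ?_⟩
        · rw [Finset.card_union_of_disjoint, hF, hG, Fm.size_and]
          rw [Finset.disjoint_left]
          intro π h1 h2
          obtain ⟨-, _, rfl⟩ := hp _ h1
          obtain ⟨-, _, h3⟩ := hq _ h2
          exact hlr (by simpa using h3 : l = r ∧ _).1
        · intro π hπ
          rcases Finset.mem_union.1 hπ with hπ | hπ
          · exact (hp π hπ).1
          · exact (hq π hπ).1
    · cases h

/-- What is known of the flow of a proof: the nodes are `ns`, the edges are less than `K`. -/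
structure FlowOK (ns : List Node) (K : ℕ) (lab : ℕ → Lit) : Prop where
  upper_lt : ∀ ν ∈ ns, ∀ e ∈ ν.upper, e < K
  lower_lt : ∀ ν ∈ ns, ∀ e ∈ ν.lower, e < K
  upper : (ns.flatMap Node.upper).Nodup
  lower : (ns.flatMap Node.lower).Nodup
  labOk : ∀ ν ∈ ns, ν.LabOk lab
  incr : ∀ ν ∈ ns, ∀ e ∈ ν.upper, ∀ f ∈ ν.lower, e < f

section

variable {ns : List Node} {K : ℕ} {lab : ℕ → Lit}

theorem DownPath.le (h : FlowOK ns K lab) {e : ℕ} {π : List ℕ} (hπ : DownPath ns e π) :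
    ∀ x ∈ π, e ≤ x := by
  induction hπ with
  | pend => simp
  | step hν he hf _ ih =>
    intro x hx
    rcases List.mem_cons.1 hx with rfl | hx
    · exact le_rfl
    · exact (h.incr _ hν _ he _ hf).le.trans (ih x hx)

theorem DownPath.nodup (h : FlowOK ns K lab) {e : ℕ} {π : List ℕ} (hπ : DownPath ns e π) :
    π.Nodup := by
  induction hπ with
  | pend => simp
  | step hν he hf hπ ih =>
    refine List.nodup_cons.2 ⟨fun hx => ?_, ih⟩
    have := hπ.le h _ hx
    have := h.incr _ hν _ he _ hf
    omega

theorem DownPath.lt (h : FlowOK ns K lab) {e : ℕ} {π : List ℕ} (hπ : DownPath ns e π) (he : e < K) :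
    ∀ x ∈ π, x < K := by
  induction hπ with
  | pend => simpa
  | step hν _ hf _ ih =>
    simp only [List.mem_cons, forall_eq_or_imp]
    exact ⟨he, ih (h.lower_lt _ hν _ hf)⟩

/-- The only nodes with edges both above and below are contractions and cocontractions, and these
preserve the literal. -/
theorem DownPath.lab_eq (h : FlowOK ns K lab) {e : ℕ} {π : List ℕ} (hπ : DownPath ns e π) :
    ∀ x ∈ π, lab x = lab e := by
  induction hπ with
  | pend => simp
  | @step ν e f π hν he hf _ ih =>
    simp only [List.mem_cons, forall_eq_or_imp, true_and]
    intro x hx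
    rw [ih x hx]
    have := h.labOk _ hν
    cases ν <;> simp_all [Node.upper, Node.lower, Node.LabOk]
    · rcases he with rfl | rfl <;> simp [this]
    · rcases hf with rfl | rfl <;> simp [this]

theorem DownPath.chain {e : ℕ} {π : List ℕ} (hπ : DownPath ns e π) :
    π.IsChain (fun e f => ∃ ν ∈ ns, e ∈ ν.upper ∧ f ∈ ν.lower) := by
  induction hπ with
  | pend => simp
  | step hν he hf hπ ih =>
    obtain ⟨π', rfl⟩ := hπ.head
    exact List.isChain_cons_cons.2 ⟨⟨_, hν, he, hf⟩, ih⟩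

theorem DownPath.last {e : ℕ} {π : List ℕ} (hπ : DownPath ns e π) :
    ∀ x ∈ π.getLast?, ∀ ν ∈ ns, x ∉ ν.upper := by
  induction hπ with
  | pend h => simpa using h
  | step hν he hf hπ ih =>
    obtain ⟨π', rfl⟩ := hπ.head
    simpa using ih

/-! ### Open paths -/

/-- The path that ascends along `p` and then descends along `q`. -/
def bent (p q : List ℕ) : List (ℕ × Dir) :=
  (p.map fun e => (e, Dir.up)).reverse ++ q.map fun e => (e, Dir.down)

theorem inversion_bent (p q : List ℕ) : inversion (bent p q) = bent q p := by
  simp [inversion, bent, Dir.flip, Function.comp_def]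

/-- Whether a direction is upwards. -/
def Dir.isUp : Dir → Bool
  | .up => true
  | .down => false

/-- The directions show where the path turns. -/
theorem bent_inj {p q p' q' : List ℕ} (h : bent p q = bent p' q') : p = p' ∧ q = q' := by
  have h₁ := congrArg (List.filter fun x => x.2.isUp) h
  have h₂ := congrArg (List.filter fun x => !x.2.isUp) h
  simp [bent, Dir.isUp, List.filter_append, List.filter_map, Function.comp_def,
    List.filter_reverse] at h₁ h₂
  have i : ∀ d : Dir, Function.Injective fun e : ℕ => (e, d) := fun d a b hab => by
    simpa using hab
  exact ⟨List.map_injective_iff.2 (i _) h₁, List.map_injective_iff.2 (i _) h₂⟩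

/-- The branches below the two edges of an identity carry dual literals, so they share no edge; and
no branch repeats an edge, because names increase along it. Hence the path is simple. The argument
is symmetric in the two edges, which gives the inversion as well. -/
theorem bent_isOpen (h : FlowOK ns K lab) {l r : ℕ} (hν : Node.aid l r ∈ ns) {p q : List ℕ}
    (hp : DownPath ns l p) (hq : DownPath ns r q) :
    (Flow.mk K ns).IsOpenAiPath (bent p q) ∧ (Flow.mk K ns).IsOpenAiPath (bent q p) := by
  have hlr : lab l ≠ lab r := by
    rw [(h.labOk _ hν : lab r = _)]
    intro e
    have := congrArg Lit.pos e
    simp [Lit.dual] at this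
  have key : ∀ {l r : ℕ} {p q : List ℕ}, lab l ≠ lab r → l < K → r < K →
      (Node.aid l r ∈ ns ∨ Node.aid r l ∈ ns) → DownPath ns l p → DownPath ns r q →
      (Flow.mk K ns).IsAiPath (bent p q) ∧
        ∀ x ∈ (bent p q).head?, (Flow.mk K ns).StartPending x := by
    intro l r p q hlr hl hr hν hp hq
    obtain ⟨p', rfl⟩ := hp.head
    obtain ⟨q', rfl⟩ := hq.head
    refine ⟨⟨by simp [bent], ?_, ?_, ?_⟩, ?_⟩
    · intro x hx
      simp only [bent, List.mem_append, List.mem_reverse, List.mem_map] at hx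
      rcases hx with ⟨e, he, rfl⟩ | ⟨e, he, rfl⟩
      · exact hp.lt h hl e he
      · exact hq.lt h hr e he
    · simp only [bent, List.map_append, List.map_reverse, List.map_map, Function.comp_def,
        List.map_id']
      rw [List.nodup_append]
      refine ⟨List.nodup_reverse.2 (hp.nodup h), hq.nodup h, ?_⟩
      rintro a ha b hb rfl
      rw [List.mem_reverse] at ha
      exact hlr ((hp.lab_eq h _ ha).symm.trans (hq.lab_eq h _ hb))
    · rw [bent, List.isChain_append]
      refine ⟨?_, ?_, ?_⟩
      · rw [List.isChain_reverse, List.isChain_map]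
        exact hp.chain.imp fun a b hab => by
          obtain ⟨ν, h1, h2, h3⟩ := hab; exact ⟨ν, h1, h3, h2⟩
      · rw [List.isChain_map]
        exact hq.chain
      · simpa [Flow.Next] using hν
    · have := hp.last
      simp only [bent, List.head?_append, List.head?_reverse, List.getLast?_map]
      cases hg : (l :: p').getLast? with
      | none => simp at hg
      | some a => simpa [Flow.StartPending] using this a hg
  have hl := h.lower_lt _ hν l (by simp [Node.lower])
  have hr := h.lower_lt _ hν r (by simp [Node.lower])
  have k₁ := key hlr hl hr (.inl hν) hp hq
  have k₂ := key hlr.symm hr hl (.inr hν) hq hp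
  exact ⟨⟨k₁.1, k₁.2, by rw [inversion_bent]; exact k₂.2⟩,
    ⟨k₂.1, k₂.2, by rw [inversion_bent]; exact k₁.2⟩⟩

theorem Dir.finite : Finite Dir :=
  Finite.of_injective Dir.isUp fun a b h => by cases a <;> cases b <;> simp_all [Dir.isUp]

/-- `Set.ncard` of an infinite set is `0`, so a lower bound for the number of open paths requires
finiteness. Simple paths have length at most the number of edges. -/
theorem Flow.finite_isOpenAiPath (φ : Flow) : {π | φ.IsOpenAiPath π}.Finite := by
  have := Dir.finite
  let f : Fin φ.edges × Dir → ℕ × Dir := Prod.map Fin.val id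
  refine ((List.finite_length_le (Fin φ.edges × Dir) φ.edges).image (List.map f)).subset ?_
  intro π hπ
  have h := hπ.1
  have : π ∈ Set.range (List.map f) := by
    rw [Set.range_list_map]
    intro x hx
    exact ⟨(⟨x.1, h.edge_lt x hx⟩, x.2), rfl⟩
  obtain ⟨π', rfl⟩ := this
  refine ⟨π', ?_, rfl⟩
  have hs := h.simple
  rw [List.map_map] at hs
  have h2 : (π'.map Prod.fst).Nodup := by
    refine List.Nodup.of_map Fin.val ?_
    rw [List.map_map]; exact hs
  have := h2.length_le_card
  simpa using this

/-- A pair of descents, one from each edge of the identity, is an open path. Counting modulo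
inversion loses nothing, as the edges `l` and `r` are different and mark the two halves. -/
theorem mul_le_numOpenAiPaths (h : FlowOK ns K lab) {l r : ℕ} (hν : Node.aid l r ∈ ns)
    {F G : Finset (List ℕ)} (hF : ∀ p ∈ F, DownPath ns l p) (hG : ∀ q ∈ G, DownPath ns r q) :
    F.card * G.card ≤ (Flow.mk K ns).numOpenAiPaths := by
  classical
  have hlr : l ≠ r := by
    rintro rfl
    have e := (h.labOk _ hν : lab l = _)
    have := congrArg Lit.pos e
    simp [Lit.dual] at this
  rw [← Finset.card_product, Flow.numOpenAiPaths]
  rw [← Finset.card_image_of_injOn (s := F ×ˢ G)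
    (f := fun x => s(bent x.1 x.2, bent x.2 x.1)), ← Set.ncard_coe_finset]
  · refine Set.ncard_le_ncard ?_ ((Flow.finite_isOpenAiPath _).image _)
    intro y hy
    simp only [Finset.coe_image, Set.mem_image, Finset.mem_coe, Finset.mem_product] at hy
    obtain ⟨⟨p, q⟩, ⟨hp, hq⟩, rfl⟩ := hy
    exact ⟨bent p q, (bent_isOpen h hν (hF p hp) (hG q hq)).1, by simp only [inversion_bent]⟩
  · rintro ⟨p, q⟩ hx ⟨p', q'⟩ hx' he
    simp only [Finset.coe_product, Set.mem_prod, Finset.mem_coe] at hx hx'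
    simp only [Sym2.eq_iff] at he
    rcases he with ⟨he, -⟩ | ⟨he, -⟩
    · obtain ⟨rfl, rfl⟩ := bent_inj he; rfl
    -- If one path were the inversion of the other, the same descent would start both at `l` and at
    -- `r`.
    · obtain ⟨rfl, rfl⟩ := bent_inj he
      obtain ⟨_, e₁⟩ := (hF _ hx.1).head
      obtain ⟨_, e₂⟩ := (hG _ hx'.2).head
      rw [e₁] at e₂
      exact absurd (List.cons.inj e₂).1 hlr

/-! ### The decoration of a flow -/

theorem eq_of_mem_flatMap {f : Node → List ℕ} (h : (ns.flatMap f).Nodup) {μ ν : Node}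
    (hμ : μ ∈ ns) (hν : ν ∈ ns) {e : ℕ} (h₁ : e ∈ f μ) (h₂ : e ∈ f ν) : μ = ν := by
  by_contra hne
  have := (List.nodup_flatMap.1 h).2
  have inst : Std.Symm (Function.onFun List.Disjoint f) := ⟨fun _ _ hd => List.Disjoint.symm hd⟩
  have := this.forall hμ hν hne
  exact this h₁ h₂

theorem find_eq_some (h : FlowOK ns K lab) {ν : Node} (hν : ν ∈ ns) {e : ℕ} (he : e ∈ ν.upper) :
    ns.find? (fun ν => decide (e ∈ ν.upper)) = some ν := by
  cases hf : ns.find? (fun ν => decide (e ∈ ν.upper)) with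
  | none => exact absurd he (find_eq_none.1 hf ν hν)
  | some μ =>
    obtain ⟨h1, h2⟩ := mem_find hf
    rw [eq_of_mem_flatMap h.upper h1 hν h2 he]

/-- Each step down increases the name, which stays below `K`, so `K - e` steps from `e` suffice and
further ones change nothing. -/
theorem treeAux_stable (h : FlowOK ns K lab) (n m e : ℕ) (he : e < K) (hn : K ≤ n + e)
    (hm : K ≤ m + e) : treeAux ns lab n e = treeAux ns lab m e := by
  induction n generalizing m e with
  | zero => omega
  | succ n ih =>
    obtain ⟨m, rfl⟩ : ∃ m', m = m' + 1 := ⟨m - 1, by omega⟩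
    rw [treeAux, treeAux]
    have go : ∀ ν x, ns.find? (fun ν => decide (e ∈ ν.upper)) = some ν → x ∈ ν.lower →
        treeAux ns lab n x = treeAux ns lab m x := by
      intro ν x hf hx
      obtain ⟨h1, h2⟩ := mem_find hf
      have := h.incr _ h1 _ h2 _ hx
      exact ih m x (h.lower_lt _ h1 _ hx) (by omega) (by omega)
    split
    · rfl
    · rename_i hf; exact go _ _ hf (by simp [Node.lower])
    · rename_i hf
      rw [go _ _ hf (by simp [Node.lower]), go _ _ hf (by simp [Node.lower])]
    · rfl

/-- Edges that descend from an identity the other edge of which leads to the conclusion. -/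
inductive Live (ns : List Node) (tree : ℕ → Option (Fm Lit)) : ℕ → Prop
  | aid_left {l r : ℕ} : Node.aid l r ∈ ns → (tree r).isSome → Live ns tree l
  | aid_right {l r : ℕ} : Node.aid l r ∈ ns → (tree l).isSome → Live ns tree r
  | acd_left {l r e : ℕ} : Node.acd l r e ∈ ns → Live ns tree l → Live ns tree e
  | acd_right {l r e : ℕ} : Node.acd l r e ∈ ns → Live ns tree r → Live ns tree e
  | acu_left {e l r : ℕ} : Node.acu e l r ∈ ns → Live ns tree e → Live ns tree l
  | acu_right {e l r : ℕ} : Node.acu e l r ∈ ns → Live ns tree e → Live ns tree r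

/-- The possible reasons for an edge below a node to be live. -/
def Node.LiveBelow (ns : List Node) (tree : ℕ → Option (Fm Lit)) (e : ℕ) : Node → Prop
  | .aid l r => e = l ∧ (tree r).isSome ∨ e = r ∧ (tree l).isSome
  | .acd l r _ => Live ns tree l ∨ Live ns tree r
  | .acu e' _ _ => Live ns tree e'
  | _ => False

theorem Live.exists_node {tree : ℕ → Option (Fm Lit)} {e : ℕ} (h : Live ns tree e) :
    ∃ ν ∈ ns, e ∈ ν.lower ∧ ν.LiveBelow ns tree e := by
  cases h with
  | aid_left hν h => exact ⟨_, hν, by simp [Node.lower], .inl ⟨rfl, h⟩⟩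
  | aid_right hν h => exact ⟨_, hν, by simp [Node.lower], .inr ⟨rfl, h⟩⟩
  | acd_left hν h => exact ⟨_, hν, by simp [Node.lower], .inl h⟩
  | acd_right hν h => exact ⟨_, hν, by simp [Node.lower], .inr h⟩
  | acu_left hν h => exact ⟨_, hν, by simp [Node.lower], h⟩
  | acu_right hν h => exact ⟨_, hν, by simp [Node.lower], h⟩

open Classical in
/-- The decoration of a flow. -/
noncomputable def decoration (ns : List Node) (K : ℕ) (lab : ℕ → Lit) : Deco where
  lab := lab
  tree := treeAux ns lab K
  -- `Live` is inductive, hence the least solution: an edge is dead unless some identity with a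
  -- useful partner really stands above it.
  dead e := decide (¬ Live ns (treeAux ns lab K) e)

theorem treeAux_acd (h : FlowOK ns K lab) {l r e : ℕ} (hν : Node.acd l r e ∈ ns) :
    treeAux ns lab K l = treeAux ns lab K e ∧ treeAux ns lab K r = treeAux ns lab K e := by
  have key : ∀ x ∈ (Node.acd l r e).upper, treeAux ns lab K x = treeAux ns lab K e := by
    intro x hx
    have hxK := h.upper_lt _ hν x hx
    have hxe := h.incr _ hν x hx e (by simp [Node.lower])
    obtain ⟨n, rfl⟩ : ∃ n, K = n + 1 := ⟨K - 1, by omega⟩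
    conv_lhs => rw [treeAux, find_eq_some h hν hx]
    exact treeAux_stable h _ _ e (h.lower_lt _ hν e (by simp [Node.lower])) (by omega) (by omega)
  exact ⟨key _ (by simp [Node.upper]), key _ (by simp [Node.upper])⟩

theorem treeAux_acu (h : FlowOK ns K lab) {l r e : ℕ} (hν : Node.acu e l r ∈ ns) :
    treeAux ns lab K e = conj (treeAux ns lab K l) (treeAux ns lab K r) := by
  have hx : e ∈ (Node.acu e l r).upper := by simp [Node.upper]
  have hxK := h.upper_lt _ hν e hx
  have key : ∀ n, K = n + 1 → ∀ x ∈ (Node.acu e l r).lower,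
      treeAux ns lab n x = treeAux ns lab K x := by
    intro n hn x hxl
    have hxe := h.incr _ hν e hx x hxl
    exact treeAux_stable h _ _ x (h.lower_lt _ hν x hxl) (by omega) (by omega)
  obtain ⟨n, rfl⟩ : ∃ n, K = n + 1 := ⟨K - 1, by omega⟩
  conv_lhs => rw [treeAux, find_eq_some h hν hx]
  simp only
  rw [key n rfl l (by simp [Node.lower]), key n rfl r (by simp [Node.lower])]

theorem treeAux_awu (h : FlowOK ns K lab) {e : ℕ} (hν : Node.awu e ∈ ns) :
    treeAux ns lab K e = none := by
  have hx : e ∈ (Node.awu e).upper := by simp [Node.upper]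
  have hxK := h.upper_lt _ hν e hx
  obtain ⟨n, rfl⟩ : ∃ n, K = n + 1 := ⟨K - 1, by omega⟩
  rw [treeAux, find_eq_some h hν hx]

/-- An edge is below at most one node. Therefore `Live` can be inverted at that node, and the
implications that define it become the equations required of `dead`. For trees, the uniqueness of
the node beneath an edge plays the same role. -/
theorem decoration_sat (h : FlowOK ns K lab) : ∀ ν ∈ ns, (decoration ns K lab).Sat ν := by
  intro ν hν
  have below : ∀ e ∈ ν.lower, Live ns (treeAux ns lab K) e →
      ν.LiveBelow ns (treeAux ns lab K) e := by
    intro e he hL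
    obtain ⟨μ, hμ, h₁, h₂⟩ := hL.exists_node
    rwa [← eq_of_mem_flatMap h.lower hμ hν h₁ he]
  have hl := h.labOk _ hν
  have hnd : ν.lower.Nodup := (List.nodup_flatMap.1 h.lower).1 ν hν
  have iso : ∀ e, (treeAux ns lab K e).isNone = decide (¬ (treeAux ns lab K e).isSome) := by
    intro e; cases treeAux ns lab K e <;> rfl
  cases ν with
  | aiu l r => exact hl
  | awu e => exact treeAux_awu h hν
  | awd e =>
    simp only [Deco.Sat, decoration, decide_eq_true_eq]
    exact below e (by simp [Node.lower])
  | aid l r =>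
    simp only [Node.lower, List.nodup_cons, List.mem_singleton] at hnd
    simp only [Deco.Sat, decoration, iso, decide_eq_decide, not_iff_not]
    refine ⟨hl, ⟨fun hL => ?_, .aid_left hν⟩, ⟨fun hL => ?_, .aid_right hν⟩⟩
    · exact (below l (by simp [Node.lower]) hL).elim And.right fun h => absurd h.1 hnd.1
    · exact (below r (by simp [Node.lower]) hL).elim (fun h => absurd h.1.symm hnd.1) And.right
  | acd l r e =>
    refine ⟨hl, treeAux_acd h hν, ?_⟩
    have : Live ns (treeAux ns lab K) e ↔
        Live ns (treeAux ns lab K) l ∨ Live ns (treeAux ns lab K) r :=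
      ⟨below e (by simp [Node.lower]), fun hL => hL.elim (.acd_left hν) (.acd_right hν)⟩
    simp only [decoration]
    rw [Bool.eq_iff_iff]
    simp [this]
  | acu e l r =>
    refine ⟨hl, treeAux_acu h hν, ?_⟩
    simp only [decoration, decide_eq_decide, not_iff_not]
    exact ⟨⟨below l (by simp [Node.lower]), .acu_left hν⟩,
      ⟨below r (by simp [Node.lower]), .acu_right hν⟩⟩

/-- At the identity that makes the edge live, the partner has at least one path, so the tree is no
larger than the number of open paths through that identity. Downwards from there, contractions keep
the tree, and cocontractions pass on subtrees. -/
theorem decoration_size (h : FlowOK ns K lab) {e : ℕ} {T : Fm Lit}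
    (he : Live ns (treeAux ns lab K) e) (hT : treeAux ns lab K e = some T) :
    T.size ≤ (Flow.mk K ns).numOpenAiPaths := by
  have hnd : ∀ ν ∈ ns, ν.lower.Nodup := (List.nodup_flatMap.1 h.lower).1
  have aid : ∀ {l r : ℕ} {T U : Fm Lit}, Node.aid l r ∈ ns → treeAux ns lab K l = some T →
      treeAux ns lab K r = some U → T.size * U.size ≤ (Flow.mk K ns).numOpenAiPaths := by
    intro l r T U hν hT hU
    obtain ⟨F, hF, hp⟩ := treeAux_paths hnd _ _ _ hT
    obtain ⟨G, hG, hq⟩ := treeAux_paths hnd _ _ _ hU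
    rw [← hF, ← hG]; exact mul_le_numOpenAiPaths h hν hp hq
  induction he generalizing T with
  | aid_left hν hx =>
    obtain ⟨U, hU⟩ := Option.isSome_iff_exists.1 hx
    exact (Nat.le_mul_of_pos_right _ (treeAux_isConj h.labOk _ _ _ hU).one_le_size).trans
      (aid hν hT hU)
  | aid_right hν hx =>
    obtain ⟨U, hU⟩ := Option.isSome_iff_exists.1 hx
    exact (Nat.le_mul_of_pos_left _ (treeAux_isConj h.labOk _ _ _ hU).one_le_size).trans
      (aid hν hU hT)
  | acd_left hν _ ih => exact ih ((treeAux_acd h hν).1.trans hT)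
  | acd_right hν _ ih => exact ih ((treeAux_acd h hν).2.trans hT)
  | @acu_left e l r hν _ ih =>
    have e₁ := treeAux_acu h hν
    rw [hT] at e₁
    cases hr : treeAux ns lab K r with
    | none => rw [hr] at e₁; exact ih e₁
    | some U =>
      rw [hr] at e₁
      have := ih e₁
      rw [Fm.size_and] at this
      omega
  | @acu_right e l r hν _ ih =>
    have e₁ := treeAux_acu h hν
    rw [hT] at e₁
    cases hr : treeAux ns lab K l with
    | none => rw [hr] at e₁; exact ih e₁
    | some U =>
      rw [hr] at e₁
      have := ih e₁
      rw [Fm.size_and] at this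
      omega

/-- Decorations of derivations, with a bound `N` for the trees of edges that are not dead. -/
structure Deco.OK (𝔡 : Deco) (N : ℕ) : Prop where
  isConj : ∀ e T, 𝔡.tree e = some T → T.IsConj (𝔡.lab e)
  size_le : ∀ e T, 𝔡.dead e = false → 𝔡.tree e = some T → T.size ≤ N

theorem Der.IsProof.exists_traced {Φ : Der} (h : Φ.IsProof KSplus) :
    ∃ (𝔡 : Deco) (E : Fm ℕ), Traced 𝔡 Φ .top E ∧ 𝔡.OK Φ.flow.numOpenAiPaths ∧
      E.map 𝔡.lab = Φ.cn ∧ ∀ e ∈ E.atoms, 𝔡.tree e = some (.atom (𝔡.lab e)) := by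
  obtain ⟨ns, E, K, lab, ht, hc, ok, hT⟩ := Φ.trace_spec h.1 .top 0 (fun _ => ⟨0, true⟩)
    (by rw [h.2]; rfl) (by simp [Fm.atoms])
  have hu := ok.upper
  simp only [Fm.atoms, Nat.sub_zero, Multiset.coe_add, List.nil_append] at hu
  -- The premiss ⊤ has no edges, so all edges are new, and by conservation each is consumed once or
  -- is in the conclusion. In particular the edges of the conclusion are pending.
  have hnd : (ns.flatMap Node.upper ++ E.atoms).Nodup := by
    have : (ns.flatMap Node.upper ++ E.atoms).Perm (List.range' 0 K) := Multiset.coe_eq_coe.1 hu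
    exact this.nodup_iff.2 List.nodup_range'
  obtain ⟨hn₁, hn₂, hn₃⟩ := List.nodup_append.1 hnd
  have hF : FlowOK ns K lab :=
    ⟨ok.upper_lt, ok.lower_lt, hn₁, ok.lower ▸ List.nodup_range', ok.labOk, ok.incr⟩
  have hflow : Φ.flow = Flow.mk K ns := by
    have ht' : Φ.trace [] 0 = (ns, E.atoms, K) := ht
    simp [Der.flow, h.2, ht']
  refine ⟨decoration ns K lab, E, hT _ (fun _ _ => rfl) (decoration_sat hF), ⟨?_, ?_⟩, hc, ?_⟩
  · exact fun e T => treeAux_isConj hF.labOk K e T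
  · intro e T hd hT
    rw [hflow]
    exact decoration_size hF (by simpa [decoration] using hd) hT
  · intro e he
    have : ∀ ν ∈ ns, e ∉ ν.upper := fun ν hν hx =>
      hn₃ e (List.mem_flatMap.2 ⟨ν, hν, hx⟩) e he rfl
    have heK := ok.lt e he
    obtain ⟨n, rfl⟩ : ∃ n, K = n + 1 := ⟨K - 1, by omega⟩
    simp only [decoration]
    rw [treeAux, find_eq_none.2 this]

end

/-! ## Programs -/

/-- Case distinction on trees. -/
def Tree.sel {α : Type*} : Tree → α → α → α
  | .nil, _, b => b
  | .cons _ _, a, _ => a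

/-! ### Symbolic evaluation of programs by weakest preconditions. -/

/-- `CallWP P i x Q`: on the argument `x`, procedure `i` terminates with a value and in a time which
satisfy `Q`. -/
def CallWP (P : Program) (i : ℕ) (x : Tree) (Q : Tree → ℕ → Prop) : Prop :=
  ∃ y t, Eval P (.call i) x y t ∧ Q y t

/-- The weakest precondition for the evaluation of an expression. -/
def wp (P : Program) : Expr → Tree → (Tree → ℕ → Prop) → Prop
  | .arg, x, Q => Q x (1 + x.size)
  | .nil, _, Q => Q .nil 2
  | .head, x, Q => Q x.head (1 + x.head.size)
  | .tail, x, Q => Q x.tail (1 + x.tail.size)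
  | .cons f g, x, Q => wp P f x fun y s => wp P g x fun z t =>
      Q (.cons y z) (s + t + (1 + (Tree.cons y z).size))
  | .comp f g, x, Q => wp P g x fun y s => wp P f y fun z t => Q z (s + t + 1)
  | .ite c f g, x, Q => wp P c x fun u s =>
      u.sel (wp P f x fun y t => Q y (s + t + 1)) (wp P g x fun y t => Q y (s + t + 1))
  | .call i, x, Q => CallWP P i x Q

/-- Unfolding `wp` executes a procedure body symbolically, with its running time. What remains are
calls, which are discharged by `Runs.use` from earlier results or induction hypotheses, and an
arithmetical inequality. -/
theorem wp_sound {P : Program} {e : Expr} {x : Tree} {Q : Tree → ℕ → Prop} (h : wp P e x Q) :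
    ∃ y t, Eval P e x y t ∧ Q y t := by
  induction e generalizing x Q with
  | arg => exact ⟨_, _, .arg x, h⟩
  | nil => exact ⟨_, _, .nil x, h⟩
  | head => exact ⟨_, _, .head x, h⟩
  | tail => exact ⟨_, _, .tail x, h⟩
  | cons f g ihf ihg =>
    obtain ⟨y, s, e₁, h₁⟩ := ihf h
    obtain ⟨z, t, e₂, h₂⟩ := ihg h₁
    exact ⟨_, _, .cons e₁ e₂, h₂⟩
  | comp f g ihf ihg =>
    obtain ⟨y, s, e₁, h₁⟩ := ihg h
    obtain ⟨z, t, e₂, h₂⟩ := ihf h₁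
    exact ⟨_, _, .comp e₁ e₂, h₂⟩
  | ite c f g ihc ihf ihg =>
    obtain ⟨u, s, e₁, h₁⟩ := ihc h
    cases u with
    | nil => obtain ⟨y, t, e₂, h₂⟩ := ihg h₁; exact ⟨_, _, .ite_false e₁ e₂, h₂⟩
    | cons a b => obtain ⟨y, t, e₂, h₂⟩ := ihf h₁; exact ⟨_, _, .ite_true e₁ e₂, h₂⟩
  | call i => exact h

/-- `Runs P i xs y c`: on the arguments `xs`, procedure `i` terminates with the value `y`, in time
at most `c`. -/
def Runs (P : Program) (i : ℕ) (xs : List Tree) (y : Tree) (c : ℕ) : Prop :=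
  ∃ t ≤ c, Eval P (.call i) (Tree.ofList xs) y t

theorem Runs.intro {P : Program} {i : ℕ} {xs : List Tree} {y : Tree} {c : ℕ} {f : Expr}
    (hf : P[i]? = some f) (h : wp P f (Tree.ofList xs) fun y' t => y' = y ∧ t + 1 ≤ c) :
    Runs P i xs y c := by
  obtain ⟨y', t, e, rfl, ht⟩ := wp_sound h
  exact ⟨_, ht, .call hf e⟩

theorem Runs.use {P : Program} {i : ℕ} {xs : List Tree} {x y : Tree} {c : ℕ}
    {Q : Tree → ℕ → Prop} (h : Runs P i xs y c) (hx : x = Tree.ofList xs)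
    (hQ : ∀ t ≤ c, Q y t) : CallWP P i x Q := by
  obtain ⟨t, ht, e⟩ := h
  exact ⟨y, t, hx ▸ e, hQ t ht⟩

theorem Runs.mono {P : Program} {i : ℕ} {xs : List Tree} {y : Tree} {c c' : ℕ}
    (h : Runs P i xs y c) (hc : c ≤ c') : Runs P i xs y c' := by
  obtain ⟨t, ht, e⟩ := h
  exact ⟨t, ht.trans hc, e⟩

/-! ### Notation for programs. -/

namespace Expr

/-- First component of the value of an expression. -/
def hd (e : Expr) : Expr := .comp .head e
/-- Second component of the value of an expression. -/
def tl (e : Expr) : Expr := .comp .tail e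
/-- The variable `n`, the argument being a list of the values of the variables. -/
def v : ℕ → Expr
  | 0 => .head
  | n + 1 => .comp (v n) .tail
/-- `f` with the value of `e` for a new variable `0`. -/
def letIn (e f : Expr) : Expr := .comp f (.cons e .arg)
/-- The list of the values of expressions. -/
def list : List Expr → Expr
  | [] => .nil
  | e :: es => .cons e (list es)
/-- Call of a procedure. -/
def app (i : ℕ) (es : List Expr) : Expr := .comp (.call i) (list es)
/-- The case of the given number. -/
def sw (e : Expr) : List Expr → Expr
  | [] => .nil
  | [f] => f
  -- Tags are unary numerals, so each test for `nil` takes off one successor; the last case is the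
  -- default.
  | f :: g :: fs => .ite e (sw (tl e) (g :: fs)) f
/-- Numerals. -/
def num : ℕ → Expr
  | 0 => .nil
  | n + 1 => .cons .nil (num n)
/-- Codes. -/
def tag (n : ℕ) (e : Expr) : Expr := .cons (num n) e
/-- Codes with two components. -/
def tag₂ (n : ℕ) (e f : Expr) : Expr := .cons (num n) (.cons e f)
/-- Codes of inference steps. -/
def step (ρ e f : Expr) : Expr := .cons (num 3) (.cons ρ (.cons e f))

end Expr

open DeepInference.Expr

/-! ### The procedures of the algorithm; numbers in calls are positions in `prog`. -/

/-- `[Φ] ↦` the conclusion of `Φ`. -/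
def cnBody : Expr :=
  sw (hd (v 0)) [tl (v 0),
    tag₂ 3 (app 1 [hd (tl (v 0))]) (app 1 [tl (tl (v 0))]),
    tag₂ 4 (app 1 [hd (tl (v 0))]) (app 1 [tl (tl (v 0))]),
    app 1 [tl (tl (tl (v 0)))]]

/-- `[A, l] ↦` the atoms of `A`, followed by `l`. -/
def flatBody : Expr :=
  let r := app 2 [hd (tl (v 0)), app 2 [tl (tl (v 0)), v 1]]
  sw (hd (v 0)) [v 1, v 1, .cons (tl (v 0)) (v 1), r, r]

/-- `[A, l] ↦` the formula `A` with its atoms replaced from `l`, and the rest of `l`. -/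
def fillBody : Expr :=
  let r := letIn (app 3 [hd (tl (v 0)), v 1]) <| letIn (app 3 [tl (tl (v 1)), tl (v 0)]) <|
    .cons (.cons (hd (v 2)) (.cons (hd (v 1)) (hd (v 0)))) (tl (v 0))
  sw (hd (v 0)) [.cons (v 0) (v 1), .cons (v 0) (v 1),
    .cons (.cons (hd (v 0)) (hd (v 1))) (tl (v 1)), r, r]

/-- `[l, i, y] ↦` the list `l` with `y` at the position `i`. -/
def setBody : Expr :=
  .ite (v 1) (.cons (hd (v 0)) (app 4 [tl (v 0), tl (v 1), v 2])) (.cons (v 2) (tl (v 0)))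

/-- `[σ, ys, l] ↦` the list `l` with the elements of `ys` at the positions `σ`. -/
def scatBody : Expr :=
  .ite (v 0) (app 4 [app 5 [tl (v 0), tl (v 1), v 2], hd (v 0), hd (v 1)]) (v 2)

/-- `[l, i] ↦` the element of `l` at the position `i`. -/
def nthBody : Expr := .ite (v 1) (app 6 [tl (v 0), tl (v 1)]) (hd (v 0))

/-- `[σ, l] ↦` the elements of `l` at the positions `σ`. -/
def gatherBody : Expr :=
  .ite (v 0) (.cons (app 6 [v 1, hd (v 0)]) (app 7 [tl (v 0), v 1])) .nil

/-- `[l, k] ↦` the interval from `k` of the length of `l`. -/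
def iotaBody : Expr := .ite (v 0) (.cons (v 1) (app 8 [tl (v 0), .cons .nil (v 1)])) .nil

/-- `[l, k] ↦` the sum of `k` and the length of `l`. -/
def addlenBody : Expr := .ite (v 0) (.cons .nil (app 9 [tl (v 0), v 1])) (v 1)

/-- `[xs, k] ↦` consecutive intervals from `k` on, of the sizes of the formulae `xs`. -/
def blocksBody : Expr :=
  .ite (v 0) (letIn (app 2 [hd (v 0), .nil]) <|
    .cons (app 8 [v 0, v 2]) (app 10 [tl (v 1), app 9 [v 0, v 2]])) .nil

/-- `[xs, ys] ↦ xs ++ ys`. -/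
def appendBody : Expr := .ite (v 0) (.cons (hd (v 0)) (app 11 [tl (v 0), v 1])) (v 1)

/-- `[xss] ↦` the concatenation of `xss`. -/
def concatBody : Expr := .ite (v 0) (app 11 [hd (v 0), app 12 [tl (v 0)]]) .nil

/-- `[σ, xs] ↦ expand σ xs`. -/
def expandBody : Expr := app 12 [app 7 [v 0, app 10 [v 1, .nil]]]

/-- `[X] ↦` the formula `X` of formulae, flattened. -/
def joinBody : Expr :=
  let r := .cons (hd (v 0)) (.cons (app 14 [hd (tl (v 0))]) (app 14 [tl (tl (v 0))]))
  sw (hd (v 0)) [v 0, v 0, tl (v 0), r, r]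

/-- `[T] ↦ contr T`. -/
def contrBody : Expr :=
  sw (hd (v 0)) [.nil, .nil,
    step (tag 4 .nil) (tag 0 (tag₂ 4 (v 0) (v 0))) (tag 0 (v 0)),
    step (tag 7 .nil) (tag 0 (tag₂ 4 (v 0) (v 0)))
      (tag₂ 1 (app 15 [hd (tl (v 0))]) (app 15 [tl (tl (v 0))]))]

/-- `[Φ, Ψ, X, Y, Z] ↦ meet Φ Ψ X Y Z`. -/
def meetBody : Expr :=
  step (tag 8 .nil) (tag 0 (tag 0 .nil)) <|
  step (tag 6 .nil) (tag₂ 1 (v 0) (v 1)) <|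
  step (tag 8 (app 13 [list [num 2, num 0, num 1, num 3], list [v 2, v 4, v 3, v 4]]))
    (tag 0 (tag₂ 4 (tag₂ 3 (tag₂ 4 (v 2) (v 4)) (v 3)) (v 4))) <|
  step (tag 8 (app 13 [list [num 1, num 0, num 2, num 3], list [v 3, v 2, v 4, v 4]]))
    (tag₂ 2 (step (tag 6 .nil) (tag 0 (tag₂ 3 (v 3) (tag₂ 4 (v 2) (v 4))))
      (tag 0 (tag₂ 4 (tag₂ 3 (v 3) (v 2)) (v 4)))) (tag 0 (v 4)))
    (tag₂ 2 (tag 0 (tag₂ 3 (v 2) (v 3))) (app 15 [v 4]))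

/-- `[b, Z] ↦ idAtom b Z`. -/
def idAtomBody : Expr :=
  sw (hd (v 1)) [.nil, .nil,
    step (tag 0 .nil) (tag 0 (tag 0 .nil)) (tag 0 (tag₂ 4 (v 1) (v 0))),
    app 16 [app 17 [v 0, hd (tl (v 1))], app 17 [v 0, tl (tl (v 1))],
      hd (tl (v 1)), tl (tl (v 1)), v 0]]

/-- `[Z, X] ↦ idConj Z X`. -/
def idConjBody : Expr :=
  sw (hd (v 1)) [.nil, .nil,
    step (tag 8 (app 13 [list [num 1, num 0], list [v 0, v 1]])) (app 17 [v 1, v 0])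
      (tag 0 (tag₂ 4 (v 1) (v 0))),
    app 16 [app 18 [v 0, hd (tl (v 1))], app 18 [v 0, tl (tl (v 1))],
      hd (tl (v 1)), tl (tl (v 1)), v 0]]

/-- `[ρ, A, X] ↦` the annotations of the premiss `A` of a step, given those `X` of the
conclusion. -/
def upBody : Expr :=
  sw (hd (v 0)) [tag 0 .nil, .nil, tag 1 .nil, tag 2 .nil,
    tag₂ 4 (v 2) (v 2),
    -- At a cocontraction the edge above leads to the conclusion if one of those below does; its
    -- literal is taken from the first that does.
    tag 2 (.ite (tl (hd (tl (v 2)))) (tl (hd (tl (v 2)))) (tl (tl (tl (v 2))))),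
    tag₂ 3 (hd (tl (hd (tl (v 2))))) (tag₂ 4 (tl (tl (hd (tl (v 2))))) (tl (tl (v 2)))),
    tag₂ 4 (tag₂ 3 (hd (tl (hd (tl (v 2))))) (hd (tl (tl (tl (v 2))))))
      (tag₂ 3 (tl (tl (hd (tl (v 2))))) (tl (tl (tl (tl (v 2)))))),
    -- The atoms of the premiss only provide a list of the right length: as the tracing is a
    -- permutation, every entry is overwritten.
    hd (app 3 [v 1, app 5 [tl (v 0), app 2 [v 2, .nil], app 2 [v 1, .nil]]])]

/-- `[ρ, X, Z] ↦` which edges of the conclusion of a step are dead, given those `X` of the premiss,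
and which edges `Z` of the conclusion lead to the conclusion of the proof. -/
def downBody : Expr :=
  sw (hd (v 0)) [
    -- The left edge is dead exactly when the right one does not lead to the conclusion, and
    -- conversely.
    tag₂ 4 (tag 2 (.ite (tl (tl (tl (v 2)))) .nil (num 1)))
      (tag 2 (.ite (tl (hd (tl (v 2)))) .nil (num 1))),
    .nil, tag 2 (num 1), tag 0 .nil,
    tag 2 (.ite (tl (hd (tl (v 1)))) (tl (tl (tl (v 1)))) .nil),
    tag₂ 3 (v 1) (v 1),
    tag₂ 4 (tag₂ 3 (hd (tl (v 1))) (hd (tl (tl (tl (v 1)))))) (tl (tl (tl (tl (v 1))))),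
    tag₂ 3 (tag₂ 4 (hd (tl (hd (tl (v 1))))) (hd (tl (tl (tl (v 1))))))
      (tag₂ 4 (tl (tl (hd (tl (v 1))))) (tl (tl (tl (tl (v 1)))))),
    hd (app 3 [v 2, app 7 [tl (v 0), app 2 [v 1, .nil]]])]

/-- `[ρ, A, X, V] ↦ (W, ρ₁, r)` for a step with the premiss `A`: the formulae `W` to be substituted
for its atoms, given the ones `V` for the conclusion; a rule `ρ₁`, and possibly a rule and a
derivation, which replace the step. -/
def locBody : Expr :=
  -- An `=` step with empty tracing, applied only between formulae without atoms whenever the values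
  -- at hand are units.
  let noStep := .cons (tag 8 .nil) .nil
  let refl := fun e : Expr => tag 8 (app 13 [list [.nil], list [e]])
  sw (hd (v 0)) [
    .cons (tag 0 .nil) (letIn (tl (hd (tl (v 3)))) (letIn (tl (tl (tl (v 4))))
      -- The tail of the tag is not `nil` exactly if the tag is at least `2`, that is, if the value
      -- is neither ⊤ nor ⊥.
      (.ite (tl (hd (v 1))) (.ite (tl (hd (v 0)))
        (.cons (tag 8 .nil) (.cons (refl (tag₂ 4 (v 1) (v 0))) (app 18 [v 0, v 1])))
        noStep) noStep))),
    .nil,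
    .cons (tag 1 .nil) (.cons (tag 8 .nil) (.ite (hd (tl (v 3))) .nil
      (.cons (tag 8 .nil) (step (tag 6 .nil)
        (tag 0 (tag₂ 3 (tag 1 .nil) (tag₂ 4 (tag 0 .nil) (tag 0 .nil))))
        (tag 0 (tag₂ 4 (tag₂ 3 (tag 1 .nil) (tag 0 .nil)) (tag 0 .nil))))))),
    .cons (tag 2 (tag 0 .nil)) noStep,
    -- If the common tree is missing, both values are ⊤. Otherwise a dead premiss edge becomes ⊥ and
    -- drops out as a unit, and only two live edges need a contraction.
    .ite (hd (tl (v 3)))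
      (.ite (tl (hd (tl (v 2))))
        (.cons (tag₂ 4 (tag 2 (tag 1 .nil)) (v 3)) (.cons (refl (tl (v 3))) .nil))
        (.ite (tl (tl (tl (v 2))))
          (.cons (tag₂ 4 (v 3) (tag 2 (tag 1 .nil))) (.cons (refl (tl (v 3))) .nil))
          (.cons (tag₂ 4 (v 3) (v 3)) (.cons (refl (tag₂ 4 (tl (v 3)) (tl (v 3))))
            (.cons (refl (tl (v 3))) (app 15 [tl (v 3)]))))))
      (.cons (tag₂ 4 (v 3) (v 3)) noStep),
    letIn (tl (hd (tl (v 3)))) (letIn (tl (tl (tl (v 4))))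
      -- The value above a cocontraction is rebuilt from those below: ⊤ is neutral, and if neither
      -- is ⊤ then both are ⊥ or both are trees.
      (letIn (.ite (hd (v 1)) (.ite (hd (v 0))
          (.ite (tl (hd (v 1))) (tag₂ 3 (v 1) (v 0)) (tag 1 .nil)) (v 1)) (v 0))
        (.cons (tag 2 (v 0)) (.cons (refl (v 0)) .nil)))),
    .cons (app 19 [v 0, v 1, v 3]) (.cons (v 0) .nil),
    .cons (app 19 [v 0, v 1, v 3]) (.cons (v 0) .nil),
    letIn (app 19 [v 0, v 1, v 3]) (.cons (v 0)
      (.cons (tag 8 (app 13 [tl (v 1), app 2 [v 0, .nil]])) .nil))]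

/-- `[Φ, Z] ↦` which edges of the premiss of `Φ` lead to the conclusion of the proof, given those
`Z` of the conclusion of `Φ`. -/
def zBody : Expr :=
  sw (hd (v 0)) [v 1,
    tag₂ 3 (app 22 [hd (tl (v 0)), hd (tl (v 1))]) (app 22 [tl (tl (v 0)), tl (tl (v 1))]),
    tag₂ 4 (app 22 [hd (tl (v 0)), hd (tl (v 1))]) (app 22 [tl (tl (v 0)), tl (tl (v 1))]),
    app 22 [hd (tl (tl (v 0))), app 19 [hd (tl (v 0)), app 1 [hd (tl (tl (v 0)))],
      app 22 [tl (tl (tl (v 0))), v 1]]]]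

/-- `[Φ, X, Z] ↦` which edges of the conclusion of `Φ` are dead, given those `X` of the premiss,
and which edges `Z` of the conclusion lead to the conclusion of the proof. -/
def dBody : Expr :=
  let l := app 23 [hd (tl (v 0)), hd (tl (v 1)), hd (tl (v 2))]
  let r := app 23 [tl (tl (v 0)), tl (tl (v 1)), tl (tl (v 2))]
  sw (hd (v 0)) [v 1, tag₂ 3 l r, tag₂ 4 l r,
    letIn (app 22 [tl (tl (tl (v 0))), v 2])
      (app 23 [tl (tl (tl (v 1))), app 20 [hd (tl (v 1)),
        app 23 [hd (tl (tl (v 1))), v 2,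
          app 19 [hd (tl (v 1)), app 1 [hd (tl (tl (v 1)))], v 0]], v 0], v 3])]

/-- `[Φ, X, Z, V] ↦ (Ψ, W)`: the transformation of `Φ`, and the formulae `W` that are substituted
for the atoms of its premiss, given those `V` for the conclusion. -/
def gBody : Expr :=
  let l := app 24 [hd (tl (v 0)), hd (tl (v 1)), hd (tl (v 2)), hd (tl (v 3))]
  let r := app 24 [tl (tl (v 1)), tl (tl (v 2)), tl (tl (v 3)), tl (tl (v 4))]
  sw (hd (v 0)) [.cons (tag 0 (app 14 [v 3])) (v 3),
    letIn l (letIn r (.cons (tag₂ 1 (hd (v 1)) (hd (v 0))) (tag₂ 3 (tl (v 1)) (tl (v 0))))),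
    letIn l (letIn r (.cons (tag₂ 2 (hd (v 1)) (hd (v 0))) (tag₂ 4 (tl (v 1)) (tl (v 0))))),
    -- The order is forced by the dependencies: descending connectivity, then deadness above the
    -- step, then the lower part, whose premiss values determine the step and the values above it.
    -- Connectivity and deadness are computed afresh at every step, which costs only a polynomial
    -- factor.
    letIn (app 22 [tl (tl (tl (v 0))), v 2]) <|
    letIn (app 19 [hd (tl (v 1)), app 1 [hd (tl (tl (v 1)))], v 0]) <|
    letIn (app 23 [hd (tl (tl (v 2))), v 3, v 0]) <|
    letIn (app 24 [tl (tl (tl (v 3))), app 20 [hd (tl (v 3)), v 0, v 2], v 5, v 6]) <|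
    letIn (app 21 [hd (tl (v 4)), app 1 [hd (tl (tl (v 4)))], v 1, tl (v 0)]) <|
    letIn (app 24 [hd (tl (tl (v 5))), v 6, v 3, hd (v 0)]) <|
    .cons (.ite (tl (tl (v 1)))
      (step (hd (tl (v 1))) (hd (v 0))
        (step (hd (tl (tl (v 1)))) (tl (tl (tl (v 1)))) (hd (v 2))))
      (step (hd (tl (v 1))) (hd (v 0)) (hd (v 2)))) (tl (v 0))]

/-- `[F, X] ↦` the formulae to be substituted for the atoms of the conclusion `F` of a proof, the
dead ones being given by `X`. -/
def initBody : Expr :=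
  sw (hd (v 0)) [v 0, v 0, .ite (tl (v 1)) (tag 2 (tag 1 .nil)) (tag 2 (v 0)),
    tag₂ 3 (app 25 [hd (tl (v 0)), hd (tl (v 1))]) (app 25 [tl (tl (v 0)), tl (tl (v 1))]),
    tag₂ 4 (app 25 [hd (tl (v 0)), hd (tl (v 1))]) (app 25 [tl (tl (v 0)), tl (tl (v 1))])]

/-- `[F, X] ↦` weakening of the dead atoms of `F`, given by `X`. -/
def weakBody : Expr :=
  sw (hd (v 0)) [tag 0 (v 0), tag 0 (v 0),
    .ite (tl (v 1)) (step (tag 2 .nil) (tag 0 (tag 1 .nil)) (tag 0 (v 0))) (tag 0 (v 0)),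
    tag₂ 1 (app 26 [hd (tl (v 0)), hd (tl (v 1))]) (app 26 [tl (tl (v 0)), tl (tl (v 1))]),
    tag₂ 2 (app 26 [hd (tl (v 0)), hd (tl (v 1))]) (app 26 [tl (tl (v 0)), tl (tl (v 1))])]

/-- The transformation of a proof. -/
def mainBody : Expr :=
  letIn (app 1 [.arg]) <|
  -- The input is the bare code of the proof, not a list of arguments; after one `letIn` it is the
  -- tail of the argument. `tag 0 .nil` annotates the premiss ⊤.
  letIn (app 23 [tl .arg, tag 0 .nil, v 0]) <|
  letIn (app 25 [v 1, v 0]) <|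
  step (tag 8 (app 13 [list [.nil], list [app 14 [v 0]]]))
    (hd (app 24 [tl (tl (tl .arg)), tag 0 .nil, v 2, v 0])) (app 26 [v 2, v 1])

/-- The program. -/
def prog : Program :=
  [mainBody, cnBody, flatBody, fillBody, setBody, scatBody, nthBody, gatherBody, iotaBody,
    addlenBody, blocksBody, appendBody, concatBody, expandBody, joinBody, contrBody, meetBody,
    idAtomBody, idConjBody, upBody, downBody, locBody, zBody, dBody, gBody, initBody, weakBody]

/-! ### Codes -/

/-- The code of a formula whose atoms have the codes `c`. -/
def Fm.enc {α : Type} (c : α → Tree) : Fm α → Tree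
  | .top => .cons (Tree.ofNat 0) .nil
  | .bot => .cons (Tree.ofNat 1) .nil
  | .atom a => .cons (Tree.ofNat 2) (c a)
  | .and A B => .cons (Tree.ofNat 3) (.cons (A.enc c) (B.enc c))
  | .or A B => .cons (Tree.ofNat 4) (.cons (A.enc c) (B.enc c))

theorem Fm.code_eq_enc (A : Fm Lit) : A.code = A.enc Lit.code := by
  induction A <;> simp_all [Fm.code, Fm.enc]

theorem Fm.enc_map {α β : Type} (f : α → β) (c : β → Tree) (A : Fm α) :
    (A.map f).enc c = A.enc (c ∘ f) := by
  induction A <;> simp_all [Fm.map, Fm.enc]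

theorem ofNat_zero : Tree.ofNat 0 = .nil := rfl
theorem ofNat_one : Tree.ofNat 1 = .cons .nil .nil := rfl
theorem ofNat_two : Tree.ofNat 2 = .cons .nil (.cons .nil .nil) := rfl
theorem ofNat_three : Tree.ofNat 3 = .cons .nil (.cons .nil (.cons .nil .nil)) := rfl
theorem ofNat_four : Tree.ofNat 4 = .cons .nil (.cons .nil (.cons .nil (.cons .nil .nil))) := rfl

theorem ofNat_succ (n : ℕ) : Tree.ofNat (n + 1) = .cons .nil (Tree.ofNat n) := rfl

set_option linter.unusedSimpArgs false
set_option maxRecDepth 10000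

/-! ### Formulae and lists -/

theorem size_ofList_append (xs ys : List Tree) :
    (Tree.ofList (xs ++ ys)).size + 1 = (Tree.ofList xs).size + (Tree.ofList ys).size := by
  induction xs with
  | nil => simp [Tree.ofList, Tree.size]; omega
  | cons x xs ih => simp only [List.cons_append, Tree.ofList, Tree.size]; omega

theorem length_lt_size_ofList (l : List Tree) : 2 * l.length + 1 ≤ (Tree.ofList l).size := by
  induction l with
  | nil => simp [Tree.ofList, Tree.size]
  | cons x xs ih =>
    have := x.one_le_size
    simp only [List.length_cons, Tree.ofList, Tree.size]; omega

theorem size_ofList_set (l : List Tree) (i : ℕ) (y : Tree) :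
    (Tree.ofList (l.set i y)).size ≤ (Tree.ofList l).size + y.size := by
  induction l generalizing i with
  | nil => simp
  | cons x xs ih =>
    cases i with
    | zero => simp only [List.set_cons_zero, Tree.ofList, Tree.size]; omega
    | succ i =>
      have := ih i
      simp only [List.set_cons_succ, Tree.ofList, Tree.size]; omega

theorem size_ofList_atoms {α : Type} (c : α → Tree) (A : Fm α) :
    (Tree.ofList (A.atoms.map c)).size ≤ (A.enc c).size := by
  induction A with
  | and A B h₁ h₂ | or A B h₁ h₂ =>
    have := size_ofList_append (A.atoms.map c) (B.atoms.map c)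
    simp only [Fm.atoms, List.map_append, Fm.enc, Tree.size] at *; omega
  | _ => simp [Fm.atoms, Fm.enc, Tree.ofList, Tree.size, Tree.size_ofNat]

theorem Fm.three_le_size_code (A : Fm Lit) : 3 ≤ A.code.size := by
  cases A <;> simp only [Fm.code, Tree.size, Tree.size_ofNat] <;> omega

/-- The connectives have longer tags in formulae than in derivations, hence the factor; the summand
`11` carries the induction. -/
theorem Der.cn_length (Φ : Der) : Φ.cn.code.size + 11 ≤ 3 * Φ.length := by
  induction Φ with
  | fm A =>
    have := A.three_le_size_code
    simp only [Der.cn, Der.length, Der.code, Tree.size, Tree.size_ofNat] at *; omega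
  | step ρ Φ Ψ _ ih =>
    simp only [Der.cn, Der.length, Der.code, Tree.size, Tree.size_ofNat] at *; omega
  | and Φ Ψ ih₁ ih₂ | or Φ Ψ ih₁ ih₂ =>
    simp only [Der.cn, Fm.code, Der.length, Der.code, Tree.size, Tree.size_ofNat] at *; omega

theorem Der.pr_length (Φ : Der) : Φ.pr.code.size + 11 ≤ 3 * Φ.length := by
  induction Φ with
  | fm A =>
    have := A.three_le_size_code
    simp only [Der.pr, Der.length, Der.code, Tree.size, Tree.size_ofNat] at *; omega
  | step ρ Φ Ψ ih _ =>
    simp only [Der.pr, Der.length, Der.code, Tree.size, Tree.size_ofNat] at *; omega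
  | and Φ Ψ ih₁ ih₂ | or Φ Ψ ih₁ ih₂ =>
    simp only [Der.pr, Fm.code, Der.length, Der.code, Tree.size, Tree.size_ofNat] at *; omega

/-- Here and for the other recursive procedures the bound has the form (measure of the recursion) ×
(cost of one call without its recursive calls), so that the induction adds up. `M` bounds all
intermediate values. -/
theorem flat_runs {α : Type} (c : α → Tree) (A : Fm α) (l : List Tree) {M : ℕ}
    (hA : (A.enc c).size ≤ M) (hl : (Tree.ofList (A.atoms.map c ++ l)).size ≤ M) :
    Runs prog 2 [A.enc c, Tree.ofList l] (Tree.ofList (A.atoms.map c ++ l))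
      ((A.enc c).size * (100 * M)) := by
  induction A generalizing l with
  | top =>
    refine .intro (f := flatBody) rfl ?_
    simp only [flatBody, wp, hd, tl, v, sw, Tree.ofList, Tree.head, Tree.tail, Tree.sel, Tree.size,
      Fm.enc, ofNat_zero, Fm.atoms, List.map_nil, List.nil_append, true_and] at *
    omega
  | bot =>
    refine .intro (f := flatBody) rfl ?_
    simp only [flatBody, wp, hd, tl, v, sw, Tree.ofList, Tree.head, Tree.tail, Tree.sel, Tree.size,
      Fm.enc, ofNat_one, Fm.atoms, List.map_nil, List.nil_append, true_and] at *
    omega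
  | atom a =>
    refine .intro (f := flatBody) rfl ?_
    simp only [flatBody, wp, hd, tl, v, sw, Tree.ofList, Tree.head, Tree.tail, Tree.sel, Tree.size,
      Fm.enc, ofNat_two, Fm.atoms, List.map_cons, List.map_nil, List.cons_append, List.nil_append,
      true_and] at *
    simp only [Nat.add_mul, Nat.one_mul]
    omega
  | and A B ihA ihB | or A B ihA ihB =>
    refine .intro (f := flatBody) rfl ?_
    have h₁ := size_ofList_append (A.atoms.map c) (Tree.ofList (B.atoms.map c ++ l) :: [])
    have h₂ := size_ofList_append (A.atoms.map c) (B.atoms.map c ++ l)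
    have h₃ := size_ofList_append (B.atoms.map c) l
    have h₄ := (Tree.ofList (A.atoms.map c)).one_le_size
    have h₅ := (Tree.ofList (B.atoms.map c)).one_le_size
    simp only [flatBody, wp, hd, tl, v, sw, Tree.ofList, Tree.head, Tree.tail, Tree.sel, Tree.size,
      Fm.enc, ofNat_three, ofNat_four, app, list, Fm.atoms, List.map_append, List.append_assoc]
      at hA hl ⊢
    refine (ihB l (by omega) (by omega)).use rfl fun t ht => ?_
    refine (ihA _ (by omega) hl).use rfl fun u hu => ⟨rfl, ?_⟩
    simp only [Nat.add_mul, Nat.one_mul]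
    omega

/-- Only the shape of the first argument matters; its annotations `u` are discarded, so any
annotated copy may serve as a mould. -/
theorem fill_runs {α : Type} (u w : α → Tree) (A : Fm α) (l : List Tree) {M : ℕ}
    (hu : (A.enc u).size ≤ M) (hw : (A.enc w).size ≤ M)
    (hl : (Tree.ofList (A.atoms.map w ++ l)).size ≤ M) :
    Runs prog 3 [A.enc u, Tree.ofList (A.atoms.map w ++ l)] (.cons (A.enc w) (Tree.ofList l))
      ((A.enc u).size * (200 * M)) := by
  induction A generalizing l with
  | top =>
    refine .intro (f := fillBody) rfl ?_
    simp only [fillBody, wp, hd, tl, v, sw, Tree.ofList, Tree.head, Tree.tail, Tree.sel, Tree.size,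
      Fm.enc, ofNat_zero, Fm.atoms, List.map_nil, List.nil_append, true_and] at *
    omega
  | bot =>
    refine .intro (f := fillBody) rfl ?_
    simp only [fillBody, wp, hd, tl, v, sw, Tree.ofList, Tree.head, Tree.tail, Tree.sel, Tree.size,
      Fm.enc, ofNat_one, Fm.atoms, List.map_nil, List.nil_append, true_and] at *
    omega
  | atom a =>
    refine .intro (f := fillBody) rfl ?_
    simp only [fillBody, wp, hd, tl, v, sw, Tree.ofList, Tree.head, Tree.tail, Tree.sel, Tree.size,
      Fm.enc, ofNat_two, Fm.atoms, List.map_cons, List.map_nil, List.cons_append, List.nil_append,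
      true_and] at *
    simp only [Nat.add_mul, Nat.one_mul]
    omega
  | and A B ihA ihB | or A B ihA ihB =>
    refine .intro (f := fillBody) rfl ?_
    have h₂ := size_ofList_append (A.atoms.map w) (B.atoms.map w ++ l)
    have h₃ := size_ofList_append (B.atoms.map w) l
    have h₄ := (Tree.ofList (A.atoms.map w)).one_le_size
    have h₅ := (Tree.ofList (B.atoms.map w)).one_le_size
    simp only [fillBody, wp, hd, tl, v, sw, letIn, Tree.ofList, Tree.head, Tree.tail, Tree.sel,
      Tree.size, Fm.enc, ofNat_three, ofNat_four, app, list, Fm.atoms, List.map_append,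
      List.append_assoc] at hu hw hl ⊢
    refine (ihA _ (by omega) (by omega) hl).use rfl fun t ht => ?_
    simp only [wp, Tree.head, Tree.tail, Tree.sel, Tree.size]
    refine (ihB l (by omega) (by omega) (by omega)).use rfl fun t ht => ?_
    simp only [wp, Tree.head, Tree.tail, Tree.sel, Tree.size, true_and]
    simp only [Nat.add_mul, Nat.one_mul]
    omega

theorem set_runs (l : List Tree) (i : ℕ) (y : Tree) {M : ℕ} (hi : i < l.length)
    (hl : (Tree.ofList l).size ≤ M) (hy : y.size ≤ M) :
    Runs prog 4 [Tree.ofList l, Tree.ofNat i, y] (Tree.ofList (l.set i y))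
      ((i + 1) * (100 * M)) := by
  induction i generalizing l with
  | zero =>
    obtain ⟨x, l, rfl⟩ := List.exists_cons_of_length_pos hi
    refine .intro (f := setBody) rfl ?_
    simp only [setBody, wp, hd, tl, v, Tree.ofList, Tree.head, Tree.tail, Tree.sel, Tree.size,
      ofNat_zero, List.set_cons_zero, true_and] at *
    omega
  | succ i ih =>
    obtain ⟨x, l, rfl⟩ := List.exists_cons_of_length_pos (by omega : 0 < l.length)
    have h₁ := length_lt_size_ofList l
    have h₂ := Tree.size_ofNat i
    have h₃ := size_ofList_set l i y
    simp only [List.length_cons] at hi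
    refine .intro (f := setBody) rfl ?_
    simp only [setBody, wp, hd, tl, v, Tree.ofList, Tree.head, Tree.tail, Tree.sel, Tree.size,
      ofNat_succ, List.set_cons_succ, app, list] at hl ⊢
    refine (ih l (by omega) (by omega)).use rfl fun t ht => ⟨rfl, ?_⟩
    simp only [Nat.add_mul, Nat.one_mul] at ht ⊢
    omega

/-- The list `l` with the elements of `ys` at the positions `σ`. -/
def scatter : List ℕ → List Tree → List Tree → List Tree
  | i :: σ, y :: ys, l => (scatter σ ys l).set i y
  | _, _, l => l

theorem length_scatter (σ : List ℕ) (ys l : List Tree) :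
    (scatter σ ys l).length = l.length := by
  induction σ generalizing ys with
  | nil => rfl
  | cons i σ ih => cases ys <;> simp [scatter, ih]

theorem size_scatter (σ : List ℕ) (ys l : List Tree) :
    (Tree.ofList (scatter σ ys l)).size ≤ (Tree.ofList l).size + (Tree.ofList ys).size := by
  induction σ generalizing ys with
  | nil => simp [scatter]
  | cons i σ ih =>
    cases ys with
    | nil => simp [scatter]
    | cons y ys =>
      have h₁ := ih ys
      have h₂ := size_ofList_set (scatter σ ys l) i y
      simp only [scatter, Tree.ofList, Tree.size]; omega

theorem getElem_scatter (σ : List ℕ) (g : ℕ → Tree) (l : List Tree) (i : ℕ)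
    (hi : i < (scatter σ (σ.map g) l).length) (h : i ∈ σ) :
    (scatter σ (σ.map g) l)[i] = g i := by
  induction σ with
  | nil => simp at h
  | cons j σ ih =>
    simp only [List.map_cons, scatter, List.getElem_set]
    split
    · rename_i h; rw [h]
    · rename_i hj
      rcases List.mem_cons.1 h with rfl | h
      · exact absurd rfl hj
      · exact ih _ h

/-- If every position occurs in `σ`, nothing of the initial list is left. -/
theorem scatter_eq (σ : List ℕ) (g : ℕ → Tree) (l : List Tree)
    (h : ∀ i < l.length, i ∈ σ) : scatter σ (σ.map g) l = (List.range l.length).map g := by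
  refine List.ext_getElem (by simp [length_scatter]) fun i h₁ h₂ => ?_
  rw [getElem_scatter _ _ _ _ _ (h i (by simpa [length_scatter] using h₁))]
  simp

/-- The code of a list of numbers. -/
def natsCode (σ : List ℕ) : Tree := Tree.ofList (σ.map Tree.ofNat)

theorem scat_runs (σ : List ℕ) (ys l : List Tree) {M : ℕ} (hσ : (natsCode σ).size ≤ M)
    (hi : ∀ i ∈ σ, i < l.length) (hy : (Tree.ofList ys).size ≤ M) (hl : (Tree.ofList l).size ≤ M)
    (hlen : σ.length = ys.length) :
    Runs prog 5 [natsCode σ, Tree.ofList ys, Tree.ofList l] (Tree.ofList (scatter σ ys l))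
      ((σ.length + 1) * (M * (300 * M))) := by
  induction σ generalizing ys with
  | nil =>
    refine .intro (f := scatBody) rfl ?_
    simp only [scatBody, wp, hd, tl, v, natsCode, Tree.ofList, Tree.head, Tree.tail, Tree.sel,
      Tree.size, List.map_nil, scatter, true_and, List.length_nil,
      Nat.zero_add, Nat.one_mul] at *
    have : 300 * M ≤ M * (300 * M) := Nat.le_mul_of_pos_left _ hσ
    omega
  | cons i σ ih =>
    obtain ⟨y, ys, rfl⟩ : ∃ y ys', ys = y :: ys' := by cases ys <;> simp_all
    have h₁ := size_scatter σ ys l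
    have h₂ := size_ofList_set (scatter σ ys l) i y
    have h₃ := length_lt_size_ofList l
    have h₅ := hi i (by simp)
    refine .intro (f := scatBody) rfl ?_
    simp only [scatBody, wp, hd, tl, v, natsCode, Tree.ofList, Tree.head, Tree.tail, Tree.sel,
      Tree.size, List.map_cons, scatter, app, list, List.length_cons] at hσ hy hlen ⊢
    refine (ih ys (by unfold natsCode; omega) (fun j hj => hi j (by simp [hj])) (by omega)
      (by omega)).use rfl fun t ht => ?_
    refine (set_runs (scatter σ ys l) i y (M := 2 * M) (by rw [length_scatter]; exact h₅)
      (by omega) (by omega)).use rfl fun u hu => ⟨rfl, ?_⟩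
    have h₆ : (i + 1) * (100 * (2 * M)) ≤ M * (100 * (2 * M)) :=
      Nat.mul_le_mul_right _ (by have := Tree.size_ofNat i; omega)
    have h₇ : 100 * M ≤ M * (100 * M) := Nat.le_mul_of_pos_left _ (by omega)
    have h₈ : M * (300 * M) = 3 * (M * (100 * M)) := by ring
    have h₉ : M * (100 * (2 * M)) = 2 * (M * (100 * M)) := by ring
    simp only [Nat.add_mul, Nat.one_mul] at ht h₆ hu ⊢
    omega

theorem nth_runs (l : List Tree) (i : ℕ) {M : ℕ} (hi : i < l.length)
    (hl : (Tree.ofList l).size ≤ M) :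
    Runs prog 6 [Tree.ofList l, Tree.ofNat i] (l[i]) ((i + 1) * (100 * M)) := by
  induction i generalizing l with
  | zero =>
    obtain ⟨x, l, rfl⟩ := List.exists_cons_of_length_pos hi
    refine .intro (f := nthBody) rfl ?_
    simp only [nthBody, wp, hd, tl, v, Tree.ofList, Tree.head, Tree.tail, Tree.sel, Tree.size,
      ofNat_zero, List.getElem_cons_zero, true_and] at *
    omega
  | succ i ih =>
    obtain ⟨x, l, rfl⟩ := List.exists_cons_of_length_pos (by omega : 0 < l.length)
    have h₁ := length_lt_size_ofList l
    have h₂ := Tree.size_ofNat i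
    simp only [List.length_cons] at hi
    refine .intro (f := nthBody) rfl ?_
    simp only [nthBody, wp, hd, tl, v, Tree.ofList, Tree.head, Tree.tail, Tree.sel, Tree.size,
      ofNat_succ, List.getElem_cons_succ, app, list] at hl ⊢
    refine (ih l (by omega) (by omega)).use rfl fun t ht => ⟨rfl, ?_⟩
    simp only [Nat.add_mul, Nat.one_mul] at ht ⊢
    omega

theorem gather_runs (σ : List ℕ) (l : List Tree) (g : ℕ → Tree) {M : ℕ}
    (hσ : (natsCode σ).size ≤ M) (hl : (Tree.ofList l).size ≤ M)
    (hg : ∀ i ∈ σ, l[i]? = some (g i)) (ho : (Tree.ofList (σ.map g)).size ≤ M) :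
    Runs prog 7 [natsCode σ, Tree.ofList l] (Tree.ofList (σ.map g))
      ((σ.length + 1) * (M * (200 * M))) := by
  induction σ with
  | nil =>
    refine .intro (f := gatherBody) rfl ?_
    simp only [gatherBody, wp, hd, tl, v, natsCode, Tree.ofList, Tree.head, Tree.tail, Tree.sel,
      Tree.size, List.map_nil, true_and, List.length_nil,
      Nat.zero_add, Nat.one_mul] at *
    have : 200 * M ≤ M * (200 * M) := Nat.le_mul_of_pos_left _ hσ
    omega
  | cons i σ ih =>
    obtain ⟨h₅, h₄⟩ := List.getElem?_eq_some_iff.1 (hg i (by simp))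
    have h₃ := length_lt_size_ofList l
    refine .intro (f := gatherBody) rfl ?_
    simp only [gatherBody, wp, hd, tl, v, natsCode, Tree.ofList, Tree.head, Tree.tail, Tree.sel,
      Tree.size, List.map_cons, app, list, List.length_cons] at hσ ho ⊢
    refine (nth_runs l i h₅ hl).use rfl fun u hu => ?_
    refine (ih (by unfold natsCode; omega) (fun j hj => hg j (by simp [hj])) (by omega)).use rfl
      fun t ht => ⟨by rw [h₄], ?_⟩
    have h₆ : (i + 1) * (100 * M) ≤ M * (100 * M) :=
      Nat.mul_le_mul_right _ (by have := Tree.size_ofNat i; omega)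
    have h₇ : 100 * M ≤ M * (100 * M) := Nat.le_mul_of_pos_left _ (by omega)
    have h₈ : M * (200 * M) = 2 * (M * (100 * M)) := by ring
    rw [h₄]
    simp only [Nat.add_mul, Nat.one_mul] at ht h₆ hu ⊢
    omega

theorem iota_runs (l : List Tree) (k : ℕ) {M : ℕ} (hl : (Tree.ofList l).size ≤ M)
    (hk : (Tree.ofNat (k + l.length)).size ≤ M)
    (ho : (natsCode (List.range' k l.length)).size ≤ M) :
    Runs prog 8 [Tree.ofList l, Tree.ofNat k] (natsCode (List.range' k l.length))
      ((l.length + 1) * (100 * M)) := by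
  induction l generalizing k with
  | nil =>
    refine .intro (f := iotaBody) rfl ?_
    simp only [iotaBody, wp, hd, tl, v, natsCode, Tree.ofList, Tree.head, Tree.tail, Tree.sel,
      Tree.size, List.map_nil, List.range', List.length_nil, true_and, Nat.add_zero] at *
    omega
  | cons x l ih =>
    have h₁ := Tree.size_ofNat k
    have h₂ := Tree.size_ofNat (k + (l.length + 1))
    have h₃ := Tree.size_ofNat (k + 1 + l.length)
    refine .intro (f := iotaBody) rfl ?_
    simp only [iotaBody, wp, hd, tl, v, natsCode, Tree.ofList, Tree.head, Tree.tail, Tree.sel,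
      Tree.size, List.map_cons, List.range', List.length_cons, app, list] at hl hk ho ⊢
    refine (ih (k + 1) (by omega) (by omega) (by unfold natsCode; omega)).use rfl
      fun t ht => ⟨rfl, ?_⟩
    simp only [Nat.add_mul, Nat.one_mul, natsCode] at ht ⊢
    omega

theorem addlen_runs (l : List Tree) (k : ℕ) {M : ℕ} (hl : (Tree.ofList l).size ≤ M)
    (hk : (Tree.ofNat (k + l.length)).size ≤ M) :
    Runs prog 9 [Tree.ofList l, Tree.ofNat k] (Tree.ofNat (k + l.length))
      ((l.length + 1) * (100 * M)) := by
  induction l with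
  | nil =>
    refine .intro (f := addlenBody) rfl ?_
    simp only [addlenBody, wp, hd, tl, v, Tree.ofList, Tree.head, Tree.tail, Tree.sel,
      Tree.size, List.length_nil, true_and, Nat.add_zero] at *
    omega
  | cons x l ih =>
    have h₁ := Tree.size_ofNat k
    have h₂ := Tree.size_ofNat (k + l.length)
    refine .intro (f := addlenBody) rfl ?_
    simp only [addlenBody, wp, hd, tl, v, Tree.ofList, Tree.head, Tree.tail, Tree.sel,
      Tree.size, List.length_cons, ← Nat.add_assoc, ofNat_succ, app, list] at hl hk ⊢
    refine (ih (by omega) (by omega)).use rfl fun t ht => ⟨rfl, ?_⟩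
    simp only [Nat.add_mul, Nat.one_mul] at ht ⊢
    omega

theorem append_runs (xs ys : List Tree) {M : ℕ} (ho : (Tree.ofList (xs ++ ys)).size ≤ M) :
    Runs prog 11 [Tree.ofList xs, Tree.ofList ys] (Tree.ofList (xs ++ ys))
      ((xs.length + 1) * (100 * M)) := by
  induction xs with
  | nil =>
    have := (Tree.ofList ys).one_le_size
    refine .intro (f := appendBody) rfl ?_
    simp only [appendBody, wp, hd, tl, v, Tree.ofList, Tree.head, Tree.tail, Tree.sel,
      Tree.size, List.length_nil, List.nil_append, true_and] at *
    omega
  | cons x l ih =>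
    have h₁ := size_ofList_append l ys
    have h₂ := (Tree.ofList ys).one_le_size
    have h₃ := (Tree.ofList l).one_le_size
    refine .intro (f := appendBody) rfl ?_
    simp only [appendBody, wp, hd, tl, v, Tree.ofList, Tree.head, Tree.tail, Tree.sel,
      Tree.size, List.length_cons, List.cons_append, app, list] at ho ⊢
    refine (ih (by omega)).use rfl fun t ht => ⟨rfl, ?_⟩
    simp only [Nat.add_mul, Nat.one_mul] at ht ⊢
    omega

theorem concat_runs (xss : List (List Tree)) {M : ℕ}
    (hi : (Tree.ofList (xss.map Tree.ofList)).size ≤ M)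
    (ho : (Tree.ofList xss.flatten).size ≤ M) :
    Runs prog 12 [Tree.ofList (xss.map Tree.ofList)] (Tree.ofList xss.flatten)
      ((xss.length + 1) * (M * (200 * M))) := by
  induction xss with
  | nil =>
    refine .intro (f := concatBody) rfl ?_
    simp only [concatBody, wp, hd, tl, v, Tree.ofList, Tree.head, Tree.tail, Tree.sel,
      Tree.size, List.map_nil, List.flatten_nil, true_and, List.length_nil,
      Nat.zero_add, Nat.one_mul]
      at *
    have : 200 * M ≤ M * (200 * M) := Nat.le_mul_of_pos_left _ hi
    omega
  | cons xs xss ih =>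
    have h₁ := size_ofList_append xs xss.flatten
    have h₂ := (Tree.ofList xs).one_le_size
    have h₃ := length_lt_size_ofList xs
    refine .intro (f := concatBody) rfl ?_
    simp only [concatBody, wp, hd, tl, v, Tree.ofList, Tree.head, Tree.tail, Tree.sel,
      Tree.size, List.map_cons, List.flatten_cons, List.length_cons, app, list] at hi ho ⊢
    refine (ih (by omega) (by omega)).use rfl fun t ht => ?_
    refine (append_runs xs xss.flatten ho).use rfl fun u hu => ⟨rfl, ?_⟩
    have h₆ : (xs.length + 1) * (100 * M) ≤ M * (100 * M) :=
      Nat.mul_le_mul_right _ (by omega)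
    have h₇ : 100 * M ≤ M * (100 * M) := Nat.le_mul_of_pos_left _ (by omega)
    have h₈ : M * (200 * M) = 2 * (M * (100 * M)) := by ring
    simp only [Nat.add_mul, Nat.one_mul] at ht h₆ hu ⊢
    omega

theorem natsCode_perm {σ τ : List ℕ} (h : σ.Perm τ) : (natsCode σ).size = (natsCode τ).size := by
  unfold natsCode
  induction h with
  | nil => rfl
  | cons x _ ih => simp only [List.map_cons, Tree.ofList, Tree.size, ih]
  | swap x y l => simp only [List.map_cons, Tree.ofList, Tree.size]; omega
  | trans _ _ ih₁ ih₂ => exact ih₁.trans ih₂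

theorem natsCode_append (σ τ : List ℕ) :
    (natsCode (σ ++ τ)).size + 1 = (natsCode σ).size + (natsCode τ).size := by
  simp only [natsCode, List.map_append, size_ofList_append]

theorem natsCode_range (n m : ℕ) (h : n ≤ m) :
    (natsCode (List.range n)).size ≤ m * (2 * m + 2) + 1 := by
  have h₁ := Tree.size_ofList_le ((List.range n).map Tree.ofNat) (2 * m + 1) (by
    simp only [List.mem_map, List.mem_range, forall_exists_index, and_imp,
      forall_apply_eq_imp_iff₂, Tree.size_ofNat]
    intro i hi; omega)
  have h₂ : n * (2 * m + 1 + 1) ≤ m * (2 * m + 2) := Nat.mul_le_mul_right _ h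
  simp only [List.length_map, List.length_range] at h₁
  unfold natsCode; omega

theorem size_ofList_flatten (xss : List (List Tree)) :
    (Tree.ofList (xss.map Tree.ofList)).size = (Tree.ofList xss.flatten).size + 2 * xss.length := by
  induction xss with
  | nil => rfl
  | cons xs xss ih =>
    have := size_ofList_append xs xss.flatten
    simp only [List.map_cons, Tree.ofList, Tree.size, List.flatten_cons, List.length_cons]
    omega

theorem cn_runs (Φ : Der) {M : ℕ} (hM : 3 * Φ.length ≤ M) :
    Runs prog 1 [Φ.code] Φ.cn.code (Φ.length * (100 * M)) := by
  have hl := Φ.cn_length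
  induction Φ with
  | fm A =>
    refine .intro (f := cnBody) rfl ?_
    simp only [cnBody, wp, hd, tl, v, sw, Tree.ofList, Tree.head, Tree.tail, Tree.sel, Tree.size,
      Der.code, ofNat_zero, Der.cn, true_and, Der.length] at *
    simp only [Nat.add_mul, Nat.one_mul]
    omega
  | and Φ Ψ ih₁ ih₂ | or Φ Ψ ih₁ ih₂ =>
    have h₁ := Φ.cn_length
    have h₂ := Ψ.cn_length
    refine .intro (f := cnBody) rfl ?_
    simp only [cnBody, wp, hd, tl, v, sw, Tree.ofList, Tree.head, Tree.tail, Tree.sel, Tree.size,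
      Der.code, ofNat_zero, ofNat_one, ofNat_two, ofNat_three, ofNat_four, Der.cn, Der.length,
      Fm.code, tag₂, num, app, list] at *
    refine (ih₁ (by omega) h₁).use rfl fun t ht => ?_
    refine (ih₂ (by omega) h₂).use rfl fun u hu => ⟨rfl, ?_⟩
    simp only [Nat.add_mul, Nat.one_mul, Tree.size] at *
    omega
  | step ρ Φ Ψ _ ih =>
    have h₂ := Ψ.cn_length
    refine .intro (f := cnBody) rfl ?_
    simp only [cnBody, wp, hd, tl, v, sw, Tree.ofList, Tree.head, Tree.tail, Tree.sel, Tree.size,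
      Der.code, ofNat_zero, ofNat_one, ofNat_two, ofNat_three, ofNat_four, Der.cn, Der.length,
      Fm.code, app, list] at *
    refine (ih (by omega) h₂).use rfl fun t ht => ⟨rfl, ?_⟩
    simp only [Nat.add_mul, Nat.one_mul, Tree.size] at *
    omega

theorem join_runs {α : Type} (V : α → Fm Lit) (E : Fm α) {M : ℕ}
    (h₁ : (E.enc fun e => (V e).code).size ≤ M) :
    Runs prog 14 [E.enc fun e => (V e).code] (E.bind V).code
      ((E.enc fun e => (V e).code).size * (100 * M)) ∧
    (E.bind V).code.size ≤ (E.enc fun e => (V e).code).size := by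
  induction E with
  | top | bot =>
    refine ⟨.intro (f := joinBody) rfl ?_, ?_⟩
    · simp only [joinBody, wp, hd, tl, v, sw, Tree.ofList, Tree.head, Tree.tail, Tree.sel,
        Tree.size, Fm.enc, Fm.bind, Fm.code, ofNat_zero, ofNat_one, true_and] at *
      omega
    · simp [Fm.enc, Fm.bind, Fm.code]
  | atom e =>
    refine ⟨.intro (f := joinBody) rfl ?_, ?_⟩
    · simp only [joinBody, wp, hd, tl, v, sw, Tree.ofList, Tree.head, Tree.tail, Tree.sel,
        Tree.size, Fm.enc, Fm.bind, Fm.code, ofNat_two, true_and] at *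
      simp only [Nat.add_mul, Nat.one_mul]
      omega
    · simp only [Fm.enc, Fm.bind, Tree.size]; omega
  | and A B ih₁ ih₂ | or A B ih₁ ih₂ =>
    simp only [Fm.enc, Tree.size] at h₁
    obtain ⟨i₁, l₁⟩ := ih₁ (by omega)
    obtain ⟨i₂, l₂⟩ := ih₂ (by omega)
    refine ⟨.intro (f := joinBody) rfl ?_, ?_⟩
    · simp only [joinBody, wp, hd, tl, v, sw, Tree.ofList, Tree.head, Tree.tail, Tree.sel,
        Tree.size, Fm.enc, Fm.bind, Fm.code, ofNat_three, ofNat_four, app, list] at *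
      refine i₁.use rfl fun t ht => ?_
      refine i₂.use rfl fun u hu => ⟨rfl, ?_⟩
      simp only [Nat.add_mul, Nat.one_mul, Tree.size] at *
      omega
    · simp only [Fm.enc, Fm.bind, Fm.code, Tree.size] at *; omega

theorem blocks_runs (xs : List (Fm Lit)) (k : ℕ) {M : ℕ}
    (hx : (Tree.ofList (xs.map Fm.code)).size ≤ M)
    (hk : 2 * (k + (xs.map Fm.size).sum) + 1 ≤ M)
    (hb : (natsCode (List.range' k (xs.map Fm.size).sum)).size ≤ M) :
    Runs prog 10 [Tree.ofList (xs.map Fm.code), Tree.ofNat k]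
      (Tree.ofList ((blocks k (xs.map Fm.size)).map natsCode))
      ((xs.length + 1) * (M * (1000 * M))) := by
  induction xs generalizing k with
  | nil =>
    refine .intro (f := blocksBody) rfl ?_
    simp only [blocksBody, wp, hd, tl, v, Tree.ofList, Tree.head, Tree.tail, Tree.sel,
      Tree.size, List.map_nil, true_and, blocks, List.length_nil, Nat.zero_add, Nat.one_mul] at *
    have : 1000 * M ≤ M * (1000 * M) := Nat.le_mul_of_pos_left _ (by omega)
    have := Tree.size_ofNat k
    omega
  | cons A xs ih =>
    refine .intro (f := blocksBody) rfl ?_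
    have e₁ := natsCode_append (List.range' k A.size)
      (List.range' (k + A.size) (xs.map Fm.size).sum)
    rw [List.range'_append_1] at e₁
    have e₂ := (natsCode (List.range' k A.size)).one_le_size
    have e₃ := (natsCode (List.range' (k + A.size) (xs.map Fm.size).sum)).one_le_size
    have e₄ := Tree.size_ofNat k
    have e₅ := Tree.size_ofNat (k + A.size)
    have e₆ : (Tree.ofList ((blocks (k + A.size) (xs.map Fm.size)).map natsCode)).size =
        (natsCode (List.range' (k + A.size) (xs.map Fm.size).sum)).size + 2 * xs.length := by
      have := size_ofList_flatten
        ((blocks (k + A.size) (xs.map Fm.size)).map (List.map Tree.ofNat))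
      rw [List.map_map, ← List.map_flatten, flatten_blocks, List.length_map, length_blocks,
        List.length_map] at this
      exact this
    have e₇ := length_lt_size_ofList (xs.map Fm.code)
    have e₈ := A.size_le_code
    have e₁₀ := size_ofList_atoms Lit.code A
    rw [← Fm.code_eq_enc] at e₁₀
    have e₁₁ : (A.atoms.map Lit.code).length = A.size := by simp [Fm.size]
    simp only [blocksBody, wp, hd, tl, v, Tree.ofList, Tree.head, Tree.tail, Tree.sel,
      Tree.size, List.map_cons, List.length_cons, List.sum_cons, blocks, letIn, app, list,
      List.length_map] at hx hk hb e₇ ⊢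
    refine (flat_runs Lit.code A [] (M := M) (by rw [← Fm.code_eq_enc]; omega)
      (by rw [List.append_nil]; omega)).use (by rw [← Fm.code_eq_enc]; rfl) fun t ht => ?_
    rw [List.append_nil, ← Fm.code_eq_enc] at *
    refine (iota_runs (A.atoms.map Lit.code) k (M := M) (by omega) (by rw [e₁₁]; omega)
      (by rw [e₁₁]; omega)).use rfl fun u hu => ?_
    rw [e₁₁] at hu
    refine (addlen_runs (A.atoms.map Lit.code) k (M := M) (by omega)
      (by rw [e₁₁]; omega)).use rfl fun w hw => ?_
    rw [e₁₁] at hw ⊢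
    refine (ih (k + A.size) (by omega) (by omega) (by omega)).use rfl fun z hz => ⟨rfl, ?_⟩
    have h₆ : (A.size + 1) * (100 * M) ≤ M * (100 * M) := Nat.mul_le_mul_right _ (by omega)
    have h₇ : 100 * M ≤ M * (100 * M) := Nat.le_mul_of_pos_left _ (by omega)
    have h₉ : A.code.size * (100 * M) ≤ M * (100 * M) := Nat.mul_le_mul_right _ (by omega)
    have h₈ : M * (1000 * M) = 10 * (M * (100 * M)) := by ring
    simp only [Nat.add_mul, Nat.one_mul] at hz h₆ hw hu ⊢
    omega

/-! ### Running times for tracings, contractions and identities. -/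

/-- A bound for the running time of `expand`. -/
def expandCost (M : ℕ) : ℕ := (10 * (M * M)) * ((10 * (M * M)) * (5000 * (10 * (M * M))))

theorem expand_perm {σ : List ℕ} {xs : List (Fm Lit)} (h : σ.Perm (List.range xs.length)) :
    (expand σ xs).Perm (List.range (xs.map Fm.size).sum) := by
  have := h.flatMap_right fun i => (blocks 0 (xs.map Fm.size)).getD i []
  refine this.trans ?_
  have hl : (blocks 0 (xs.map Fm.size)).length = xs.length := by simp [length_blocks]
  rw [← hl, flatMap_range_getD, flatten_blocks, List.range_eq_range']

theorem sum_size_le (xs : List (Fm Lit)) :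
    (xs.map Fm.size).sum ≤ (Tree.ofList (xs.map Fm.code)).size := by
  induction xs with
  | nil => simp
  | cons A xs ih =>
    have := A.size_le_code
    simp only [List.map_cons, List.sum_cons, Tree.ofList, Tree.size]; omega

theorem expand_size {σ : List ℕ} {xs : List (Fm Lit)} {M : ℕ}
    (hx : (Tree.ofList (xs.map Fm.code)).size ≤ M) (h : σ.Perm (List.range xs.length)) :
    (natsCode (expand σ xs)).size ≤ M * (2 * M + 2) + 1 := by
  rw [natsCode_perm (expand_perm h)]
  exact natsCode_range _ _ ((sum_size_le xs).trans hx)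

theorem expand_runs (σ : List ℕ) (xs : List (Fm Lit)) {M : ℕ}
    (hx : (Tree.ofList (xs.map Fm.code)).size ≤ M) (h : σ.Perm (List.range xs.length)) :
    Runs prog 13 [natsCode σ, Tree.ofList (xs.map Fm.code)] (natsCode (expand σ xs))
      (expandCost M) := by
  have h₁ : xs.length ≤ M := by
    have := length_lt_size_ofList (xs.map Fm.code); simp only [List.length_map] at this; omega
  have hM : 1 ≤ M := (Tree.one_le_size _).trans hx
  have h₂ := sum_size_le xs
  have h₃ := natsCode_range _ _ (h₂.trans hx)
  have h₄ := natsCode_range xs.length _ h₁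
  rw [← natsCode_perm h] at h₄
  have h₅ := expand_size hx h
  set bs := blocks 0 (xs.map Fm.size) with hbs
  have hbl : bs.length = xs.length := by simp [hbs, length_blocks]
  have h₆ : (Tree.ofList (bs.map natsCode)).size =
      (natsCode (List.range (xs.map Fm.size).sum)).size + 2 * xs.length := by
    have := size_ofList_flatten (bs.map (List.map Tree.ofNat))
    rw [List.map_map, ← List.map_flatten, flatten_blocks, List.length_map, hbl,
      ← List.range_eq_range'] at this
    exact this
  have h₇ : (Tree.ofList (σ.map fun i => natsCode (bs.getD i []))).size =
      (natsCode (expand σ xs)).size + 2 * xs.length := by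
    have := size_ofList_flatten (σ.map fun i => (bs.getD i []).map Tree.ofNat)
    rw [List.map_map, List.length_map, h.length_eq, List.length_range] at this
    refine this.trans ?_
    simp only [natsCode, expand, List.flatMap_def, List.map_flatten, List.map_map]; rfl
  have h₈ : M ≤ M * M := Nat.le_mul_self M
  have h₉ : M * (2 * M + 2) = 2 * (M * M) + 2 * M := by ring
  have hσl : σ.length = xs.length := by rw [h.length_eq, List.length_range]
  rw [h₉] at h₃ h₄ h₅
  unfold expandCost
  -- Positions are unary numbers, so lists of them have size quadratic in `M`; `m` bounds all lists
  -- that occur.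
  generalize hm : 10 * (M * M) = m
  refine .intro (f := expandBody) rfl ?_
  simp only [expandBody, wp, hd, tl, v, Tree.ofList, Tree.head, Tree.tail, Tree.sel, Tree.size,
    app, list]
  refine (blocks_runs xs 0 (M := m) (by omega) (by omega)
    (by rw [← List.range_eq_range']; omega)).use rfl fun t ht => ?_
  refine (gather_runs σ (bs.map natsCode) (fun i => natsCode (bs.getD i [])) (M := m) (by omega)
    (by omega) (fun i hi => ?_) (by omega)).use rfl fun u hu => ?_
  · have : i < bs.length := by rw [hbl]; simpa using h.mem_iff.1 hi
    simp [this]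
  have e₁ : Tree.ofList (σ.map fun i => natsCode (bs.getD i [])) =
      Tree.ofList ((σ.map fun i => (bs.getD i []).map Tree.ofNat).map Tree.ofList) := by
    rw [List.map_map]; rfl
  have e₂ : (σ.map fun i => (bs.getD i []).map Tree.ofNat).flatten =
      (expand σ xs).map Tree.ofNat := by
    simp only [expand, List.flatMap_def, List.map_flatten, List.map_map]; rfl
  refine (concat_runs (σ.map fun i => (bs.getD i []).map Tree.ofNat) (M := m)
    (by rw [← e₁]; omega) (by rw [e₂]; unfold natsCode at h₅; omega)).use
      (by rw [← e₁]; rfl) fun w hw => ⟨by rw [e₂]; rfl, ?_⟩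
  simp only [List.length_map, hσl, ← hbs] at h₇ ht hu hw ⊢
  have g₁ : (xs.length + 1) * (m * (1000 * m)) ≤ m * (m * (1000 * m)) :=
    Nat.mul_le_mul_right _ (by omega)
  have g₂ : (xs.length + 1) * (m * (200 * m)) ≤ m * (m * (200 * m)) :=
    Nat.mul_le_mul_right _ (by omega)
  have g₃ : m * (m * (1000 * m)) = 1000 * (m * (m * m)) := by ring
  have g₄ : m * (m * (5000 * m)) = 5000 * (m * (m * m)) := by ring
  have g₅ : m * (m * (200 * m)) = 200 * (m * (m * m)) := by ring
  have g₆ : m ≤ m * (m * m) := Nat.le_mul_of_pos_right _ (Nat.mul_pos (by omega) (by omega))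
  omega

/-- The results of the recursive calls are disjoint parts of the output, so the time can be charged
to the length of the output. The same holds for `idAtom` and `idConj`. -/
theorem contr_runs {a : Lit} {T : Fm Lit} (h : T.IsConj a) {M : ℕ} (hM : (contr T).length ≤ M) :
    Runs prog 15 [T.code] (contr T).code ((contr T).length * (1000 * M)) := by
  induction T with
  | atom b =>
    refine .intro (f := contrBody) rfl ?_
    simp only [contrBody, wp, hd, tl, v, sw, Tree.ofList, Tree.head, Tree.tail, Tree.sel,
      Tree.size, Fm.code, ofNat_zero, ofNat_one, ofNat_two, ofNat_three, ofNat_four, step, tag,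
      tag₂,
      num, contr, Der.code, Rule.code, Der.length, Fm.size_atom, true_and] at *
    refine le_trans ?_ (Nat.le_mul_of_pos_left _ (by omega))
    omega
  | and X Y ihX ihY =>
    refine .intro (f := contrBody) rfl ?_
    have e₁ := h.1.one_le_size
    have e₂ : Tree.ofNat 7 = .cons .nil (.cons .nil (.cons .nil (Tree.ofNat 4))) := rfl
    simp only [contrBody, wp, hd, tl, v, sw, Tree.ofList, Tree.head, Tree.tail, Tree.sel,
      Tree.size, Fm.code, ofNat_zero, ofNat_one, ofNat_two, ofNat_three, ofNat_four, step, tag,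
      tag₂,
      num, contr, Der.code, Rule.code, Der.length, Fm.size_and, app, list, e₂] at *
    refine (ihX h.1 (by omega)).use rfl fun t ht => ?_
    refine (ihY h.2 (by omega)).use rfl fun u hu => ⟨rfl, ?_⟩
    simp only [Nat.add_mul, Tree.size, Nat.one_mul]
    omega
  | _ => cases h

/-- A bound for the running time of `meet`. -/
def meetCost (M : ℕ) : ℕ := 2 * expandCost (50 * M) + M * (1000 * M) + 5000 * M

theorem meet_runs {Φ Ψ : Der} {X Y Z : Fm Lit} {a : Lit} (hZ : Z.IsConj a) {M : ℕ}
    (hM : (meet Φ Ψ X Y Z).length ≤ M) :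
    Runs prog 16 [Φ.code, Ψ.code, X.code, Y.code, Z.code] (meet Φ Ψ X Y Z).code (meetCost M) := by
  have e₂ : Tree.ofNat 6 = .cons .nil (.cons .nil (Tree.ofNat 4)) := rfl
  have e₃ : Tree.ofNat 8 = .cons .nil (.cons .nil (Tree.ofNat 6)) := rfl
  have e₄ := expand_runs [2, 0, 1, 3] [X, Z, Y, Z] (M := 50 * M)
  have e₅ := expand_runs [1, 0, 2, 3] [Y, X, Z, Z] (M := 50 * M)
  refine .intro (f := meetBody) rfl ?_
  simp only [meetBody, wp, hd, tl, v, sw, Tree.ofList, Tree.head, Tree.tail, Tree.sel,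
    Tree.size, Fm.code, ofNat_zero, ofNat_one, ofNat_two, ofNat_three, ofNat_four, step, tag,
      tag₂,
    num, meet, Der.code, Rule.code, Der.length, app, list, e₂, e₃] at hM ⊢
  refine (e₄ (by simp only [List.map_cons, List.map_nil, Tree.ofList, Tree.size]; omega)
    (by simp; decide)).use rfl fun t ht => ?_
  refine (e₅ (by simp only [List.map_cons, List.map_nil, Tree.ofList, Tree.size]; omega)
    (by simp; decide)).use rfl fun u hu => ?_
  refine (contr_runs hZ (M := M) (by simp only [Der.length]; omega)).use rfl fun w hw => ⟨rfl, ?_⟩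
  have e₇ : (contr Z).length * (1000 * M) ≤ M * (1000 * M) :=
    Nat.mul_le_mul_right _ (by simp only [Der.length]; omega)
  simp only [meetCost, Tree.size, natsCode]
  linarith

theorem idAtom_runs {a : Lit} {Z : Fm Lit} (h : Z.IsConj a) {M : ℕ}
    (hM : (idAtom (.atom a.dual) Z).length ≤ M) :
    Runs prog 17 [(Fm.atom a.dual).code, Z.code] (idAtom (.atom a.dual) Z).code
      ((idAtom (.atom a.dual) Z).length * (2 * meetCost M)) := by
  generalize hb : Fm.atom a.dual = b at *
  induction Z with
  | atom c =>
    refine .intro (f := idAtomBody) rfl ?_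
    simp only [idAtomBody, wp, hd, tl, v, sw, Tree.ofList, Tree.head, Tree.tail, Tree.sel,
      Tree.size, Fm.code, ofNat_zero, ofNat_one, ofNat_two, ofNat_three, ofNat_four, step, tag,
      tag₂,
      num, idAtom, Der.code, Rule.code, Der.length, Fm.size_atom, true_and, meetCost] at *
    refine le_trans ?_ (Nat.le_mul_of_pos_left _ (by omega))
    omega
  | and X Y ihX ihY =>
    refine .intro (f := idAtomBody) rfl ?_
    have e₁ : b.IsConj a.dual := by subst hb; rfl
    have e₂ := meet_runs (Φ := idAtom b X) (Ψ := idAtom b Y) (X := X) (Y := Y) e₁ hM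
    simp only [idAtomBody, wp, hd, tl, v, sw, Tree.ofList, Tree.head, Tree.tail, Tree.sel,
      Tree.size, Fm.code, ofNat_zero, ofNat_one, ofNat_two, ofNat_three, ofNat_four,
      num, idAtom, Der.length, Fm.size_and, app, list] at *
    -- All arguments of `meet` occur in its result, so the bound `M` for the result also bounds
    -- them.
    have e₃ : (idAtom b X).code.size + (idAtom b Y).code.size + X.code.size + Y.code.size +
        b.code.size + 8 ≤ (meet (idAtom b X) (idAtom b Y) X Y b).code.size := by
      simp only [meet, Der.code, Tree.size, Fm.code, Tree.size_ofNat]; omega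
    refine (ihX h.1 (by omega)).use rfl fun t ht => ?_
    refine (ihY h.2 (by omega)).use rfl fun u hu => ?_
    refine e₂.use rfl fun w hw => ⟨rfl, ?_⟩
    have e₄ : 5000 * M ≤ meetCost M := by simp only [meetCost]; omega
    have e₅ : ((idAtom b X).code.size + (idAtom b Y).code.size + 1) * (2 * meetCost M) ≤
        (meet (idAtom b X) (idAtom b Y) X Y b).code.size * (2 * meetCost M) :=
      Nat.mul_le_mul_right _ (by omega)
    simp only [Nat.add_mul, Tree.size, Nat.one_mul] at e₅ ⊢
    omega
  | _ => cases h

theorem idConj_runs {a : Lit} {X Z : Fm Lit} (hX : X.IsConj a) (hZ : Z.IsConj a.dual) {M : ℕ}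
    (hM : (idConj Z X).length ≤ M) :
    Runs prog 18 [Z.code, X.code] (idConj Z X).code
      ((idConj Z X).length * (M * (4 * meetCost M))) := by
  have e₄ : 5000 * M + expandCost (50 * M) ≤ meetCost M := by simp only [meetCost]; omega
  induction X with
  | atom c =>
    cases hX
    refine .intro (f := idConjBody) rfl ?_
    have e₅ := idAtom_runs hZ (M := M)
    rw [Lit.dual_dual] at e₅
    have e₁ := expand_runs [1, 0] [Z, .atom a] (M := 50 * M)
    have e₃ : Tree.ofNat 8 = .cons .nil (.cons .nil (.cons .nil (.cons .nil (Tree.ofNat 4)))) := rfl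
    simp only [idConjBody, wp, hd, tl, v, sw, Tree.ofList, Tree.head, Tree.tail, Tree.sel,
      Tree.size, Fm.code, ofNat_zero, ofNat_one, ofNat_two, ofNat_three, ofNat_four, step, tag,
      tag₂,
      num, idConj, Der.code, Rule.code, Der.length, Fm.size_atom, e₃, app, list] at hM ⊢
    refine (e₁ (by simp only [List.map_cons, List.map_nil, Tree.ofList, Tree.size, Fm.code,
      Tree.size_ofNat]; omega) (by simp; decide)).use rfl fun t ht => ?_
    refine (e₅ (by simp only [Der.length]; omega)).use rfl fun u hu => ⟨rfl, ?_⟩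
    have e₇ : (idAtom (.atom a) Z).length * (2 * meetCost M) ≤ M * (2 * meetCost M) :=
      Nat.mul_le_mul_right _ (by simp only [Der.length]; omega)
    have e₈ : meetCost M ≤ M * meetCost M := Nat.le_mul_of_pos_left _ (by omega)
    have e₉ : M * (2 * meetCost M) = 2 * (M * meetCost M) := by ring
    have e₁₀ : M * (4 * meetCost M) = 4 * (M * meetCost M) := by ring
    refine le_trans ?_ (Nat.le_mul_of_pos_left _ (by omega))
    simp only [Tree.size, natsCode]
    omega
  | and X Y ihX ihY =>
    refine .intro (f := idConjBody) rfl ?_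
    have e₂ := meet_runs (Φ := idConj Z X) (Ψ := idConj Z Y) (X := X) (Y := Y) hZ hM
    simp only [idConjBody, wp, hd, tl, v, sw, Tree.ofList, Tree.head, Tree.tail, Tree.sel,
      Tree.size, Fm.code, ofNat_zero, ofNat_one, ofNat_two, ofNat_three, ofNat_four,
      num, idConj, Der.length, Fm.size_and, app, list] at *
    have e₃ : (idConj Z X).code.size + (idConj Z Y).code.size + X.code.size + Y.code.size +
        Z.code.size + 8 ≤ (meet (idConj Z X) (idConj Z Y) X Y Z).code.size := by
      simp only [meet, Der.code, Tree.size, Fm.code, Tree.size_ofNat]; omega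
    refine (ihX hX.1 (by omega)).use rfl fun t ht => ?_
    refine (ihY hX.2 (by omega)).use rfl fun u hu => ?_
    refine e₂.use rfl fun w hw => ⟨rfl, ?_⟩
    have e₈ : meetCost M ≤ M * meetCost M := Nat.le_mul_of_pos_left _ (by omega)
    have e₁₀ : M * (4 * meetCost M) = 4 * (M * meetCost M) := by ring
    have e₅ : ((idConj Z X).code.size + (idConj Z Y).code.size + 1) * (M * (4 * meetCost M)) ≤
        (meet (idConj Z X) (idConj Z Y) X Y Z).code.size * (M * (4 * meetCost M)) :=
      Nat.mul_le_mul_right _ (by omega)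
    simp only [Nat.add_mul, Tree.size, Nat.one_mul] at e₅ ⊢
    omega
  | _ => cases hX

/-! ### Inference steps -/

/-- The code of the literal of an edge, if the edge leads to the conclusion. -/
def Deco.zc (𝔡 : Deco) (e : ℕ) : Tree := if (𝔡.tree e).isSome then (𝔡.lab e).code else .nil

/-- The code of the information whether an edge is dead. -/
def Deco.dc (𝔡 : Deco) (e : ℕ) : Tree := Tree.ofBool (𝔡.dead e)

/-- The formula that is substituted for an atom. -/
def Deco.val (𝔡 : Deco) (e : ℕ) : Fm Lit :=
  match 𝔡.tree e with
  | none => .top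
  | some T => if 𝔡.dead e then .bot else T

/-- The code of the formula that is substituted for an atom. -/
def Deco.vc (𝔡 : Deco) (e : ℕ) : Tree := (𝔡.val e).code

/-- A bound for the running time of `up` and `down`. -/
def traceCost (M : ℕ) : ℕ := (2 * M) * ((2 * M) * (3000 * (2 * M)))

theorem le_traceCost {M : ℕ} (hM : 1 ≤ M) : 6000 * M ≤ traceCost M := by
  have h₁ : 1 ≤ M * M := Nat.mul_pos hM hM
  have h₂ : traceCost M = (M * M) * (24000 * M) := by unfold traceCost; ring
  have h₃ := Nat.le_mul_of_pos_left (24000 * M) h₁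
  omega

theorem ofNat_eight :
    Tree.ofNat 8 = .cons .nil (.cons .nil (.cons .nil (.cons .nil (Tree.ofNat 4)))) := rfl
theorem ofNat_five : Tree.ofNat 5 = .cons .nil (Tree.ofNat 4) := rfl
theorem ofNat_six : Tree.ofNat 6 = .cons .nil (.cons .nil (Tree.ofNat 4)) := rfl
theorem ofNat_seven : Tree.ofNat 7 = .cons .nil (.cons .nil (.cons .nil (Tree.ofNat 4))) := rfl

theorem length_lt_size_natsCode (σ : List ℕ) : 2 * σ.length + 1 ≤ (natsCode σ).size := by
  simpa [natsCode] using length_lt_size_ofList (σ.map Tree.ofNat)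

theorem up_runs_eq {σ : List ℕ} {X Y : Fm ℕ} (h : EqSkel σ X Y) (ε : ℕ → ℕ) (lab : ℕ → Lit)
    (g : ℕ → Tree) {M : ℕ} (h₁ : (Rule.eq σ).code.size ≤ M)
    (h₂ : ((X.map ε).map lab).code.size ≤ M) (h₃ : ((Y.map ε).enc g).size ≤ M)
    (h₄ : ((X.map ε).enc g).size ≤ M) :
    Runs prog 19 [(Rule.eq σ).code, ((X.map ε).map lab).code, (Y.map ε).enc g]
      ((X.map ε).enc g) (traceCost M) := by
  have e₁ := size_ofList_atoms g (Y.map ε)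
  have e₂ := size_ofList_atoms g (X.map ε)
  have e₃ := size_ofList_atoms (Lit.code ∘ lab) (X.map ε)
  have e₄ : ((X.map ε).map lab).code = (X.map ε).enc (Lit.code ∘ lab) := by
    rw [Fm.code_eq_enc, Fm.enc_map]
  rw [e₄] at h₂ ⊢
  have hY : (Y.map ε).atoms.map g = σ.map (g ∘ ε) := by rw [Fm.atoms_map, h.cn, List.map_map]
  have hX : (X.map ε).atoms.map g = (List.range X.size).map (g ∘ ε) := by
    rw [Fm.atoms_map, h.pr, List.map_map]
  have hl : ((X.map ε).atoms.map (Lit.code ∘ lab)).length = X.size := by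
    rw [List.length_map]; exact Fm.size_map _ _
  have hsc : scatter σ (σ.map (g ∘ ε)) ((X.map ε).atoms.map (Lit.code ∘ lab)) =
      (X.map ε).atoms.map g := by
    rw [scatter_eq _ _ _ fun i hi => h.perm.mem_iff.2 (by simpa [hl] using hi), hl, hX]
  have hσ := length_lt_size_natsCode σ
  refine .intro (f := upBody) rfl ?_
  simp only [upBody, wp, hd, tl, v, sw, Tree.ofList, Tree.head, Tree.tail, Tree.sel,
      Tree.size, ofNat_zero, ofNat_one, ofNat_two, ofNat_three, ofNat_four, ofNat_eight, tag, tag₂,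
      num, app, list, Rule.code, ← natsCode.eq_1] at h₁ ⊢
  refine (flat_runs g (Y.map ε) [] (M := M) h₃ (by simpa using e₁.trans h₃)).use rfl
    fun t₁ ht₁ => ?_
  refine (flat_runs (Lit.code ∘ lab) (X.map ε) [] (M := M) h₂ (by simpa using e₃.trans h₂)).use rfl
    fun t₂ ht₂ => ?_
  simp only [List.append_nil]
  refine (scat_runs σ ((Y.map ε).atoms.map g) ((X.map ε).atoms.map (Lit.code ∘ lab)) (M := 2 * M)
    (by omega) (fun i hi => by rw [hl]; exact h.lt hi) (by omega) (by omega)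
    (by rw [hY, List.length_map])).use rfl fun t₃ ht₃ => ?_
  rw [hY, hsc]
  refine (fill_runs (Lit.code ∘ lab) g (X.map ε) [] (M := 2 * M) (by omega) (by omega)
    (by rw [List.append_nil]; omega)).use (by rw [List.append_nil]; rfl)
    fun t₄ ht₄ => ⟨rfl, ?_⟩
  rw [hY] at e₁
  have g₁ : ((Y.map ε).enc g).size * (100 * M) ≤ M * (100 * M) := Nat.mul_le_mul_right _ h₃
  have g₂ : ((X.map ε).enc (Lit.code ∘ lab)).size * (100 * M) ≤ M * (100 * M) :=
    Nat.mul_le_mul_right _ h₂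
  have g₃ : ((X.map ε).enc (Lit.code ∘ lab)).size * (200 * (2 * M)) ≤ M * (200 * (2 * M)) :=
    Nat.mul_le_mul_right _ h₂
  have g₄ : (σ.length + 1) * (2 * M * (300 * (2 * M))) ≤ M * (2 * M * (300 * (2 * M))) :=
    Nat.mul_le_mul_right _ (by omega)
  have g₅ : M * (2 * M * (300 * (2 * M))) = 1200 * (M * (M * M)) := by ring
  have g₆ : traceCost M = 24000 * (M * (M * M)) := by unfold traceCost; ring
  have g₇ : M * M ≤ M * (M * M) := Nat.le_mul_of_pos_left _ (by omega)
  have g₈ : M ≤ M * M := Nat.le_mul_self M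
  have g₉ : M * (200 * (2 * M)) = 400 * (M * M) := by ring
  have g₁₀ : M * (100 * M) = 100 * (M * M) := by ring
  rw [g₆]
  simp only [Tree.head, Tree.size]
  omega

/-- Switch, medial and `=` rearrange atoms, so any annotation passes through them; the values in
particular do. Through the structural rules only the annotation by literals does, for which the
equations in `Deco.Sat` give what the program computes. -/
theorem up_runs {𝔡 : Deco} {ρ : Rule} {X Y : Fm ℕ} (h : 𝔡.Local ρ X Y)
    (g : ℕ → Tree) (hg : g = 𝔡.zc ∨ ρ = .swi ∨ ρ = .med ∨ ∃ σ, ρ = .eq σ) {M : ℕ}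
    (h₁ : ρ.code.size ≤ M) (h₂ : (X.map 𝔡.lab).code.size ≤ M) (h₃ : (Y.enc g).size ≤ M)
    (h₄ : (X.enc g).size ≤ M) :
    Runs prog 19 [ρ.code, (X.map 𝔡.lab).code, Y.enc g] (X.enc g) (traceCost M) := by
  have hM := le_traceCost (X.enc g |>.one_le_size.trans h₄)
  have hz : ∀ {e : ℕ}, 𝔡.zc e = if (𝔡.tree e).isSome then (𝔡.lab e).code else .nil := rfl
  cases h with
  | eq h ε => exact up_runs_eq h ε _ g h₁ h₂ h₃ h₄
  | aid hs =>
    refine .intro (f := upBody) rfl ?_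
    simp only [upBody, wp, hd, tl, v, sw, Tree.ofList, Tree.head, Tree.tail, Tree.sel,
      Tree.size, ofNat_zero, ofNat_one, ofNat_two, ofNat_three, ofNat_four, tag, tag₂,
      num, Rule.code, Fm.enc, Fm.map, Fm.code, true_and] at *
    omega
  | awd hs =>
    refine .intro (f := upBody) rfl ?_
    simp only [upBody, wp, hd, tl, v, sw, Tree.ofList, Tree.head, Tree.tail, Tree.sel,
      Tree.size, ofNat_zero, ofNat_one, ofNat_two, ofNat_three, ofNat_four, tag, tag₂,
      num, Rule.code, Fm.enc, Fm.map, Fm.code, true_and] at *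
    omega
  | @awu e hs =>
    obtain rfl : g = 𝔡.zc := by simpa using hg
    refine .intro (f := upBody) rfl ?_
    have : 𝔡.zc e = .nil := by simp [hz, show 𝔡.tree e = none from hs]
    simp only [upBody, wp, hd, tl, v, sw, Tree.ofList, Tree.head, Tree.tail, Tree.sel,
      Tree.size, ofNat_zero, ofNat_one, ofNat_two, ofNat_three, ofNat_four, tag, tag₂,
      num, Rule.code, Fm.enc, Fm.map, Fm.code, this, true_and] at *
    omega
  | @acd l r e hs =>
    obtain rfl : g = 𝔡.zc := by simpa using hg
    refine .intro (f := upBody) rfl ?_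
    have e₁ : 𝔡.zc l = 𝔡.zc e := by simp [hz, hs.1, hs.2.1]
    have e₂ : 𝔡.zc r = 𝔡.zc e := by simp [hz, hs.1, hs.2.1]
    simp only [upBody, wp, hd, tl, v, sw, Tree.ofList, Tree.head, Tree.tail, Tree.sel,
      Tree.size, ofNat_zero, ofNat_one, ofNat_two, ofNat_three, ofNat_four, tag, tag₂,
      num, Rule.code, Fm.enc, Fm.map, Fm.code, e₁, e₂, true_and] at *
    omega
  | @acu e l r hs =>
    obtain rfl : g = 𝔡.zc := by simpa using hg
    refine .intro (f := upBody) rfl ?_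
    obtain ⟨⟨hl, hr⟩, ht, -⟩ := hs
    cases hl' : 𝔡.tree l with
    | none =>
      have e₁ : 𝔡.zc l = .nil := by simp [hz, hl']
      have e₂ : 𝔡.zc e = 𝔡.zc r := by simp [hz, hr, ht, hl', conj]
      simp only [upBody, wp, hd, tl, v, sw, Tree.ofList, Tree.head, Tree.tail, Tree.sel,
        Tree.size, ofNat_zero, ofNat_one, ofNat_two, ofNat_three, ofNat_four, ofNat_five, tag, tag₂,
        num, Rule.code, Fm.enc, Fm.map, Fm.code, e₁, e₂, true_and] at *
      omega
    | some T =>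
      have e₁ : 𝔡.zc l = (𝔡.lab e).code := by simp [hz, hl', hl]
      have e₂ : 𝔡.zc e = (𝔡.lab e).code := by
        simp only [hz, ht, hl']; cases 𝔡.tree r <;> simp [conj]
      simp only [upBody, wp, hd, tl, v, sw, Tree.ofList, Tree.head, Tree.tail, Tree.sel,
        Tree.size, ofNat_zero, ofNat_one, ofNat_two, ofNat_three, ofNat_four, ofNat_five, tag, tag₂,
        num, Rule.code, Lit.code, Fm.enc, Fm.map, Fm.code, e₁, e₂, true_and] at *
      omega
  | swi A B C =>
    refine .intro (f := upBody) rfl ?_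
    simp only [upBody, wp, hd, tl, v, sw, Tree.ofList, Tree.head, Tree.tail, Tree.sel,
      Tree.size, ofNat_zero, ofNat_one, ofNat_two, ofNat_three, ofNat_four, ofNat_six, tag, tag₂,
      num, Rule.code, Fm.enc, Fm.map, Fm.code, true_and] at *
    linarith
  | med A B C D =>
    refine .intro (f := upBody) rfl ?_
    simp only [upBody, wp, hd, tl, v, sw, Tree.ofList, Tree.head, Tree.tail, Tree.sel,
      Tree.size, ofNat_zero, ofNat_one, ofNat_two, ofNat_three, ofNat_four, ofNat_seven, tag, tag₂,
      num, Rule.code, Fm.enc, Fm.map, Fm.code, true_and] at *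
    linarith

theorem down_runs_eq {σ : List ℕ} {X Y : Fm ℕ} (h : EqSkel σ X Y) (ε : ℕ → ℕ)
    (g u : ℕ → Tree) {M : ℕ} (h₁ : (Rule.eq σ).code.size ≤ M)
    (h₂ : ((X.map ε).enc g).size ≤ M) (h₃ : ((Y.map ε).enc u).size ≤ M)
    (h₄ : ((Y.map ε).enc g).size ≤ M) :
    Runs prog 20 [(Rule.eq σ).code, (X.map ε).enc g, (Y.map ε).enc u]
      ((Y.map ε).enc g) (traceCost M) := by
  have e₁ := size_ofList_atoms g (Y.map ε)
  have e₂ := size_ofList_atoms g (X.map ε)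
  have hY : (Y.map ε).atoms.map g = σ.map (g ∘ ε) := by rw [Fm.atoms_map, h.cn, List.map_map]
  have hX : (X.map ε).atoms.map g = (List.range X.size).map (g ∘ ε) := by
    rw [Fm.atoms_map, h.pr, List.map_map]
  have hσ := length_lt_size_natsCode σ
  refine .intro (f := downBody) rfl ?_
  simp only [downBody, wp, hd, tl, v, sw, Tree.ofList, Tree.head, Tree.tail, Tree.sel,
      Tree.size, ofNat_zero, ofNat_one, ofNat_two, ofNat_three, ofNat_four, ofNat_eight, tag, tag₂,
      num, app, list, Rule.code, ← natsCode.eq_1] at h₁ ⊢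
  refine (flat_runs g (X.map ε) [] (M := M) h₂ (by simpa using e₂.trans h₂)).use rfl
    fun t₁ ht₁ => ?_
  simp only [List.append_nil]
  refine (gather_runs σ ((X.map ε).atoms.map g) (g ∘ ε) (M := M)
    (by omega) (by omega) (fun i hi => by rw [hX]; simp [h.lt hi])
    (by rw [← hY]; omega)).use rfl fun t₃ ht₃ => ?_
  rw [← hY]
  refine (fill_runs u g (Y.map ε) [] (M := M) h₃ h₄
    (by rw [List.append_nil]; omega)).use (by rw [List.append_nil]; rfl)
    fun t₄ ht₄ => ⟨rfl, ?_⟩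
  have g₂ : ((X.map ε).enc g).size * (100 * M) ≤ M * (100 * M) :=
    Nat.mul_le_mul_right _ h₂
  have g₃ : ((Y.map ε).enc u).size * (200 * M) ≤ M * (200 * M) :=
    Nat.mul_le_mul_right _ h₃
  have g₄ : (σ.length + 1) * (M * (200 * M)) ≤ M * (M * (200 * M)) :=
    Nat.mul_le_mul_right _ (by omega)
  have g₅ : M * (M * (200 * M)) = 200 * (M * (M * M)) := by ring
  have g₆ : traceCost M = 24000 * (M * (M * M)) := by unfold traceCost; ring
  have g₇ : M * M ≤ M * (M * M) := Nat.le_mul_of_pos_left _ (by omega)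
  have g₈ : M ≤ M * M := Nat.le_mul_self M
  have g₉ : M * (200 * M) = 200 * (M * M) := by ring
  have g₁₀ : M * (100 * M) = 100 * (M * M) := by ring
  rw [g₆]
  simp only [Tree.head, Tree.size]
  omega

theorem down_runs {𝔡 : Deco} {ρ : Rule} {X Y : Fm ℕ} (h : 𝔡.Local ρ X Y) {M : ℕ}
    (h₁ : ρ.code.size ≤ M) (h₂ : (X.enc 𝔡.dc).size ≤ M) (h₃ : (Y.enc 𝔡.zc).size ≤ M)
    (h₄ : (Y.enc 𝔡.dc).size ≤ M) :
    Runs prog 20 [ρ.code, X.enc 𝔡.dc, Y.enc 𝔡.zc] (Y.enc 𝔡.dc) (traceCost M) := by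
  have hM := le_traceCost (X.enc 𝔡.dc |>.one_le_size.trans h₂)
  have hz : ∀ {e : ℕ}, 𝔡.zc e = if (𝔡.tree e).isSome then (𝔡.lab e).code else .nil := rfl
  have hd' : ∀ {e : ℕ}, 𝔡.dc e = Tree.ofBool (𝔡.dead e) := rfl
  cases h with
  | eq h ε => exact down_runs_eq h ε _ _ h₁ h₂ h₃ h₄
  | @aid l r hs =>
    refine .intro (f := downBody) rfl ?_
    have hl : 𝔡.dc l = if (𝔡.tree r).isSome then .nil else .cons .nil .nil := by
      rw [hd', hs.2.1]; cases 𝔡.tree r <;> rfl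
    have hr : 𝔡.dc r = if (𝔡.tree l).isSome then .nil else .cons .nil .nil := by
      rw [hd', hs.2.2]; cases 𝔡.tree l <;> rfl
    cases hl' : (𝔡.tree l).isSome <;> cases hr' : (𝔡.tree r).isSome <;>
    · simp only [downBody, wp, hd, tl, v, sw, Tree.ofList, Tree.head, Tree.tail, Tree.sel,
        Tree.size, ofNat_zero, ofNat_one, ofNat_two, ofNat_three, ofNat_four, tag, tag₂,
        num, Rule.code, Fm.enc, hl, hr, hl', hr', hz, Lit.code, if_true, if_false,
        Bool.false_eq_true, true_and] at *
      omega
  | @awd e hs =>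
    refine .intro (f := downBody) rfl ?_
    have e₁ : 𝔡.dc e = .cons .nil .nil := by rw [hd', show 𝔡.dead e = true from hs]; rfl
    simp only [downBody, wp, hd, tl, v, sw, Tree.ofList, Tree.head, Tree.tail, Tree.sel,
      Tree.size, ofNat_zero, ofNat_one, ofNat_two, ofNat_three, ofNat_four, tag, tag₂,
      num, Rule.code, Fm.enc, e₁, true_and] at *
    omega
  | @awu e hs =>
    refine .intro (f := downBody) rfl ?_
    simp only [downBody, wp, hd, tl, v, sw, Tree.ofList, Tree.head, Tree.tail, Tree.sel,
      Tree.size, ofNat_zero, ofNat_one, ofNat_two, ofNat_three, ofNat_four, tag, tag₂,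
      num, Rule.code, Fm.enc, true_and] at *
    omega
  | @acd l r e hs =>
    refine .intro (f := downBody) rfl ?_
    cases hl : 𝔡.dead l
    · have e₁ : 𝔡.dc l = .nil := by rw [hd', hl]; rfl
      have e₂ : 𝔡.dc e = .nil := by rw [hd', hs.2.2, hl]; rfl
      simp only [downBody, wp, hd, tl, v, sw, Tree.ofList, Tree.head, Tree.tail, Tree.sel,
        Tree.size, ofNat_zero, ofNat_one, ofNat_two, ofNat_three, ofNat_four, tag, tag₂,
        num, Rule.code, Fm.enc, e₁, e₂, true_and] at *
      omega
    · have e₁ : 𝔡.dc l = .cons .nil .nil := by rw [hd', hl]; rfl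
      have e₂ : 𝔡.dc e = 𝔡.dc r := by rw [hd', hs.2.2, hl]; rfl
      simp only [downBody, wp, hd, tl, v, sw, Tree.ofList, Tree.head, Tree.tail, Tree.sel,
        Tree.size, ofNat_zero, ofNat_one, ofNat_two, ofNat_three, ofNat_four, tag, tag₂,
        num, Rule.code, Fm.enc, e₁, e₂, true_and] at *
      omega
  | @acu e l r hs =>
    refine .intro (f := downBody) rfl ?_
    have e₁ : 𝔡.dc l = 𝔡.dc e := by rw [hd', hs.2.2.1]; rfl
    have e₂ : 𝔡.dc r = 𝔡.dc e := by rw [hd', hs.2.2.2]; rfl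
    simp only [downBody, wp, hd, tl, v, sw, Tree.ofList, Tree.head, Tree.tail, Tree.sel,
      Tree.size, ofNat_zero, ofNat_one, ofNat_two, ofNat_three, ofNat_four, ofNat_five, tag, tag₂,
      num, Rule.code, Fm.enc, e₁, e₂, true_and] at *
    omega
  | swi A B C =>
    refine .intro (f := downBody) rfl ?_
    simp only [downBody, wp, hd, tl, v, sw, Tree.ofList, Tree.head, Tree.tail, Tree.sel,
      Tree.size, ofNat_zero, ofNat_one, ofNat_two, ofNat_three, ofNat_four, ofNat_six, tag, tag₂,
      num, Rule.code, Fm.enc, true_and] at *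
    linarith
  | med A B C D =>
    refine .intro (f := downBody) rfl ?_
    simp only [downBody, wp, hd, tl, v, sw, Tree.ofList, Tree.head, Tree.tail, Tree.sel,
      Tree.size, ofNat_zero, ofNat_one, ofNat_two, ofNat_three, ofNat_four, ofNat_seven, tag, tag₂,
      num, Rule.code, Fm.enc, true_and] at *
    linarith

theorem Tree.head_nil : Tree.nil.head = .nil := rfl
theorem Tree.head_cons (x y : Tree) : (Tree.cons x y).head = x := rfl
theorem Tree.tail_nil : Tree.nil.tail = .nil := rfl
theorem Tree.tail_cons (x y : Tree) : (Tree.cons x y).tail = y := rfl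
theorem Tree.sel_nil {α : Type*} (a b : α) : Tree.nil.sel a b = b := rfl
theorem Tree.sel_cons {α : Type*} (x y : Tree) (a b : α) : (Tree.cons x y).sel a b = a := rfl

theorem Fm.IsConj.head_code {a : Lit} {T : Fm Lit} (h : T.IsConj a) :
    ∃ x, T.code.head = .cons .nil (.cons .nil x) ∧ x.size ≤ T.code.size := by
  cases T <;> simp_all [Fm.IsConj, Fm.code, Tree.head, ofNat_two, ofNat_three, Tree.size]; omega

theorem Deco.val_none {𝔡 : Deco} {e : ℕ} (h : 𝔡.tree e = none) : 𝔡.val e = .top := by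
  simp [Deco.val, h]

theorem Deco.val_dead {𝔡 : Deco} {e : ℕ} {T : Fm Lit} (h : 𝔡.tree e = some T)
    (h' : 𝔡.dead e = true) : 𝔡.val e = .bot := by
  simp [Deco.val, h, h']

theorem Deco.val_live {𝔡 : Deco} {e : ℕ} {T : Fm Lit} (h : 𝔡.tree e = some T)
    (h' : 𝔡.dead e = false) : 𝔡.val e = T := by
  simp [Deco.val, h, h']

/-! ### Replacing an inference step. -/

/-- A bound for the size of the derivation which replaces an inference step. -/
def stepSize (N : ℕ) : ℕ := 96 * (N * (N * N * N)) + 3 * N * N + N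

/-- A bound for the length of what replaces an inference step. -/
def stepLength (M : ℕ) : ℕ :=
  2 * M * ((2 * M + 2) * meetLength M) + 2 * M * (3 * M + 60) + (20 + M * (2 * M + 2)) + 500

theorem le_stepLength (M : ℕ) : M + 500 ≤ stepLength M := by
  have := Nat.le_mul_of_pos_right M (by omega : 0 < 2 * M + 2)
  unfold stepLength; omega

/-- The tree `r` encodes a rule, and possibly a derivation with another rule, which fill the gap
between the formulae `A` and `B`. -/
def Fills (A B : Fm Lit) (q L : ℕ) (r : Tree) : Prop :=
  (∃ ρ ∈ KS, r = .cons ρ.code .nil ∧ Inst ρ A B ∧ ρ.code.size ≤ L) ∨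
  ∃ ρ₁ ∈ KS, ∃ ρ₂ ∈ KS, ∃ χ : Der, r = .cons ρ₁.code (.cons ρ₂.code χ.code) ∧
    χ.IsDerivation KS ∧ Inst ρ₁ A χ.pr ∧ Inst ρ₂ χ.cn B ∧ ρ₁.code.size ≤ L ∧ ρ₂.code.size ≤ L ∧
    χ.length ≤ L ∧ χ.size ≤ q

theorem Fills.eq {A B : Fm Lit} {σ : List ℕ} (h : EqTrace A B σ) {q M : ℕ} (hM : A.size ≤ M) :
    Fills A B q (stepLength M) (.cons (Rule.eq σ).code .nil) :=
  .inl ⟨.eq σ, eq_mem_KS _, rfl, .eq h, (h.code_size hM).trans (by unfold stepLength; omega)⟩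

/-- Derivations can only be put together by a rule, so where nothing is to happen they are glued by
an `=` step with the identical tracing. -/
theorem eqTrace_refl (A : Fm Lit) : EqTrace A A (expand [0] [A]) :=
  EqSkel.eqTrace (X := .atom 0) (Y := .atom 0) ⟨rfl, rfl, .refl _⟩ (fun i => [A].getD i .top)

theorem eqTrace_bot_or (A : Fm Lit) : EqTrace (.or .bot A) A (expand [0] [A]) :=
  EqSkel.eqTrace (X := .or .bot (.atom 0)) (Y := .atom 0)
    ⟨rfl, rfl, (Fm.Eqv.or_comm _ _).trans (.or_bot _)⟩ (fun i => [A].getD i .top)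

theorem eqTrace_or_bot (A : Fm Lit) : EqTrace (.or A .bot) A (expand [0] [A]) :=
  EqSkel.eqTrace (X := .or (.atom 0) .bot) (Y := .atom 0)
    ⟨rfl, rfl, .or_bot _⟩ (fun i => [A].getD i .top)

theorem eqTrace_and_top (A : Fm Lit) : EqTrace A (.and A .top) (expand [0] [A]) :=
  EqSkel.eqTrace (X := .atom 0) (Y := .and (.atom 0) .top)
    ⟨rfl, rfl, .symm (.and_top _)⟩ (fun i => [A].getD i .top)

theorem eqTrace_top_and (A : Fm Lit) : EqTrace A (.and .top A) (expand [0] [A]) :=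
  EqSkel.eqTrace (X := .atom 0) (Y := .and .top (.atom 0))
    ⟨rfl, rfl, .symm ((Fm.Eqv.and_comm _ _).trans (.and_top _))⟩ (fun i => [A].getD i .top)

theorem eqTrace_top_or {A : Fm Lit} (h : A = .top ∨ A = .bot) :
    EqTrace .top (.or .top A) [] ∧ EqTrace .top (.or A .top) [] := by
  have h₁ : (Fm.or .top A).Eqv .top := by
    rcases h with rfl | rfl
    · exact .top_or_top
    · exact .or_bot _
  exact ⟨.nil h₁.symm rfl, .nil (.symm (.trans (.or_comm _ _) h₁)) rfl⟩

/-- A bound for the running times of `contr` and `idConj` within `loc`. -/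
def builderCost (M : ℕ) : ℕ :=
  let L := stepLength M + 50 * M
  L * (L * (4 * meetCost L)) + L * (1000 * L)

/-- A bound for the running time of `loc`. -/
def locCost (M : ℕ) : ℕ :=
  builderCost M + 3 * expandCost (50 * M) + traceCost M + M * (200 * M) +
    10000 * (stepLength M + 50 * M)

theorem contr_runs' {a : Lit} {T : Fm Lit} (h : T.IsConj a) {M : ℕ}
    (hM : (contr T).length ≤ stepLength M) :
    Runs prog 15 [T.code] (contr T).code (builderCost M) := by
  refine (contr_runs h (M := stepLength M + 50 * M) (by omega)).mono ?_
  have := Nat.mul_le_mul_right (1000 * (stepLength M + 50 * M))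
    (by omega : (contr T).length ≤ stepLength M + 50 * M)
  simp only [builderCost]
  omega

theorem idConj_runs' {a : Lit} {X Z : Fm Lit} (hX : X.IsConj a) (hZ : Z.IsConj a.dual) {M : ℕ}
    (hM : (idConj Z X).length ≤ stepLength M) :
    Runs prog 18 [Z.code, X.code] (idConj Z X).code (builderCost M) := by
  refine (idConj_runs hX hZ (M := stepLength M + 50 * M) (by omega)).mono ?_
  have := Nat.mul_le_mul_right
    ((stepLength M + 50 * M) * (4 * meetCost (stepLength M + 50 * M)))
    (by omega : (idConj Z X).length ≤ stepLength M + 50 * M)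
  simp only [builderCost]
  omega

theorem refl_runs (A : Fm Lit) {M : ℕ} (h : A.code.size ≤ M) :
    Runs prog 13 [.cons .nil .nil, .cons A.code .nil] (natsCode (expand [0] [A]))
      (expandCost (50 * M)) := by
  have := A.code.one_le_size
  exact expand_runs [0] [A] (M := 50 * M)
    (by simp only [List.map_cons, List.map_nil, Tree.ofList, Tree.size]; omega) (by simp)

theorem natsCode_refl_size (A : Fm Lit) {M : ℕ} (h : A.code.size ≤ M) :
    (natsCode (expand [0] [A])).size ≤ stepLength M := by
  have h₁ := (eqTrace_refl A).code_size (A.size_le_code.trans h)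
  simp only [Rule.code, Tree.size] at h₁
  unfold stepLength natsCode
  omega

/-- If both edges have trees, both are live and of size at most `N`, and `idConj` applies. Otherwise
one value is ⊤ and the other is a unit. -/
theorem loc_runs_aid {𝔡 : Deco} {N : ℕ} (hOK : 𝔡.OK N) {l r : ℕ} (hs : 𝔡.Sat (.aid l r)) {M : ℕ}
    {xA xX : Tree} (h₁ : xA.size ≤ M) (h₂ : xX.size ≤ M)
    (h₃ : ((Fm.or (.atom l) (.atom r)).enc 𝔡.vc).size ≤ M) :
    ∃ y, Runs prog 21 [Rule.aid.code, xA, xX, (Fm.or (.atom l) (.atom r)).enc 𝔡.vc]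
      (.cons (Tree.cons .nil .nil) y) (locCost M) ∧
      Fills .top (.or (𝔡.val l) (𝔡.val r)) (stepSize N) (stepLength M) y := by
  obtain ⟨hlab, hl, hr⟩ := hs
  have hv : ∀ e, 𝔡.vc e = (𝔡.val e).code := fun _ => rfl
  have hM := le_stepLength M
  -- All cases in which one of the edges has no tree.
  have key : ∀ A B : Fm Lit, 𝔡.val l = A → 𝔡.val r = B →
      (A = .top ∧ (B = .top ∨ B = .bot)) ∨ (B = .top ∧ (A = .top ∨ A = .bot)) →
      ∃ y, Runs prog 21 [Rule.aid.code, xA, xX, (Fm.or (.atom l) (.atom r)).enc 𝔡.vc]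
      (.cons (Tree.cons .nil .nil) y) (locCost M) ∧
      Fills .top (.or (𝔡.val l) (𝔡.val r)) (stepSize N) (stepLength M) y := by
    intro A B hA hB h
    refine ⟨.cons (Rule.eq []).code .nil, .intro (f := locBody) rfl ?_, .eq ?_ (Nat.zero_le _)⟩
    · rcases h with ⟨rfl, rfl | rfl⟩ | ⟨rfl, rfl | rfl⟩ <;>
      · simp only [locBody, wp, hd, tl, v, sw, Tree.ofList, Tree.head_nil, Tree.head_cons,
          Tree.tail_nil, Tree.tail_cons, Tree.sel_nil, Tree.sel_cons,
          Tree.size, ofNat_zero, ofNat_one, ofNat_two, ofNat_three, ofNat_four, ofNat_eight, tag,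
          tag₂, num, letIn, Rule.code, Fm.enc, Fm.code, hv, hA, hB, List.map_nil, true_and] at *
        simp only [locCost]
        omega
    · rw [hA, hB]
      rcases h with ⟨rfl, h⟩ | ⟨rfl, h⟩
      · exact (eqTrace_top_or h).1
      · exact (eqTrace_top_or h).2
  cases hl' : 𝔡.tree l with
  | none =>
    cases hr' : 𝔡.tree r with
    | none => exact key _ _ (Deco.val_none hl') (Deco.val_none hr') (by simp)
    | some T => exact key _ _ (Deco.val_none hl') (Deco.val_dead hr' (by simp [hr, hl'])) (by simp)
  | some S =>
    cases hr' : 𝔡.tree r with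
    | none => exact key _ _ (Deco.val_dead hl' (by simp [hl, hr'])) (Deco.val_none hr') (by simp)
    | some T =>
      have hdl : 𝔡.dead l = false := by simp [hl, hr']
      have hdr : 𝔡.dead r = false := by simp [hr, hl']
      have hA := Deco.val_live hl' hdl
      have hB := Deco.val_live hr' hdr
      have hS := hOK.isConj _ _ hl'
      have hT := hOK.isConj _ _ hr'
      rw [hlab] at hT
      have sS := hOK.size_le _ _ hdl hl'
      have sT := hOK.size_le _ _ hdr hr'
      obtain ⟨x, hx, hx'⟩ := hS.head_code
      obtain ⟨z, hz, hz'⟩ := hT.head_code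
      obtain ⟨p₁, p₂⟩ := idConj_isProof hS hT
      have p₃ := idConj_size hS hT sS sT
      have h₃' := h₃
      simp only [Fm.enc, hv, hA, hB, Tree.size, Tree.size_ofNat] at h₃'
      have p₄ := idConj_length hS hT (m := M) (by omega) (by omega)
      have p₅ : 2 * S.size * ((2 * M + 2) * meetLength M) ≤
        2 * M * ((2 * M + 2) * meetLength M) :=
        Nat.mul_le_mul_right _ (by have := S.size_le_code; omega)
      have p₆ : 2 * S.size * (48 * (N * N * N)) ≤ 2 * N * (48 * (N * N * N)) :=
        Nat.mul_le_mul_right _ (by omega)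
      have p₇ : (idConj T S).length ≤ stepLength M := by unfold stepLength; omega
      have q₁ := refl_runs (.or S T) (M := M) (by rw [Fm.code_size_or]; omega)
      have q₂ := idConj_runs' hS hT p₇
      have q₃ := natsCode_refl_size (.or S T) (M := M) (by rw [Fm.code_size_or]; omega)
      refine ⟨.cons (Rule.eq []).code (.cons (Rule.eq (expand [0] [.or S T])).code
        (idConj T S).code), .intro (f := locBody) rfl ?_,
        .inr ⟨_, eq_mem_KS _, _, eq_mem_KS _, _, rfl, p₁.1, .eq ?_, .eq ?_, ?_, ?_, p₇, ?_⟩⟩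
      · simp only [locBody, wp, hd, tl, v, sw, Tree.ofList, Tree.head_nil, Tree.head_cons,
          Tree.tail_nil, Tree.tail_cons, Tree.sel_nil, Tree.sel_cons,
          Tree.size, ofNat_zero, ofNat_one, ofNat_two, ofNat_three, ofNat_four, ofNat_eight, tag,
          tag₂, num, letIn, Rule.code, Fm.enc, hv, hA, hB, List.map_nil, hx, hz, app, list] at h₃ ⊢
        refine q₁.use (by simp only [Fm.code, ofNat_four]; rfl) fun t ht => ?_
        refine q₂.use rfl fun u hu => ⟨rfl, ?_⟩
        simp only [locCost, Tree.size, Der.length, natsCode] at q₃ p₇ ⊢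
        linarith only [h₁, h₂, h₃', hM, ht, hu, q₃, p₇, hx', hz', Nat.zero_le (M * (200 * M)),
          Nat.zero_le (traceCost M), Nat.zero_le (expandCost (50 * M))]
      · rw [p₁.2]; exact .nil (.refl _) rfl
      · rw [p₂, hA, hB]; exact eqTrace_refl _
      · simp only [Rule.code, Tree.size, Tree.size_ofNat, Tree.ofList, List.map_nil, stepLength]
        omega
      · exact ((eqTrace_refl (.or S T)).code_size (m := M) (by
          have h₁ := S.size_le_code; have h₂ := T.size_le_code
          rw [Fm.size_or]; omega)).trans (by unfold stepLength; omega)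
      · unfold stepSize
        have : 2 * N * (48 * (N * N * N)) = 96 * (N * (N * N * N)) := by ring
        omega

theorem le_locCost (M : ℕ) : 510000 * M ≤ locCost M ∧ 1000000 ≤ locCost M := by
  have := le_stepLength M
  unfold locCost; constructor <;> omega

/-- Weakening exists only for atoms, so ⊤ is obtained from ⊥ by a switch: ⊥ = ⊥ ∧ (⊤ ∨ ⊤) → (⊥ ∧ ⊤)
∨ ⊤ = ⊤. This happens where a weakened atom does not lead to the conclusion. -/
theorem fills_bot_top (q M : ℕ) : Fills .bot .top q (stepLength M)
    (.cons (Rule.eq []).code (.cons (Rule.eq []).code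
      (Der.step .swi (.fm (.and .bot (.or .top .top)))
        (.fm (.or (.and .bot .top) .top))).code)) := by
  refine .inr ⟨_, eq_mem_KS _, _, eq_mem_KS _, _, rfl, ⟨trivial, trivial, swi_mem_KS, .swi _ _ _⟩,
    .eq (.nil ?_ rfl), .eq (.nil ?_ rfl), ?_, ?_, ?_, by simp [Der.size]⟩
  · exact (Fm.Eqv.symm (.and_top _)).trans (.and_ctx _ (.symm .top_or_top))
  · exact (Fm.Eqv.or_comm _ _).trans ((Fm.Eqv.or_ctx _ (.and_top _)).trans (.or_bot _))
  all_goals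
    simp only [Rule.code, Tree.size, Tree.size_ofNat, Tree.ofList, List.map_nil, stepLength,
      Der.length, Der.code, Fm.code]
    omega

theorem loc_runs_awd {𝔡 : Deco} {N : ℕ} {e : ℕ} (hs : 𝔡.dead e = true) {M : ℕ}
    {xA xX : Tree} (h₁ : xA.size ≤ M) (h₂ : xX.size ≤ M) (h₃ : ((Fm.atom e).enc 𝔡.vc).size ≤ M) :
    ∃ y, Runs prog 21 [Rule.awd.code, xA, xX, (Fm.atom e).enc 𝔡.vc]
      (.cons ((Fm.bot : Fm ℕ).enc 𝔡.vc) y) (locCost M) ∧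
      Fills .bot (𝔡.val e) (stepSize N) (stepLength M) y := by
  have hv : ∀ e, 𝔡.vc e = (𝔡.val e).code := fun _ => rfl
  have hM := le_stepLength M
  obtain ⟨hc₁, hc₂⟩ := le_locCost M
  cases he : 𝔡.tree e with
  | none =>
    have hA := Deco.val_none he
    rw [hA]
    refine ⟨_, .intro (f := locBody) rfl ?_, fills_bot_top _ M⟩
    simp only [locBody, wp, hd, tl, v, sw, Tree.ofList, Tree.head_nil, Tree.head_cons,
      Tree.tail_nil, Tree.tail_cons, Tree.sel_nil, Tree.sel_cons, step, Der.code,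
      Tree.size, ofNat_zero, ofNat_one, ofNat_two, ofNat_three, ofNat_four, ofNat_eight, ofNat_six,
      tag, tag₂, num, letIn, Rule.code, Fm.enc, Fm.code, hv, hA, List.map_nil, true_and] at h₃ ⊢
    linarith only [h₁, h₂, h₃, hc₁, hc₂]
  | some T =>
    have hA := Deco.val_dead he hs
    rw [hA]
    refine ⟨_, .intro (f := locBody) rfl ?_, .eq (σ := []) (.nil (.refl _) rfl) (Nat.zero_le M)⟩
    simp only [locBody, wp, hd, tl, v, sw, Tree.ofList, Tree.head_nil, Tree.head_cons,
      Tree.tail_nil, Tree.tail_cons, Tree.sel_nil, Tree.sel_cons, step, Der.code,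
      Tree.size, ofNat_zero, ofNat_one, ofNat_two, ofNat_three, ofNat_four, ofNat_eight,
      tag, tag₂, num, letIn, Rule.code, Fm.enc, Fm.code, hv, hA, List.map_nil, true_and] at h₃ ⊢
    linarith only [h₁, h₂, h₃, hc₁, hc₂]

theorem loc_runs_awu {𝔡 : Deco} {N : ℕ} {e : ℕ} (hs : 𝔡.tree e = none) {M : ℕ}
    {xA xX : Tree} (h₁ : xA.size ≤ M) (h₂ : xX.size ≤ M) :
    ∃ y, Runs prog 21 [Rule.awu.code, xA, xX, (Fm.top : Fm ℕ).enc 𝔡.vc]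
      (.cons ((Fm.atom e).enc 𝔡.vc) y) (locCost M) ∧
      Fills (𝔡.val e) .top (stepSize N) (stepLength M) y := by
  have hv : ∀ e, 𝔡.vc e = (𝔡.val e).code := fun _ => rfl
  have hM := le_stepLength M
  obtain ⟨hc₁, hc₂⟩ := le_locCost M
  have hA := Deco.val_none hs
  rw [hA]
  refine ⟨_, .intro (f := locBody) rfl ?_, .eq (σ := []) (.nil (.refl _) rfl) (Nat.zero_le M)⟩
  simp only [locBody, wp, hd, tl, v, sw, Tree.ofList, Tree.head_nil, Tree.head_cons,
    Tree.tail_nil, Tree.tail_cons, Tree.sel_nil, Tree.sel_cons, step, Der.code,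
    Tree.size, ofNat_zero, ofNat_one, ofNat_two, ofNat_three, ofNat_four, ofNat_eight,
    tag, tag₂, num, letIn, Rule.code, Fm.enc, Fm.code, hv, hA, List.map_nil, true_and]
  linarith only [h₁, h₂, hc₁, hc₂]

theorem Deco.dc_eq {𝔡 : Deco} {e : ℕ} {b : Bool} (h : 𝔡.dead e = b) : 𝔡.dc e = Tree.ofBool b := by
  rw [Deco.dc, h]

theorem Deco.val_congr {𝔡 : Deco} {e f : ℕ} (h : 𝔡.tree e = 𝔡.tree f) (h' : 𝔡.dead e = 𝔡.dead f) :
    𝔡.val e = 𝔡.val f := by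
  rw [Deco.val, Deco.val, h, h']

theorem Deco.val_cases (𝔡 : Deco) (e : ℕ) :
    𝔡.val e = .top ∨ ∃ x, (𝔡.val e).code.head = .cons .nil x ∧ x.size ≤ (𝔡.val e).code.size := by
  cases 𝔡.val e <;> simp [Fm.code, Tree.head, ofNat_one, ofNat_two, ofNat_three, ofNat_four,
    Tree.size] <;> omega

/-- The three edges have the same tree, and the lower one is dead only if both upper ones are. So a
dead upper edge contributes ⊥, and the other has the value of the lower edge; if neither is dead,
the tree is contracted by `contr`. -/
theorem loc_runs_acd {𝔡 : Deco} {N : ℕ} (hOK : 𝔡.OK N) {l r e : ℕ} (hs : 𝔡.Sat (.acd l r e)) {M : ℕ}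
    {xA : Tree} (h₁ : xA.size ≤ M)
    (h₂ : ((Fm.or (.atom l) (.atom r)).enc 𝔡.dc).size ≤ M)
    (h₃ : ((Fm.atom e).enc 𝔡.vc).size ≤ M)
    (h₄ : ((Fm.or (.atom l) (.atom r)).enc 𝔡.vc).size ≤ M) :
    ∃ y, Runs prog 21 [Rule.acd.code, xA, (Fm.or (.atom l) (.atom r)).enc 𝔡.dc,
        (Fm.atom e).enc 𝔡.vc]
      (.cons ((Fm.or (.atom l) (.atom r)).enc 𝔡.vc) y) (locCost M) ∧
      Fills (.or (𝔡.val l) (𝔡.val r)) (𝔡.val e) (stepSize N) (stepLength M) y := by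
  obtain ⟨⟨hlab, hlab'⟩, ⟨hl, hr⟩, hde⟩ := hs
  have hv : ∀ e, 𝔡.vc e = (𝔡.val e).code := fun _ => rfl
  have hM := le_stepLength M
  obtain ⟨hc₁, hc₂⟩ := le_locCost M
  have hle : (𝔡.val e).code.size ≤ M := by
    simp only [Fm.enc, Tree.size, hv] at h₃; omega
  have hsz : (Fm.or (𝔡.val l) (𝔡.val r)).size ≤ M := by
    have e₁ := (𝔡.val l).size_le_code
    have e₂ := (𝔡.val r).size_le_code
    simp only [Fm.enc, Tree.size, hv] at h₄
    rw [Fm.size_or]; omega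
  have q₁ := refl_runs _ hle
  have q₃ := natsCode_refl_size _ hle
  by_cases ht : 𝔡.tree e = none
  · have hA := Deco.val_none ht
    have hB := Deco.val_none (hl.trans ht)
    have hC := Deco.val_none (hr.trans ht)
    rw [hA, hB, hC]
    refine ⟨_, .intro (f := locBody) rfl ?_, .eq (σ := []) (.nil .top_or_top rfl) (Nat.zero_le M)⟩
    simp only [locBody, wp, hd, tl, v, sw, Tree.ofList, Tree.head_nil, Tree.head_cons,
      Tree.tail_nil, Tree.tail_cons, Tree.sel_nil, Tree.sel_cons, step, Der.code,
      Tree.size, ofNat_zero, ofNat_one, ofNat_two, ofNat_three, ofNat_four, ofNat_eight,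
      tag, tag₂, num, letIn, Rule.code, Fm.enc, Fm.code, hv, hA, hB, hC, List.map_nil, true_and]
      at h₂ h₃ ⊢
    linarith only [h₁, h₂, h₃, hc₁, hc₂]
  obtain ⟨T, hT⟩ := Option.ne_none_iff_exists'.1 ht
  obtain ⟨x, hx, hx'⟩ : ∃ x, (𝔡.val e).code.head = .cons .nil x ∧ x.size ≤ (𝔡.val e).code.size := by
    rcases 𝔡.val_cases e with h | h
    · cases hd' : 𝔡.dead e
      · have := hOK.isConj _ _ hT
        rw [← Deco.val_live hT hd', h] at this
        cases this
      · rw [Deco.val_dead hT hd'] at h; cases h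
    · exact h
  cases hdl : 𝔡.dead l
  · cases hdr : 𝔡.dead r
    · have hd' : 𝔡.dead e = false := by simp [hde, hdl]
      have hA := Deco.val_live hT hd'
      have hB := Deco.val_live (hl.trans hT) hdl
      have hC := Deco.val_live (hr.trans hT) hdr
      have el := Deco.dc_eq hdl
      have er := Deco.dc_eq hdr
      have hc := hOK.isConj _ _ hT
      have sT := hOK.size_le _ _ hd' hT
      rw [hA] at hle q₁ q₃ hx hx'
      have ht' := T.size_le_code
      have h₄' := h₄
      simp only [Fm.enc, hv, hB, hC, Tree.size, Tree.size_ofNat] at h₄'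
      have q₅ : (Fm.or T T).code.size ≤ M := by rw [Fm.code_size_or]; omega
      have q₂ := refl_runs _ q₅
      have q₄ := natsCode_refl_size _ q₅
      have p₁ := contr_length hc hle
      have p₂ : 2 * T.size * (3 * M + 60) ≤ 2 * M * (3 * M + 60) :=
        Nat.mul_le_mul_right _ (by omega)
      have p₃ : (contr T).length ≤ stepLength M := by unfold stepLength; omega
      have p₄ := contr_runs' hc p₃
      rw [hA, hB, hC]
      refine ⟨.cons (Rule.eq (expand [0] [.or T T])).code (.cons (Rule.eq (expand [0] [T])).code
        (contr T).code), .intro (f := locBody) rfl ?_,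
        .inr ⟨_, eq_mem_KS _, _, eq_mem_KS _, _, rfl, contr_isDerivation hc, .eq ?_, .eq ?_, ?_, ?_,
          p₃, ?_⟩⟩
      · simp only [locBody, wp, hd, tl, v, sw, Tree.ofList, Tree.head_nil, Tree.head_cons,
          Tree.tail_nil, Tree.tail_cons, Tree.sel_nil, Tree.sel_cons, Tree.ofBool,
          Tree.size, ofNat_zero, ofNat_one, ofNat_two, ofNat_three, ofNat_four, ofNat_eight, tag,
          tag₂, num, letIn, Rule.code, Fm.enc, hv, hA, hB, hC, el, er, List.map_nil, hx, app, list]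
          at h₂ h₃ ⊢
        refine q₂.use (by simp only [Fm.code, ofNat_four]; rfl) fun t ht => ?_
        refine q₁.use rfl fun u hu => ?_
        refine p₄.use rfl fun w hw => ⟨rfl, ?_⟩
        simp only [locCost, Tree.size, Der.length, natsCode] at q₃ q₄ p₃ ⊢
        linarith only [h₁, h₂, h₄', hM, ht, hu, hw, q₃, q₄, p₃, hx', Nat.zero_le (M * (200 * M)),
          Nat.zero_le (traceCost M), Nat.zero_le (expandCost (50 * M))]
      · rw [contr_pr hc]; exact eqTrace_refl _
      · rw [contr_cn hc]; exact eqTrace_refl _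
      · exact ((eqTrace_refl (.or T T)).code_size (m := M) (by
          rw [Fm.size_or]; omega)).trans (by unfold stepLength; omega)
      · exact ((eqTrace_refl T).code_size (m := M) (by omega)).trans (by unfold stepLength; omega)
      · have := contr_size hc
        have p₅ : 3 * T.size * T.size ≤ 3 * N * N := Nat.mul_le_mul (by omega) sT
        unfold stepSize; omega
    · have hA : 𝔡.val l = 𝔡.val e := Deco.val_congr hl (by simp [hde, hdl])
      have hB := Deco.val_dead (hr.trans hT) hdr
      have el := Deco.dc_eq hdl
      have er := Deco.dc_eq hdr
      refine ⟨_, .intro (f := locBody) rfl ?_, .eq (σ := expand [0] [𝔡.val e]) ?_ hsz⟩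
      · simp only [locBody, wp, hd, tl, v, sw, Tree.ofList, Tree.head_nil, Tree.head_cons,
          Tree.tail_nil, Tree.tail_cons, Tree.sel_nil, Tree.sel_cons, Tree.ofBool,
          Tree.size, ofNat_zero, ofNat_one, ofNat_two, ofNat_three, ofNat_four, ofNat_eight, tag,
          tag₂, num, letIn, Rule.code, Fm.enc, hv, hA, hB, el, er, List.map_nil, hx, app, list,
          Fm.code] at h₂ h₃ ⊢
        refine q₁.use rfl fun u hu => ⟨rfl, ?_⟩
        simp only [locCost, Tree.size, natsCode] at q₃ ⊢
        linarith only [h₁, h₂, h₃, hM, hu, q₃, hx', Nat.zero_le (M * (200 * M)),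
          Nat.zero_le (traceCost M), Nat.zero_le (expandCost (50 * M)), Nat.zero_le (builderCost M)]
      · rw [hA, hB]; exact eqTrace_or_bot _
  · have hA : 𝔡.val r = 𝔡.val e := Deco.val_congr hr (by simp [hde, hdl])
    have hB := Deco.val_dead (hl.trans hT) hdl
    have el := Deco.dc_eq hdl
    refine ⟨_, .intro (f := locBody) rfl ?_, .eq (σ := expand [0] [𝔡.val e]) ?_ hsz⟩
    · simp only [locBody, wp, hd, tl, v, sw, Tree.ofList, Tree.head_nil, Tree.head_cons,
        Tree.tail_nil, Tree.tail_cons, Tree.sel_nil, Tree.sel_cons, Tree.ofBool,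
        Tree.size, ofNat_zero, ofNat_one, ofNat_two, ofNat_three, ofNat_four, ofNat_eight, tag,
        tag₂, num, letIn, Rule.code, Fm.enc, hv, hA, hB, el, List.map_nil, hx, app, list,
        Fm.code] at h₂ h₃ ⊢
      refine q₁.use rfl fun u hu => ⟨rfl, ?_⟩
      simp only [locCost, Tree.size, natsCode] at q₃ ⊢
      linarith only [h₁, h₂, h₃, hM, hu, q₃, hx', Nat.zero_le (M * (200 * M)),
        Nat.zero_le (traceCost M), Nat.zero_le (expandCost (50 * M)), Nat.zero_le (builderCost M)]
    · rw [hA, hB]; exact eqTrace_bot_or _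

/-- The tree above is the conjunction of those below by construction, so the cocontraction becomes
an equation; a missing tree gives ⊤ as a unit, and ⊥ = ⊥ ∧ ⊥ covers the dead case. -/
theorem loc_runs_acu {𝔡 : Deco} {N : ℕ} (hOK : 𝔡.OK N) {e l r : ℕ} (hs : 𝔡.Sat (.acu e l r)) {M : ℕ}
    {xA xX : Tree} (h₁ : xA.size ≤ M) (h₂ : xX.size ≤ M)
    (h₃ : ((Fm.and (.atom l) (.atom r)).enc 𝔡.vc).size ≤ M)
    (h₄ : ((Fm.atom e).enc 𝔡.vc).size ≤ M) :
    ∃ y, Runs prog 21 [Rule.acu.code, xA, xX, (Fm.and (.atom l) (.atom r)).enc 𝔡.vc]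
      (.cons ((Fm.atom e).enc 𝔡.vc) y) (locCost M) ∧
      Fills (𝔡.val e) (.and (𝔡.val l) (𝔡.val r)) (stepSize N) (stepLength M) y := by
  obtain ⟨⟨hlab, hlab'⟩, ht, hdl, hdr⟩ := hs
  have hv : ∀ e, 𝔡.vc e = (𝔡.val e).code := fun _ => rfl
  have hM := le_stepLength M
  have hle : (𝔡.val e).code.size ≤ M := by
    simp only [Fm.enc, Tree.size, hv] at h₄; omega
  have hsz := (𝔡.val e).size_le_code.trans hle
  have q₁ := refl_runs _ hle
  have q₃ := natsCode_refl_size _ hle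
  by_cases hl : 𝔡.tree l = none
  · have hA := Deco.val_none hl
    have hB : 𝔡.val e = 𝔡.val r := Deco.val_congr (by rw [ht, hl]; rfl) hdr.symm
    rw [hB] at hle hsz q₁ q₃ ⊢
    refine ⟨_, .intro (f := locBody) rfl ?_, .eq (σ := expand [0] [𝔡.val r]) ?_ hsz⟩
    · simp only [locBody, wp, hd, tl, v, sw, Tree.ofList, Tree.head_nil, Tree.head_cons,
        Tree.tail_nil, Tree.tail_cons, Tree.sel_nil, Tree.sel_cons,
        Tree.size, ofNat_zero, ofNat_one, ofNat_two, ofNat_three, ofNat_four, ofNat_five,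
        ofNat_eight, tag, tag₂, num, letIn, Rule.code, Fm.enc, Fm.code, hv, hA, hB, List.map_nil,
        app, list] at h₃ ⊢
      refine q₁.use rfl fun u hu => ⟨rfl, ?_⟩
      simp only [locCost, Tree.size, natsCode] at q₃ ⊢
      linarith only [h₁, h₂, h₃, hM, hu, q₃, Nat.zero_le (M * (200 * M)),
        Nat.zero_le (traceCost M), Nat.zero_le (expandCost (50 * M)), Nat.zero_le (builderCost M)]
    · rw [hA]; exact eqTrace_top_and _
  by_cases hr : 𝔡.tree r = none
  · have hA := Deco.val_none hr
    have hB : 𝔡.val e = 𝔡.val l := Deco.val_congr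
      (by rw [ht, hr]; cases 𝔡.tree l <;> rfl) hdl.symm
    obtain ⟨T, hT⟩ := Option.ne_none_iff_exists'.1 hl
    obtain ⟨x, hx, hx'⟩ : ∃ x, (𝔡.val l).code.head = .cons .nil x ∧
        x.size ≤ (𝔡.val l).code.size := by
      rcases 𝔡.val_cases l with h | h
      · cases hd' : 𝔡.dead l
        · have := hOK.isConj _ _ hT
          rw [← Deco.val_live hT hd', h] at this
          cases this
        · rw [Deco.val_dead hT hd'] at h; cases h
      · exact h
    rw [hB] at hle hsz q₁ q₃ ⊢
    refine ⟨_, .intro (f := locBody) rfl ?_, .eq (σ := expand [0] [𝔡.val l]) ?_ hsz⟩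
    · simp only [locBody, wp, hd, tl, v, sw, Tree.ofList, Tree.head_nil, Tree.head_cons,
        Tree.tail_nil, Tree.tail_cons, Tree.sel_nil, Tree.sel_cons,
        Tree.size, ofNat_zero, ofNat_one, ofNat_two, ofNat_three, ofNat_four, ofNat_five,
        ofNat_eight, tag, tag₂, num, letIn, Rule.code, Fm.enc, Fm.code, hv, hA, hB, List.map_nil,
        hx, app, list] at h₃ ⊢
      refine q₁.use rfl fun u hu => ⟨rfl, ?_⟩
      simp only [locCost, Tree.size, natsCode] at q₃ ⊢
      linarith only [h₁, h₂, h₃, hM, hu, q₃, hx', Nat.zero_le (M * (200 * M)),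
        Nat.zero_le (traceCost M), Nat.zero_le (expandCost (50 * M)), Nat.zero_le (builderCost M)]
    · rw [hA]; exact eqTrace_and_top _
  obtain ⟨S, hS⟩ := Option.ne_none_iff_exists'.1 hl
  obtain ⟨T, hT⟩ := Option.ne_none_iff_exists'.1 hr
  have he : 𝔡.tree e = some (.and S T) := by rw [ht, hS, hT]; rfl
  cases hde : 𝔡.dead e
  · have hA := Deco.val_live hS (hdl.trans hde)
    have hB := Deco.val_live hT (hdr.trans hde)
    have hC := Deco.val_live he hde
    obtain ⟨x, hx, hx'⟩ := (hOK.isConj _ _ hS).head_code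
    obtain ⟨z, hz, hz'⟩ := (hOK.isConj _ _ hT).head_code
    rw [hC] at hle hsz q₁ q₃ ⊢
    refine ⟨_, .intro (f := locBody) rfl ?_, .eq (σ := expand [0] [.and S T]) ?_ hsz⟩
    · simp only [locBody, wp, hd, tl, v, sw, Tree.ofList, Tree.head_nil, Tree.head_cons,
        Tree.tail_nil, Tree.tail_cons, Tree.sel_nil, Tree.sel_cons,
        Tree.size, ofNat_zero, ofNat_one, ofNat_two, ofNat_three, ofNat_four, ofNat_five,
        ofNat_eight, tag, tag₂, num, letIn, Rule.code, Fm.enc, hv, hA, hB, hC, List.map_nil,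
        hx, hz, app, list] at h₃ ⊢
      refine q₁.use (by simp only [Fm.code, ofNat_three]; rfl) fun u hu =>
        ⟨by simp only [Fm.code, ofNat_three, natsCode], ?_⟩
      simp only [locCost, Tree.size, natsCode] at q₃ ⊢
      linarith only [h₁, h₂, h₃, hM, hu, q₃, hx', hz', Nat.zero_le (M * (200 * M)),
        Nat.zero_le (traceCost M), Nat.zero_le (expandCost (50 * M)), Nat.zero_le (builderCost M)]
    · rw [hA, hB]; exact eqTrace_refl _
  · have hA := Deco.val_dead hS (hdl.trans hde)
    have hB := Deco.val_dead hT (hdr.trans hde)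
    have hC := Deco.val_dead he hde
    rw [hC] at hle hsz q₁ q₃ ⊢
    refine ⟨_, .intro (f := locBody) rfl ?_, .eq (σ := expand [0] [.bot]) ?_ hsz⟩
    · simp only [locBody, wp, hd, tl, v, sw, Tree.ofList, Tree.head_nil, Tree.head_cons,
        Tree.tail_nil, Tree.tail_cons, Tree.sel_nil, Tree.sel_cons,
        Tree.size, ofNat_zero, ofNat_one, ofNat_two, ofNat_three, ofNat_four, ofNat_five,
        ofNat_eight, tag, tag₂, num, letIn, Rule.code, Fm.enc, Fm.code, hv, hA, hB, hC,
        List.map_nil, app, list] at h₃ ⊢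
      refine q₁.use rfl fun u hu => ⟨rfl, ?_⟩
      simp only [locCost, Tree.size, natsCode] at q₃ ⊢
      linarith only [h₁, h₂, h₃, hM, hu, q₃, Nat.zero_le (M * (200 * M)),
        Nat.zero_le (traceCost M), Nat.zero_le (expandCost (50 * M)), Nat.zero_le (builderCost M)]
    · rw [hA, hB]; exact .nil (.symm .bot_and_bot) rfl

theorem Fills.rule {A B : Fm Lit} {ρ : Rule} (hρ : ρ ∈ KS) (h : Inst ρ A B) {q L : ℕ}
    (hM : ρ.code.size ≤ L) : Fills A B q L (.cons ρ.code .nil) :=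
  .inl ⟨ρ, hρ, rfl, h, hM⟩

/-- Switch and medial are schematic in formulae, so the rule itself fills the step after the
substitution. -/
theorem loc_runs_same {𝔡 : Deco} {ρ : Rule} {X Y : Fm ℕ} (h : 𝔡.Local ρ X Y)
    (hρ : ρ = .swi ∨ ρ = .med) {M : ℕ} {xX : Tree} (h₂ : xX.size ≤ M)
    (h₀ : ρ.code.size ≤ M) (h₁ : (X.map 𝔡.lab).code.size ≤ M) (h₃ : (Y.enc 𝔡.vc).size ≤ M)
    (h₄ : (X.enc 𝔡.vc).size ≤ M) :
    Runs prog 21 [ρ.code, (X.map 𝔡.lab).code, xX, Y.enc 𝔡.vc]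
      (.cons (X.enc 𝔡.vc) (.cons ρ.code .nil)) (locCost M) := by
  have h₅ := up_runs h 𝔡.vc (by tauto) h₀ h₁ h₃ h₄
  have hM := le_stepLength M
  refine .intro (f := locBody) rfl ?_
  rcases hρ with rfl | rfl <;>
  · simp only [locBody, wp, hd, tl, v, sw, Tree.ofList, Tree.head_nil, Tree.head_cons,
      Tree.tail_nil, Tree.tail_cons, Tree.sel_nil, Tree.sel_cons,
      Tree.size, ofNat_zero, ofNat_one, ofNat_two, ofNat_three, ofNat_four, ofNat_six, ofNat_seven,
      tag, tag₂, num, letIn, Rule.code, app, list] at h₀ h₅ ⊢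
    refine h₅.use rfl fun u hu => ⟨rfl, ?_⟩
    simp only [locCost]
    linarith only [h₁, h₂, h₃, h₄, hM, hu, Nat.zero_le (M * (200 * M)),
      Nat.zero_le (traceCost M), Nat.zero_le (expandCost (50 * M)), Nat.zero_le (builderCost M)]

theorem loc_runs_eq {𝔡 : Deco} {σ : List ℕ} {X Y : Fm ℕ} (h : EqSkel σ X Y) (ε : ℕ → ℕ) {M : ℕ}
    {xX : Tree} (h₂ : xX.size ≤ M)
    (h₀ : (Rule.eq σ).code.size ≤ M) (h₁ : ((X.map ε).map 𝔡.lab).code.size ≤ M)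
    (h₃ : ((Y.map ε).enc 𝔡.vc).size ≤ M) (h₄ : ((X.map ε).enc 𝔡.vc).size ≤ M) :
    Runs prog 21 [(Rule.eq σ).code, ((X.map ε).map 𝔡.lab).code, xX, (Y.map ε).enc 𝔡.vc]
      (.cons ((X.map ε).enc 𝔡.vc)
        (.cons (Rule.eq (expand σ ((List.range X.size).map (𝔡.val ∘ ε)))).code .nil))
      (locCost M) := by
  have h₅ := up_runs_eq h ε 𝔡.lab 𝔡.vc h₀ h₁ h₃ h₄
  have hM := le_stepLength M
  have e₁ := size_ofList_atoms 𝔡.vc (X.map ε)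
  have e₂ : (X.map ε).atoms.map 𝔡.vc = ((List.range X.size).map (𝔡.val ∘ ε)).map Fm.code := by
    rw [Fm.atoms_map, h.pr, List.map_map, List.map_map]; rfl
  have e₃ := (sum_size_le ((List.range X.size).map (𝔡.val ∘ ε)))
  rw [← e₂] at e₃
  have h₆ := expand_runs σ ((List.range X.size).map (𝔡.val ∘ ε)) (M := 50 * M)
    (by rw [← e₂]; omega) (by simpa using h.perm)
  have h₇ := expand_size (M := M) (xs := (List.range X.size).map (𝔡.val ∘ ε))
    (by rw [← e₂]; omega) (σ := σ) (by simpa using h.perm)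
  have h₈ : M * (2 * M + 2) + 1 ≤ stepLength M := by unfold stepLength; omega
  have hf := flat_runs 𝔡.vc (X.map ε) [] h₄ (by rw [List.append_nil]; omega)
  have hf' : ((X.map ε).enc 𝔡.vc).size * (100 * M) ≤ M * (100 * M) := Nat.mul_le_mul_right _ h₄
  have hf'' : M * (200 * M) = 2 * (M * (100 * M)) := by ring
  refine .intro (f := locBody) rfl ?_
  simp only [locBody, wp, hd, tl, v, sw, Tree.ofList, Tree.head_nil, Tree.head_cons,
    Tree.tail_nil, Tree.tail_cons, Tree.sel_nil, Tree.sel_cons,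
    Tree.size, ofNat_zero, ofNat_one, ofNat_two, ofNat_three, ofNat_four, ofNat_eight,
    tag, tag₂, num, letIn, Rule.code, app, list] at h₀ h₅ ⊢
  refine h₅.use rfl fun u hu => ?_
  refine hf.use rfl fun t ht => ?_
  rw [List.append_nil, e₂]
  refine h₆.use rfl fun w hw => ⟨rfl, ?_⟩
  rw [e₂] at e₁
  simp only [locCost, Tree.size, natsCode] at h₇ ⊢
  linarith only [h₀, h₁, h₂, h₃, h₄, h₇, h₈, hM, hu, ht, hw, hf', hf'', e₁,
    Nat.zero_le (M * (100 * M)), Nat.zero_le (expandCost (50 * M)), Nat.zero_le (builderCost M)]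

theorem Fills.mono {A B : Fm Lit} {q q' L : ℕ} {r : Tree} (h : Fills A B q L r) (hq : q ≤ q') :
    Fills A B q' L r := by
  rcases h with h | ⟨ρ₁, k₁, ρ₂, k₂, χ, h₁, h₂, h₃, h₄, h₅, h₆, h₇, h₈⟩
  · exact .inl h
  · exact .inr ⟨ρ₁, k₁, ρ₂, k₂, χ, h₁, h₂, h₃, h₄, h₅, h₆, h₇, h₈.trans hq⟩

/-- The size budget is proportional to the atoms of the step, which is what `g_runs` can pay.
Structural steps have at least one atom, and the other rules insert no derivation. -/
theorem loc_runs {𝔡 : Deco} {N : ℕ} (hOK : 𝔡.OK N) {ρ : Rule} {X Y : Fm ℕ} (h : 𝔡.Local ρ X Y)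
    {M : ℕ} (h₀ : ρ.code.size ≤ M) (h₁ : (X.map 𝔡.lab).code.size ≤ M)
    (h₂ : (X.enc 𝔡.dc).size ≤ M) (h₃ : (Y.enc 𝔡.vc).size ≤ M) (h₄ : (X.enc 𝔡.vc).size ≤ M) :
    ∃ y, Runs prog 21 [ρ.code, (X.map 𝔡.lab).code, X.enc 𝔡.dc, Y.enc 𝔡.vc]
      (.cons (X.enc 𝔡.vc) y) (locCost M) ∧
      Fills (X.bind 𝔡.val) (Y.bind 𝔡.val) (stepSize N * (X.size + Y.size)) (stepLength M) y := by
  have hM := le_stepLength M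
  cases h with
  | aid hs =>
    obtain ⟨y, i, f⟩ := loc_runs_aid hOK hs h₁ h₂ h₃
    exact ⟨y, i, f.mono (Nat.le_mul_of_pos_right _ (by simp))⟩
  | awd hs =>
    obtain ⟨y, i, f⟩ := loc_runs_awd (N := N) hs h₁ h₂ h₃
    exact ⟨y, i, f.mono (Nat.le_mul_of_pos_right _ (by simp))⟩
  | awu hs =>
    obtain ⟨y, i, f⟩ := loc_runs_awu (N := N) hs h₁ h₂
    exact ⟨y, i, f.mono (Nat.le_mul_of_pos_right _ (by simp))⟩
  | acd hs =>
    obtain ⟨y, i, f⟩ := loc_runs_acd hOK hs h₁ h₂ h₃ h₄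
    exact ⟨y, i, f.mono (Nat.le_mul_of_pos_right _ (by simp))⟩
  | acu hs =>
    obtain ⟨y, i, f⟩ := loc_runs_acu hOK hs h₁ h₂ h₃ h₄
    exact ⟨y, i, f.mono (Nat.le_mul_of_pos_right _ (by simp))⟩
  | swi A B C =>
    exact ⟨_, loc_runs_same (.swi A B C) (.inl rfl) h₂ h₀ h₁ h₃ h₄,
      .rule swi_mem_KS (.swi _ _ _) (by omega)⟩
  | med A B C D =>
    exact ⟨_, loc_runs_same (.med A B C D) (.inr rfl) h₂ h₀ h₁ h₃ h₄,
      .rule med_mem_KS (.med _ _ _ _) (by omega)⟩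
  | eq h ε =>
    refine ⟨_, loc_runs_eq h ε h₂ h₀ h₁ h₃ h₄, .eq ?_ ?_⟩
    · rw [Fm.bind_map, Fm.bind_map]; exact h.eqTrace _
    · exact (Fm.size_le_code _).trans ((join_runs 𝔡.val _ h₄).2.trans h₄)

/-! ### Derivations -/

theorem Traced.map_lab {𝔡 : Deco} {Φ : Der} {E E' : Fm ℕ} (h : Traced 𝔡 Φ E E') :
    E.map 𝔡.lab = Φ.pr ∧ E'.map 𝔡.lab = Φ.cn := by
  induction h with
  | fm => exact ⟨rfl, rfl⟩
  | and _ _ ih₁ ih₂ | or _ _ ih₁ ih₂ =>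
    simp only [Fm.map, Der.pr, Der.cn, ih₁, ih₂, and_self]
  | step _ _ _ ih₁ ih₂ => exact ⟨ih₁.1, ih₂.2⟩

theorem Fm.enc_size_le {α : Type} {c d : α → Tree} {k : ℕ} (hk : 1 ≤ k)
    (h : ∀ a, (c a).size ≤ k * (d a).size) (A : Fm α) : (A.enc c).size ≤ k * (A.enc d).size := by
  induction A with
  | top | bot => exact Nat.le_mul_of_pos_left _ hk
  | atom a =>
    have := h a
    simp only [Fm.enc, Tree.size, Tree.size_ofNat, Nat.mul_add]
    omega
  | and A B h₁ h₂ | or A B h₁ h₂ =>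
    simp only [Fm.enc, Tree.size, Tree.size_ofNat, Nat.mul_add]
    omega

theorem Fm.IsConj.code_size {a : Lit} {T : Fm Lit} (h : T.IsConj a) :
    T.code.size + 9 ≤ T.size * (a.code.size + 15) := by
  induction T with
  | atom b =>
    cases h
    simp only [Fm.code, Tree.size, Tree.size_ofNat, Fm.size_atom]
    omega
  | and X Y ihX ihY =>
    have := ihX h.1
    have := ihY h.2
    simp only [Fm.code_size_and, Fm.size_and, Nat.add_mul]
    omega
  | _ => cases h

theorem Lit.three_le_code_size (a : Lit) : 3 ≤ a.code.size := by
  have h₁ := (Tree.ofBool a.pos).one_le_size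
  have h₂ := (Tree.ofList (a.var.bits.map Tree.ofBool)).one_le_size
  simp only [Lit.code, Tree.size]
  omega

theorem Deco.OK.val_cases {𝔡 : Deco} {N : ℕ} (hOK : 𝔡.OK N) (e : ℕ) :
    𝔡.val e = .top ∨ 𝔡.val e = .bot ∨ (𝔡.val e).IsConj (𝔡.lab e) ∧ (𝔡.val e).size ≤ N := by
  cases h : 𝔡.tree e with
  | none => exact .inl (Deco.val_none h)
  | some T =>
    cases h' : 𝔡.dead e
    · rw [Deco.val_live h h']
      exact .inr (.inr ⟨hOK.isConj _ _ h, hOK.size_le _ _ h' h⟩)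
    · exact .inr (.inl (Deco.val_dead h h'))

theorem Deco.OK.val_size {𝔡 : Deco} {N : ℕ} (hOK : 𝔡.OK N) (e : ℕ) : (𝔡.val e).size ≤ N := by
  rcases hOK.val_cases e with h | h | h
  · simp [h]
  · simp [h]
  · exact h.2

/-- A value is a unit or a conjunction of at most `N` copies of the literal; the factor `16` absorbs
the tags. -/
theorem Deco.OK.vc_size {𝔡 : Deco} {N : ℕ} (hOK : 𝔡.OK N) (e : ℕ) :
    (𝔡.vc e).size ≤ 16 * (N + 1) * (𝔡.lab e).code.size := by
  have h₀ := (𝔡.lab e).three_le_code_size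
  have h₁ : (N + 1) * ((𝔡.lab e).code.size + 15) ≤ (N + 1) * (16 * (𝔡.lab e).code.size) :=
    Nat.mul_le_mul_left _ (by omega)
  have h₂ : 16 * (N + 1) * (𝔡.lab e).code.size = (N + 1) * (16 * (𝔡.lab e).code.size) := by ring
  have h₃ : (𝔡.lab e).code.size + 15 ≤ (N + 1) * ((𝔡.lab e).code.size + 15) :=
    Nat.le_mul_of_pos_left _ (by omega)
  rw [h₂]
  refine le_trans ?_ h₁
  unfold Deco.vc
  rcases hOK.val_cases e with h | h | ⟨h, h₄⟩
  · rw [h]; simp only [Fm.code, Tree.size, Tree.size_ofNat]; omega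
  · rw [h]; simp only [Fm.code, Tree.size, Tree.size_ofNat]; omega
  · have := h.code_size
    have h₅ := Nat.mul_le_mul_right ((𝔡.lab e).code.size + 15)
      (by omega : (𝔡.val e).size ≤ N + 1)
    omega

/-- This is where the overall bound `M` comes from: `48` is `16` from `Deco.OK.vc_size` times `3`
from the bounds for premisses and conclusions. -/
theorem enc_bounds {𝔡 : Deco} {N : ℕ} (hOK : 𝔡.OK N) {E : Fm ℕ} {n M : ℕ}
    (h : (E.map 𝔡.lab).code.size + 11 ≤ 3 * n) (hM : 48 * ((N + 1) * n) ≤ M) :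
    (E.map 𝔡.lab).code.size ≤ M ∧ (E.enc 𝔡.zc).size ≤ M ∧ (E.enc 𝔡.dc).size ≤ M ∧
      (E.enc 𝔡.vc).size ≤ M := by
  have e : (E.map 𝔡.lab).code = E.enc (Lit.code ∘ 𝔡.lab) := by rw [Fm.code_eq_enc, Fm.enc_map]
  have hz := Fm.enc_size_le (c := 𝔡.zc) (d := Lit.code ∘ 𝔡.lab) le_rfl (fun e => by
    have := (𝔡.lab e).code.one_le_size
    simp only [Deco.zc, Function.comp_apply, Nat.one_mul]
    split <;> simp only [Tree.size, le_refl, this]) E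
  have hd := Fm.enc_size_le (c := 𝔡.dc) (d := Lit.code ∘ 𝔡.lab) le_rfl (fun e => by
    have := (𝔡.lab e).three_le_code_size
    simp only [Deco.dc, Function.comp_apply, Nat.one_mul]
    cases 𝔡.dead e <;> simp only [Tree.ofBool, Tree.size] <;> omega) E
  have hv := Fm.enc_size_le (c := 𝔡.vc) (d := Lit.code ∘ 𝔡.lab) (k := 16 * (N + 1)) (by omega)
    hOK.vc_size E
  rw [← e] at hz hd hv
  have h₁ : 16 * (N + 1) * (E.map 𝔡.lab).code.size ≤ 16 * (N + 1) * (3 * n) :=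
    Nat.mul_le_mul_left _ (by omega)
  have h₂ : 16 * (N + 1) * (3 * n) = 48 * ((N + 1) * n) := by ring
  have h₃ : n ≤ (N + 1) * n := Nat.le_mul_of_pos_left _ (by omega)
  omega

/-- A bound for the running time of the computation of `Z`, by the length of the derivation. -/
def zCost (M : ℕ) : ℕ := traceCost M + M * (100 * M) + 1000 * M

theorem bound_mono {N m n M : ℕ} (hM : 48 * ((N + 1) * n) ≤ M) (h : m ≤ n) :
    48 * ((N + 1) * m) ≤ M :=
  (Nat.mul_le_mul_left _ (Nat.mul_le_mul_left _ h)).trans hM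

theorem length_le_bound {N n M : ℕ} (hM : 48 * ((N + 1) * n) ≤ M) : 48 * n ≤ M := by
  have : n ≤ (N + 1) * n := Nat.le_mul_of_pos_left _ (by omega)
  omega

theorem Traced.bounds {𝔡 : Deco} {N : ℕ} (hOK : 𝔡.OK N) {Φ : Der} {E E' : Fm ℕ}
    (h : Traced 𝔡 Φ E E') {M : ℕ} (hM : 48 * ((N + 1) * Φ.length) ≤ M) :
    (Φ.pr.code.size ≤ M ∧ (E.enc 𝔡.zc).size ≤ M ∧ (E.enc 𝔡.dc).size ≤ M ∧
      (E.enc 𝔡.vc).size ≤ M) ∧ Φ.cn.code.size ≤ M ∧ (E'.enc 𝔡.zc).size ≤ M ∧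
      (E'.enc 𝔡.dc).size ≤ M ∧ (E'.enc 𝔡.vc).size ≤ M := by
  have hp := enc_bounds hOK (E := E) (by rw [h.map_lab.1]; exact Φ.pr_length) hM
  have hc := enc_bounds hOK (E := E') (by rw [h.map_lab.2]; exact Φ.cn_length) hM
  rw [h.map_lab.1] at hp
  rw [h.map_lab.2] at hc
  exact ⟨hp, hc⟩

theorem cn_runs' {N M : ℕ} {Φ : Der} (hM : 48 * ((N + 1) * Φ.length) ≤ M) :
    Runs prog 1 [Φ.code] Φ.cn.code (M * (100 * M)) := by
  have := length_le_bound hM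
  exact (cn_runs Φ (by omega)).mono (Nat.mul_le_mul_right _ (by omega))

theorem z_runs {𝔡 : Deco} {N : ℕ} (hOK : 𝔡.OK N) {Φ : Der} {E E' : Fm ℕ} (h : Traced 𝔡 Φ E E')
    {M : ℕ} (hM : 48 * ((N + 1) * Φ.length) ≤ M) :
    Runs prog 22 [Φ.code, E'.enc 𝔡.zc] (E.enc 𝔡.zc) (Φ.length * zCost M) := by
  have hz : zCost M = traceCost M + M * (100 * M) + 1000 * M := rfl
  induction h with
  | fm E =>
    have hb := (Traced.fm E).bounds hOK hM
    have hn := length_le_bound hM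
    refine Runs.mono (c := zCost M) (.intro (f := zBody) rfl ?_)
      (Nat.le_mul_of_pos_left _ (Tree.one_le_size _))
    simp only [zBody, wp, hd, tl, v, sw, Tree.ofList, Tree.head_nil, Tree.head_cons,
      Tree.tail_nil, Tree.tail_cons, Tree.sel_nil, Tree.sel_cons, Tree.size, ofNat_zero,
      Der.length, Der.code, true_and] at hn ⊢
    omega
  | @and Φ Ψ E E' F F' h₁ h₂ ih₁ ih₂ | @or Φ Ψ E E' F F' h₁ h₂ ih₁ ih₂ =>
    have hb := Traced.bounds hOK (by constructor <;> assumption) hM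
    have hn := length_le_bound hM
    have i₁ := ih₁ (bound_mono hM (by
      first | (rw [Der.length_and]; omega) | (rw [Der.length_or]; omega)))
    have i₂ := ih₂ (bound_mono hM (by
      first | (rw [Der.length_and]; omega) | (rw [Der.length_or]; omega)))
    refine .mono (c := (Φ.length + Ψ.length + 1) * zCost M) (.intro (f := zBody) rfl ?_)
      (Nat.mul_le_mul_right _
        (by first | (rw [Der.length_and]; omega) | (rw [Der.length_or]; omega)))
    simp only [zBody, wp, hd, tl, v, sw, Tree.ofList, Tree.head_nil, Tree.head_cons,
      Tree.tail_nil, Tree.tail_cons, Tree.sel_nil, Tree.sel_cons, Tree.size, ofNat_zero,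
      ofNat_one, ofNat_two, ofNat_three, ofNat_four,
      Der.length, Der.code, Fm.enc, tag₂, num, app, list] at hn hb ⊢
    refine i₁.use rfl fun t ht => ?_
    refine i₂.use rfl fun u hu => ⟨rfl, ?_⟩
    simp only [Tree.size, Nat.add_mul, Nat.one_mul, Der.length] at ht hu ⊢
    omega
  | @step ρ Φ Ψ E X Y E' h₁ h h₂ ih₁ ih₂ =>
    have m₁ := bound_mono (m := Φ.length) hM (by rw [Der.length_step]; omega)
    have m₂ := bound_mono (m := Ψ.length) hM (by rw [Der.length_step]; omega)
    obtain ⟨-, b₁, b₂, -⟩ := h₁.bounds hOK m₁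
    obtain ⟨⟨-, b₃, -⟩, -, b₄, -⟩ := h₂.bounds hOK m₂
    obtain ⟨⟨-, b₅, -⟩, -⟩ := h₁.bounds hOK m₁
    have hn := length_le_bound hM
    have hρ : ρ.code.size ≤ M := by rw [Der.length_step] at hn; omega
    have iu := up_runs h 𝔡.zc (.inl rfl) hρ (by rw [h₁.map_lab.2]; exact b₁) b₃ b₂
    rw [h₁.map_lab.2] at iu
    refine .mono (c := (Φ.length + Ψ.length + 1) * zCost M) (.intro (f := zBody) rfl ?_)
      (Nat.mul_le_mul_right _ (by rw [Der.length_step]; omega))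
    simp only [zBody, wp, hd, tl, v, sw, Tree.ofList, Tree.head_nil, Tree.head_cons,
      Tree.tail_nil, Tree.tail_cons, Tree.sel_nil, Tree.sel_cons, Tree.size, ofNat_zero,
      ofNat_one, ofNat_two, ofNat_three, ofNat_four,
      Der.length, Der.code, num, app, list] at hn ⊢
    refine (cn_runs' m₁).use rfl fun t ht => ?_
    refine (ih₂ m₂).use rfl fun u hu => ?_
    refine iu.use rfl fun w hw => ?_
    refine (ih₁ m₁).use rfl fun z hz => ⟨rfl, ?_⟩
    simp only [Tree.size, Nat.add_mul, Nat.one_mul, Der.length] at *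
    linarith only [hn, hρ, b₁, b₂, b₃, b₄, b₅, ht, hu, hw, hz, ‹zCost M = _›]

/-- A bound for the running time of the computation of `D`, by the length of the derivation. -/
def dCost (M : ℕ) : ℕ := M * zCost M + 2 * traceCost M + M * (100 * M) + 5000 * M

theorem d_runs {𝔡 : Deco} {N : ℕ} (hOK : 𝔡.OK N) {Φ : Der} {E E' : Fm ℕ} (h : Traced 𝔡 Φ E E')
    {M : ℕ} (hM : 48 * ((N + 1) * Φ.length) ≤ M) :
    Runs prog 23 [Φ.code, E.enc 𝔡.dc, E'.enc 𝔡.zc] (E'.enc 𝔡.dc) (Φ.length * dCost M) := by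
  have hd' : dCost M = M * zCost M + 2 * traceCost M + M * (100 * M) + 5000 * M := rfl
  induction h with
  | fm E =>
    have hb := (Traced.fm E).bounds hOK hM
    have hn := length_le_bound hM
    refine Runs.mono (c := dCost M) (.intro (f := dBody) rfl ?_)
      (Nat.le_mul_of_pos_left _ (Tree.one_le_size _))
    simp only [dBody, wp, hd, tl, v, sw, Tree.ofList, Tree.head_nil, Tree.head_cons,
      Tree.tail_nil, Tree.tail_cons, Tree.sel_nil, Tree.sel_cons, Tree.size, ofNat_zero,
      Der.length, Der.code, true_and] at hn ⊢
    omega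
  | @and Φ Ψ E E' F F' h₁ h₂ ih₁ ih₂ | @or Φ Ψ E E' F F' h₁ h₂ ih₁ ih₂ =>
    have hb := Traced.bounds hOK (by constructor <;> assumption) hM
    have hn := length_le_bound hM
    have i₁ := ih₁ (bound_mono hM (by
      first | (rw [Der.length_and]; omega) | (rw [Der.length_or]; omega)))
    have i₂ := ih₂ (bound_mono hM (by
      first | (rw [Der.length_and]; omega) | (rw [Der.length_or]; omega)))
    refine .mono (c := (Φ.length + Ψ.length + 1) * dCost M) (.intro (f := dBody) rfl ?_)
      (Nat.mul_le_mul_right _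
        (by first | (rw [Der.length_and]; omega) | (rw [Der.length_or]; omega)))
    simp only [dBody, wp, hd, tl, v, sw, Tree.ofList, Tree.head_nil, Tree.head_cons,
      Tree.tail_nil, Tree.tail_cons, Tree.sel_nil, Tree.sel_cons, Tree.size, ofNat_zero,
      ofNat_one, ofNat_two, ofNat_three, ofNat_four,
      Der.length, Der.code, Fm.enc, tag₂, num, app, list] at hn hb ⊢
    refine i₁.use rfl fun t ht => ?_
    refine i₂.use rfl fun u hu => ⟨rfl, ?_⟩
    simp only [Tree.size, Nat.add_mul, Nat.one_mul, Der.length] at ht hu ⊢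
    obtain ⟨⟨-, b₁, b₂, -⟩, -, b₃, b₄, -⟩ := hb
    linarith only [hd', hn, ht, hu, b₁, b₂, b₃, b₄, Nat.zero_le (M * zCost M),
      Nat.zero_le (traceCost M), Nat.zero_le (M * (100 * M))]
  | @step ρ Φ Ψ E X Y E' h₁ h h₂ ih₁ ih₂ =>
    have m₁ := bound_mono (m := Φ.length) hM (by rw [Der.length_step]; omega)
    have m₂ := bound_mono (m := Ψ.length) hM (by rw [Der.length_step]; omega)
    obtain ⟨⟨-, b₅, b₆, -⟩, b₁, b₂, b₇, -⟩ := h₁.bounds hOK m₁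
    obtain ⟨⟨-, b₃, b₈, -⟩, -, b₄, b₉, -⟩ := h₂.bounds hOK m₂
    have hn := length_le_bound hM
    have hρ : ρ.code.size ≤ M := by rw [Der.length_step] at hn; omega
    have hz : Ψ.length * zCost M ≤ M * zCost M := Nat.mul_le_mul_right _ (by
      have := length_le_bound m₂; omega)
    have iu := up_runs h 𝔡.zc (.inl rfl) hρ (by rw [h₁.map_lab.2]; exact b₁) b₃ b₂
    rw [h₁.map_lab.2] at iu
    have id := down_runs h hρ b₇ b₃ b₈
    refine .mono (c := (Φ.length + Ψ.length + 1) * dCost M) (.intro (f := dBody) rfl ?_)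
      (Nat.mul_le_mul_right _ (by rw [Der.length_step]; omega))
    simp only [dBody, wp, hd, tl, v, sw, letIn, Tree.ofList, Tree.head_nil, Tree.head_cons,
      Tree.tail_nil, Tree.tail_cons, Tree.sel_nil, Tree.sel_cons, Tree.size, ofNat_zero,
      ofNat_one, ofNat_two, ofNat_three, ofNat_four,
      Der.length, Der.code, num, app, list] at hn ⊢
    refine (z_runs hOK h₂ m₂).use rfl fun t₁ ht₁ => ?_
    refine (cn_runs' m₁).use rfl fun t₂ ht₂ => ?_
    refine iu.use rfl fun t₃ ht₃ => ?_
    refine (ih₁ m₁).use rfl fun t₄ ht₄ => ?_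
    refine id.use rfl fun t₅ ht₅ => ?_
    refine (ih₂ m₂).use rfl fun t₆ ht₆ => ⟨rfl, ?_⟩
    simp only [Tree.size, Nat.add_mul, Nat.one_mul, Der.length] at *
    linarith only [hd', hz, hn, hρ, b₁, b₂, b₃, b₄, b₅, b₆, b₇, b₈, b₉, ht₁, ht₂, ht₃, ht₄, ht₅,
      ht₆]

theorem Fm.size_bind_le {α : Type} {f : α → Fm Lit} {N : ℕ} (h : ∀ a, (f a).size ≤ N) (A : Fm α) :
    (A.bind f).size ≤ N * A.size := by
  induction A with
  | top | bot => simp [Fm.bind]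
  | atom a => simpa [Fm.bind] using h a
  | and A B h₁ h₂ | or A B h₁ h₂ => simp only [Fm.bind, Fm.size_and, Fm.size_or, Nat.mul_add]; omega

/-- A bound for the running time of the transformation, by the length of the derivation. -/
def gCost (M : ℕ) : ℕ :=
  M * zCost M + M * dCost M + 2 * traceCost M + 2 * (M * (100 * M)) + locCost M +
    1000 * (M * (5 * stepLength M)) + 1000 * stepLength M + 10000 * M

/-- The size bound also counts the atoms of premiss and conclusion, so that at a step the sizes at
its two sides, which occur in the hypotheses for the two parts, pay for the inserted derivation. A
formula costs `stepSize N` per atom three times: for its values, and as premiss and as conclusion.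
-/
theorem g_runs {𝔡 : Deco} {N : ℕ} (hOK : 𝔡.OK N) {Φ : Der} {E E' : Fm ℕ} (h : Traced 𝔡 Φ E E')
    {M : ℕ} (hM : 48 * ((N + 1) * Φ.length) ≤ M) :
    ∃ Ψ : Der, Ψ.IsDerivation KS ∧ Ψ.pr = E.bind 𝔡.val ∧ Ψ.cn = E'.bind 𝔡.val ∧
      Ψ.size + stepSize N * (E.size + E'.size) ≤ 3 * (stepSize N * Φ.size) ∧
      Ψ.length ≤ Φ.length * (5 * stepLength M) ∧
      Runs prog 24 [Φ.code, E.enc 𝔡.dc, E'.enc 𝔡.zc, E'.enc 𝔡.vc]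
        (.cons Ψ.code (E.enc 𝔡.vc)) (Φ.length * gCost M) := by
  have hg : gCost M = M * zCost M + M * dCost M + 2 * traceCost M + 2 * (M * (100 * M)) +
    locCost M + 1000 * (M * (5 * stepLength M)) + 1000 * stepLength M + 10000 * M := rfl
  have hL := le_stepLength M
  induction h with
  | fm E =>
    obtain ⟨⟨-, b₁, b₂, b₃⟩, -⟩ := (Traced.fm E).bounds hOK hM
    have hn := length_le_bound hM
    obtain ⟨j₁, j₂⟩ := join_runs 𝔡.val E b₃
    have j₃ : (E.enc 𝔡.vc).size * (100 * M) ≤ M * (100 * M) := Nat.mul_le_mul_right _ b₃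
    refine ⟨.fm (E.bind 𝔡.val), trivial, rfl, rfl, ?_, ?_, ?_⟩
    · have h₁ := Fm.size_bind_le hOK.val_size E
      have h₂ : N * E.size ≤ stepSize N * E.size :=
        Nat.mul_le_mul_right _ (by unfold stepSize; omega)
      simp only [Der.size, Fm.size_map, Nat.mul_add]
      omega
    · refine le_trans ?_ (Nat.le_mul_of_pos_left _ (Tree.one_le_size _))
      rw [Der.length_fm]
      have : (E.bind 𝔡.val).code.size ≤ M := j₂.trans b₃
      omega
    · refine Runs.mono (c := gCost M) (.intro (f := gBody) rfl ?_)
        (Nat.le_mul_of_pos_left _ (Tree.one_le_size _))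
      simp only [gBody, wp, hd, tl, v, sw, Tree.ofList, Tree.head_nil, Tree.head_cons,
        Tree.tail_nil, Tree.tail_cons, Tree.sel_nil, Tree.sel_cons, Tree.size, ofNat_zero,
        Der.length, Der.code, tag, num, app, list] at hn ⊢
      refine j₁.use rfl fun t ht => ⟨rfl, ?_⟩
      change t ≤ (E.enc 𝔡.vc).size * (100 * M) at ht
      change _ ≤ (E.enc 𝔡.vc).size at j₂
      linarith only [hg, hn, ht, j₂, j₃, b₁, b₂, b₃, hL, Nat.zero_le (M * zCost M),
        Nat.zero_le (traceCost M), Nat.zero_le (M * (100 * M)), Nat.zero_le (M * dCost M),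
        Nat.zero_le (locCost M), Nat.zero_le (M * (5 * stepLength M))]
  | @and Φ Ψ E E' F F' h₁ h₂ ih₁ ih₂ | @or Φ Ψ E E' F F' h₁ h₂ ih₁ ih₂ =>
    obtain ⟨⟨-, b₁, b₂, b₅⟩, -, b₃, b₄, b₆⟩ :=
      Traced.bounds hOK (by constructor <;> assumption) hM
    have hn := length_le_bound hM
    obtain ⟨Φ', d₁, p₁, c₁, s₁, l₁, r₁⟩ := ih₁ (bound_mono hM
      (by first | (rw [Der.length_and]; omega) | (rw [Der.length_or]; omega)))
    obtain ⟨Ψ', d₂, p₂, c₂, s₂, l₂, r₂⟩ := ih₂ (bound_mono hM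
      (by first | (rw [Der.length_and]; omega) | (rw [Der.length_or]; omega)))
    have k₁ : Φ.length * (5 * stepLength M) ≤ M * (5 * stepLength M) :=
      Nat.mul_le_mul_right _ (by
        first | (rw [Der.length_and] at hn; omega) | (rw [Der.length_or] at hn; omega))
    have k₂ : Ψ.length * (5 * stepLength M) ≤ M * (5 * stepLength M) :=
      Nat.mul_le_mul_right _ (by
        first | (rw [Der.length_and] at hn; omega) | (rw [Der.length_or] at hn; omega))
    first
    -- The statement fits only the case of `∧`, so `first` chooses the right connective.
    | (have _ : 48 * ((N + 1) * (Der.and Φ Ψ).length) ≤ M := hM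
       refine ⟨.and Φ' Ψ', ⟨d₁, d₂⟩, congr (congrArg _ p₁) p₂, congr (congrArg _ c₁) c₂,
         ?_, ?_, ?_⟩)
    | refine ⟨.or Φ' Ψ', ⟨d₁, d₂⟩, congr (congrArg _ p₁) p₂, congr (congrArg _ c₁) c₂, ?_, ?_, ?_⟩
    · simp only [Der.size, Fm.size_and, Fm.size_or, Nat.mul_add] at *
      omega
    · simp only [Der.length_and, Der.length_or, Nat.add_mul]
      omega
    · refine .mono (c := (Φ.length + Ψ.length + 1) * gCost M) (.intro (f := gBody) rfl ?_)
        (Nat.mul_le_mul_right _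
          (by first | (rw [Der.length_and]; omega) | (rw [Der.length_or]; omega)))
      simp only [gBody, wp, hd, tl, v, sw, letIn, Tree.ofList, Tree.head_nil, Tree.head_cons,
        Tree.tail_nil, Tree.tail_cons, Tree.sel_nil, Tree.sel_cons, Tree.size, ofNat_zero,
        ofNat_one, ofNat_two, ofNat_three, ofNat_four,
        Der.length, Der.code, Fm.enc, tag₂, num, app, list] at hn b₁ b₂ b₃ b₄ b₅ b₆ l₁ l₂ k₁ k₂ ⊢
      refine r₁.use rfl fun t ht => ?_
      refine r₂.use rfl fun u hu => ⟨rfl, ?_⟩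
      simp only [Tree.size, Tree.head_cons, Tree.tail_cons, Nat.add_mul, Nat.one_mul,
        Der.length] at ht hu ⊢
      linarith only [hg, hn, ht, hu, b₁, b₂, b₃, b₄, b₅, b₆, l₁, l₂, k₁, k₂, hL,
        Nat.zero_le (M * zCost M), Nat.zero_le (locCost M),
        Nat.zero_le (traceCost M), Nat.zero_le (M * (100 * M)), Nat.zero_le (M * dCost M)]
  | @step ρ Φ Ψ E X Y E' h₁ h h₂ ih₁ ih₂ =>
    have m₁ := bound_mono (m := Φ.length) hM (by rw [Der.length_step]; omega)
    have m₂ := bound_mono (m := Ψ.length) hM (by rw [Der.length_step]; omega)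
    obtain ⟨⟨-, b₅, b₆, a₁⟩, b₁, b₂, b₇, a₂⟩ := h₁.bounds hOK m₁
    obtain ⟨⟨-, b₃, b₈, a₃⟩, -, b₄, b₉, a₄⟩ := h₂.bounds hOK m₂
    have hn := length_le_bound hM
    have n₁ := length_le_bound m₁
    have n₂ := length_le_bound m₂
    have hρ : ρ.code.size ≤ M := by rw [Der.length_step] at hn; omega
    have q₁ : Ψ.length * zCost M ≤ M * zCost M := Nat.mul_le_mul_right _ (by omega)
    have q₂ : Φ.length * dCost M ≤ M * dCost M := Nat.mul_le_mul_right _ (by omega)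
    have iu := up_runs h 𝔡.zc (.inl rfl) hρ (by rw [h₁.map_lab.2]; exact b₁) b₃ b₂
    have id := down_runs h hρ b₇ b₃ b₈
    obtain ⟨y, il, fl⟩ := loc_runs hOK h hρ (by rw [h₁.map_lab.2]; exact b₁) b₇ a₃ a₂
    rw [h₁.map_lab.2] at iu il
    obtain ⟨Φ', d₁, p₁, c₁, s₁, l₁, r₁⟩ := ih₁ m₁
    obtain ⟨Ψ', d₂, p₂, c₂, s₂, l₂, r₂⟩ := ih₂ m₂
    have k₁ : Φ.length * (5 * stepLength M) ≤ M * (5 * stepLength M) :=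
      Nat.mul_le_mul_right _ (by omega)
    have k₂ : Ψ.length * (5 * stepLength M) ≤ M * (5 * stepLength M) :=
      Nat.mul_le_mul_right _ (by omega)
    -- One execution covers both kinds of filling: the tail of `y` is `nil` exactly if a single rule
    -- suffices.
    have run : ∀ Θ : Der, y.size ≤ 4 * stepLength M →
        Θ.length ≤ Φ'.length + Ψ'.length + 4 * stepLength M →
        Θ.code = y.tail.sel
          (.cons (Tree.ofNat 3) (.cons y.head (.cons Φ'.code (.cons (Tree.ofNat 3)
            (.cons y.tail.head (.cons y.tail.tail Ψ'.code))))))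
          (.cons (Tree.ofNat 3) (.cons y.head (.cons Φ'.code Ψ'.code))) →
        Runs prog 24 [(Der.step ρ Φ Ψ).code, E.enc 𝔡.dc, E'.enc 𝔡.zc, E'.enc 𝔡.vc]
          (.cons Θ.code (E.enc 𝔡.vc)) ((Der.step ρ Φ Ψ).length * gCost M) := by
      intro Θ hy hΘ eΘ
      refine .mono (c := (Φ.length + Ψ.length + 1) * gCost M) (.intro (f := gBody) rfl ?_)
        (Nat.mul_le_mul_right _ (by rw [Der.length_step]; omega))
      simp only [gBody, wp, hd, tl, v, sw, letIn, step, Tree.ofList, Tree.head_nil, Tree.head_cons,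
        Tree.tail_nil, Tree.tail_cons, Tree.sel_nil, Tree.sel_cons, Tree.size, ofNat_zero,
        ofNat_one, ofNat_two, ofNat_three, ofNat_four,
        Der.length, Der.code, num, app, list] at hn eΘ hΘ ⊢
      refine (z_runs hOK h₂ m₂).use rfl fun t₁ ht₁ => ?_
      refine (cn_runs' m₁).use rfl fun t₂ ht₂ => ?_
      refine iu.use rfl fun t₃ ht₃ => ?_
      refine (d_runs hOK h₁ m₁).use rfl fun t₄ ht₄ => ?_
      refine id.use rfl fun t₅ ht₅ => ?_
      refine r₂.use rfl fun t₆ ht₆ => ?_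
      refine (cn_runs' m₁).use rfl fun t₇ ht₇ => ?_
      refine il.use rfl fun t₈ ht₈ => ?_
      refine r₁.use rfl fun t₉ ht₉ => ?_
      have hy' : ∃ a b, y = .cons a b := by
        rcases fl with ⟨ρ₁, -, h, -⟩ | ⟨ρ₁, -, ρ₂, -, χ, h, -⟩ <;> exact ⟨_, _, h⟩
      obtain ⟨a, b, rfl⟩ := hy'
      rcases b with _ | ⟨c, d⟩ <;>
      · simp only [Tree.head_cons, Tree.tail_cons, Tree.head_nil, Tree.tail_nil, Tree.sel_nil,
          Tree.sel_cons, Tree.size] at eΘ hy ht₁ ht₂ ht₃ ht₄ ht₅ ht₆ ht₇ ht₈ ht₉ ⊢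
        refine ⟨by rw [eΘ], ?_⟩
        simp only [Nat.add_mul, Nat.one_mul, Der.length] at *
        linarith only [hg, hn, hρ, a₁, a₂, a₃, a₄, b₁, b₂, b₃, b₄, b₅, b₆, b₇, b₈, b₉, ht₁, ht₂,
          ht₃, ht₄, ht₅, ht₆, ht₇, ht₈, ht₉, hL, l₁, l₂, k₁, k₂, q₁, q₂, hy]
    have hs : Φ'.length + Ψ'.length + 4 * stepLength M + 20 ≤
        (Der.step ρ Φ Ψ).length * (5 * stepLength M) := by
      have := Nat.mul_le_mul_right (5 * stepLength M)
        (by rw [Der.length_step]; omega : Φ.length + Ψ.length + 1 ≤ (Der.step ρ Φ Ψ).length)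
      rw [Nat.add_mul, Nat.add_mul] at this
      omega
    rcases fl with ⟨ρ₁, hρ₁, rfl, i₁, z₁⟩ | ⟨ρ₁, hρ₁, ρ₂, hρ₂, χ, rfl, dχ, i₁, i₂, z₁, z₂, z₃, z₄⟩
    · refine ⟨.step ρ₁ Φ' Ψ', ⟨d₁, d₂, hρ₁, by rw [c₁, p₂]; exact i₁⟩, p₁, c₂, ?_, ?_, ?_⟩
      · simp only [Der.size, Nat.mul_add] at *
        omega
      · rw [Der.length_step]
        omega
      · refine run _ ?_ ?_ rfl
        · simp only [Tree.size]; omega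
        · rw [Der.length_step]; omega
    · refine ⟨.step ρ₁ Φ' (.step ρ₂ χ Ψ'), ⟨d₁, ⟨dχ, d₂, hρ₂, by rw [p₂]; exact i₂⟩, hρ₁,
        by rw [c₁]; exact i₁⟩, p₁, c₂, ?_, ?_, ?_⟩
      · simp only [Der.size, Nat.mul_add] at *
        omega
      · rw [Der.length_step, Der.length_step]
        omega
      · refine run _ ?_ ?_ rfl
        · simp only [Tree.size]; unfold Der.length at z₃; omega
        · rw [Der.length_step, Der.length_step]; omega

/-! ### Proofs -/

theorem Der.size_cn_le (Φ : Der) : Φ.cn.size ≤ Φ.size := by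
  induction Φ with
  | fm A => exact le_rfl
  | and Φ Ψ h₁ h₂ | or Φ Ψ h₁ h₂ => simp only [Der.cn, Der.size, Fm.size_and, Fm.size_or]; omega
  | step ρ Φ Ψ _ h => simp only [Der.cn, Der.size]; omega

/-- Weakening of the dead atoms of a formula. -/
def Deco.weak (𝔡 : Deco) : Fm ℕ → Der
  | .top => .fm .top
  | .bot => .fm .bot
  | .atom e => if 𝔡.dead e then .step .awd (.fm .bot) (.fm (.atom (𝔡.lab e)))
      else .fm (.atom (𝔡.lab e))
  | .and A B => .and (𝔡.weak A) (𝔡.weak B)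
  | .or A B => .or (𝔡.weak A) (𝔡.weak B)

/-- The edges of `E` are pending edges of the conclusion. -/
def Deco.Final (𝔡 : Deco) (E : Fm ℕ) : Prop :=
  ∀ e ∈ E.atoms, 𝔡.tree e = some (.atom (𝔡.lab e))

theorem Deco.Final.of_and {𝔡 : Deco} {A B : Fm ℕ} (h : 𝔡.Final (.and A B)) :
    𝔡.Final A ∧ 𝔡.Final B :=
  ⟨fun e he => h e (List.mem_append_left _ he), fun e he => h e (List.mem_append_right _ he)⟩

theorem Deco.Final.val {𝔡 : Deco} {e : ℕ} (h : 𝔡.Final (.atom e)) :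
    𝔡.val e = if 𝔡.dead e then .bot else .atom (𝔡.lab e) := by
  have : 𝔡.tree e = some (.atom (𝔡.lab e)) := h e (by simp [Fm.atoms])
  cases hd : 𝔡.dead e
  · rw [Deco.val_live this hd]; rfl
  · rw [Deco.val_dead this hd]; rfl

/-- Every edge of the conclusion leads to the conclusion, so the initial annotation is the
conclusion itself. -/
theorem Deco.Final.enc_zc {𝔡 : Deco} {E : Fm ℕ} (h : 𝔡.Final E) :
    E.enc 𝔡.zc = (E.map 𝔡.lab).code := by
  induction E with
  | top | bot => rfl
  | atom e =>
    have : 𝔡.tree e = some (.atom (𝔡.lab e)) := h e (by simp [Fm.atoms])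
    simp [Fm.enc, Fm.map, Fm.code, Deco.zc, this]
  | and A B h₁ h₂ | or A B h₁ h₂ =>
    simp only [Fm.enc, Fm.map, Fm.code, h₁ h.of_and.1, h₂ h.of_and.2]

/-- At the conclusion a tree is a single atom, so a value is this atom or ⊥, and atomic weakening
turns ⊥ back into the atom. -/
theorem Deco.Final.weak {𝔡 : Deco} {E : Fm ℕ} (h : 𝔡.Final E) :
    (𝔡.weak E).IsDerivation KS ∧ (𝔡.weak E).pr = E.bind 𝔡.val ∧
      (𝔡.weak E).cn = E.map 𝔡.lab ∧ (𝔡.weak E).size ≤ E.size := by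
  induction E with
  | top | bot => exact ⟨trivial, rfl, rfl, le_rfl⟩
  | atom e =>
    have hv := h.val
    cases hd : 𝔡.dead e <;> simp only [hd] at hv
    · simp [Deco.weak, hd, Fm.bind, hv, Der.IsDerivation, Der.pr, Der.cn, Fm.map, Der.size]
    · simp [Deco.weak, hd, Fm.bind, hv, Der.IsDerivation, Der.pr, Der.cn, Fm.map, Der.size, KS]
      exact .awd _
  | and A B h₁ h₂ | or A B h₁ h₂ =>
    obtain ⟨d₁, p₁, c₁, s₁⟩ := h₁ h.of_and.1
    obtain ⟨d₂, p₂, c₂, s₂⟩ := h₂ h.of_and.2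
    refine ⟨⟨d₁, d₂⟩, congr (congrArg _ p₁) p₂, congr (congrArg _ c₁) c₂, ?_⟩
    simp only [Deco.weak, Der.size, Fm.size_and, Fm.size_or]; omega

theorem Deco.weak_length (𝔡 : Deco) (E : Fm ℕ) :
    (𝔡.weak E).length ≤ 50 * (E.map 𝔡.lab).code.size := by
  induction E with
  | top | bot => simp [Deco.weak, Der.length, Der.code, Fm.code, Fm.map, Tree.size, Tree.size_ofNat]
  | atom e =>
    simp only [Deco.weak]
    split <;>
    · simp only [Der.length, Der.code, Fm.code, Fm.map, Tree.size, Tree.size_ofNat, Rule.code]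
      omega
  | and A B h₁ h₂ | or A B h₁ h₂ =>
    simp only [Deco.weak, Fm.map, Der.length_and, Der.length_or, Fm.code_size_and,
      Fm.code_size_or]
    omega

theorem init_runs {𝔡 : Deco} {E : Fm ℕ} (h : 𝔡.Final E) {M : ℕ}
    (h₁ : (E.map 𝔡.lab).code.size ≤ M) (h₂ : (E.enc 𝔡.dc).size ≤ M)
    (h₃ : (E.enc 𝔡.vc).size ≤ M) :
    Runs prog 25 [(E.map 𝔡.lab).code, E.enc 𝔡.dc] (E.enc 𝔡.vc)
      ((E.map 𝔡.lab).code.size * (100 * M)) := by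
  induction E with
  | top | bot =>
    refine .mono (c := 100 * M) (.intro (f := initBody) rfl ?_)
      (Nat.le_mul_of_pos_left _ (Tree.one_le_size _))
    simp only [initBody, wp, hd, tl, v, sw, Tree.ofList, Tree.head_nil, Tree.head_cons,
      Tree.tail_nil, Tree.tail_cons, Tree.sel_nil, Tree.sel_cons, Tree.size, ofNat_zero, ofNat_one,
      Fm.enc, Fm.map, Fm.code, true_and] at *
    omega
  | atom e =>
    have hv : 𝔡.vc e = _ := congrArg Fm.code h.val
    refine .mono (c := 100 * M) (.intro (f := initBody) rfl ?_)
      (Nat.le_mul_of_pos_left _ (Tree.one_le_size _))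
    have hd' : 𝔡.dc e = Tree.ofBool (𝔡.dead e) := rfl
    cases hd₁ : 𝔡.dead e <;> rw [hd₁] at hv hd' <;>
    · simp only [initBody, wp, hd, tl, v, sw, Tree.ofList, Tree.head_nil, Tree.head_cons,
        Tree.tail_nil, Tree.tail_cons, Tree.sel_nil, Tree.sel_cons, Tree.size, ofNat_zero,
        ofNat_one, ofNat_two, Fm.enc, Fm.map, Fm.code, hv, hd', Tree.ofBool, tag, num, if_true,
        Bool.false_eq_true, if_false, true_and] at *
      omega
  | and A B ih₁ ih₂ | or A B ih₁ ih₂ =>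
    simp only [Fm.enc, Fm.map, Fm.code, Tree.size] at h₁ h₂ h₃
    have i₁ := ih₁ h.of_and.1 (by omega) (by omega) (by omega)
    have i₂ := ih₂ h.of_and.2 (by omega) (by omega) (by omega)
    refine .intro (f := initBody) rfl ?_
    simp only [initBody, wp, hd, tl, v, sw, Tree.ofList, Tree.head_nil, Tree.head_cons,
      Tree.tail_nil, Tree.tail_cons, Tree.sel_nil, Tree.sel_cons, Tree.size, ofNat_zero, ofNat_one,
      ofNat_two, ofNat_three, ofNat_four, Fm.enc, Fm.map, Fm.code, tag₂, num, app, list] at *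
    refine i₁.use rfl fun t ht => ?_
    refine i₂.use rfl fun u hu => ⟨rfl, ?_⟩
    simp only [Nat.add_mul, Nat.one_mul, Tree.size] at *
    omega

theorem weak_runs (𝔡 : Deco) (E : Fm ℕ) {M : ℕ}
    (h₁ : (E.map 𝔡.lab).code.size ≤ M) (h₂ : (E.enc 𝔡.dc).size ≤ M) :
    Runs prog 26 [(E.map 𝔡.lab).code, E.enc 𝔡.dc] (𝔡.weak E).code
      ((E.map 𝔡.lab).code.size * (1000 * M)) := by
  have hl := 𝔡.weak_length E
  induction E with
  | top | bot =>
    refine .mono (c := 1000 * M) (.intro (f := weakBody) rfl ?_)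
      (Nat.le_mul_of_pos_left _ (Tree.one_le_size _))
    simp only [weakBody, wp, hd, tl, v, sw, Tree.ofList, Tree.head_nil, Tree.head_cons,
      Tree.tail_nil, Tree.tail_cons, Tree.sel_nil, Tree.sel_cons, Tree.size, ofNat_zero, ofNat_one,
      Fm.enc, Fm.map, Fm.code, Deco.weak, Der.code, tag, num, true_and] at *
    omega
  | atom e =>
    refine .mono (c := 1000 * M) (.intro (f := weakBody) rfl ?_)
      (Nat.le_mul_of_pos_left _ (Tree.one_le_size _))
    have hd' : 𝔡.dc e = Tree.ofBool (𝔡.dead e) := rfl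
    cases hd₁ : 𝔡.dead e <;> rw [hd₁] at hd' <;>
    · simp only [weakBody, wp, hd, tl, v, sw, Tree.ofList, Tree.head_nil, Tree.head_cons,
        Tree.tail_nil, Tree.tail_cons, Tree.sel_nil, Tree.sel_cons, Tree.size, ofNat_zero,
        ofNat_one, ofNat_two, ofNat_three, Fm.enc, Fm.map, Fm.code, hd', Tree.ofBool, tag, num,
        if_true, Deco.weak, hd₁, Der.code, Rule.code, step,
        Bool.false_eq_true, if_false, true_and] at *
      omega
  | and A B ih₁ ih₂ | or A B ih₁ ih₂ =>
    have w₁ := 𝔡.weak_length A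
    have w₂ := 𝔡.weak_length B
    simp only [Fm.enc, Fm.map, Fm.code, Tree.size] at h₁ h₂
    have i₁ := ih₁ (by omega) (by omega) w₁
    have i₂ := ih₂ (by omega) (by omega) w₂
    refine .intro (f := weakBody) rfl ?_
    simp only [weakBody, wp, hd, tl, v, sw, Tree.ofList, Tree.head_nil, Tree.head_cons,
      Tree.tail_nil, Tree.tail_cons, Tree.sel_nil, Tree.sel_cons, Tree.size, ofNat_zero, ofNat_one,
      ofNat_two, ofNat_three, ofNat_four, Fm.enc, Fm.map, Fm.code, tag₂, num, app, list,
      Deco.weak, Der.code, Der.length] at *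
    refine i₁.use rfl fun t ht => ?_
    refine i₂.use rfl fun u hu => ⟨rfl, ?_⟩
    simp only [Nat.add_mul, Nat.one_mul, Tree.size] at *
    omega

/-- A bound for the running time of the program. -/
def mainCost (M : ℕ) : ℕ :=
  M * gCost M + M * dCost M + 1500 * (M * M) + expandCost (50 * M) +
    1000 * (M * (5 * stepLength M)) + 1000 * stepLength M + 10000 * M

/-- The transformed proof is followed by weakenings of the dead atoms of the conclusion; these add
the last summand of the size bound. `M` is left free so that a polynomial in one variable can be
inserted. -/
theorem Der.IsProof.exists_KS {Φ : Der} (h : Φ.IsProof KSplus) {M : ℕ}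
    (hM : 48 * ((Φ.flow.numOpenAiPaths + 1) * Φ.length) ≤ M) :
    ∃ (Ψ : Der) (t : ℕ), Ψ.IsProof KS ∧ Ψ.cn = Φ.cn ∧
      prog.Outputs Φ.code Ψ.code t ∧ t ≤ mainCost M ∧
      Ψ.size ≤ 3 * (stepSize Φ.flow.numOpenAiPaths * Φ.size) + Φ.size := by
  obtain ⟨𝔡, E, hT, hOK, hE, hF⟩ := h.exists_traced
  replace hF : 𝔡.Final E := hF
  obtain ⟨Θ, dΘ, pΘ, cΘ, sΘ, lΘ, rΘ⟩ := g_runs hOK hT hM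
  obtain ⟨-, a₁, a₂, a₃, a₄⟩ := hT.bounds hOK hM
  obtain ⟨dW, pW, cW, sW⟩ := hF.weak
  have lW := 𝔡.weak_length E
  have rd := d_runs hOK hT hM
  have ri := init_runs hF (M := M) (by rwa [hE]) a₃ a₄
  have rw' := weak_runs 𝔡 E (M := M) (by rwa [hE]) a₃
  rw [hF.enc_zc] at rd rΘ
  rw [hE] at rd rΘ ri rw' cW lW
  obtain ⟨rj, hj⟩ := join_runs 𝔡.val E a₄
  change Runs prog 14 [E.enc 𝔡.vc] _ ((E.enc 𝔡.vc).size * (100 * M)) at rj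
  have hj' : (E.bind 𝔡.val).code.size ≤ M := hj.trans a₄
  have re := refl_runs (E.bind 𝔡.val) hj'
  have le := natsCode_refl_size (E.bind 𝔡.val) hj'
  have hn := length_le_bound hM
  have q₁ : Φ.length * gCost M ≤ M * gCost M := Nat.mul_le_mul_right _ (by omega)
  have q₂ : Φ.length * dCost M ≤ M * dCost M := Nat.mul_le_mul_right _ (by omega)
  have q₃ : Φ.length * (5 * stepLength M) ≤ M * (5 * stepLength M) :=
    Nat.mul_le_mul_right _ (by omega)
  have q₄ : Φ.cn.code.size * (100 * M) ≤ M * (100 * M) := Nat.mul_le_mul_right _ a₁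
  have q₅ : Φ.cn.code.size * (1000 * M) ≤ M * (1000 * M) := Nat.mul_le_mul_right _ a₁
  have q₆ : (E.enc 𝔡.vc).size * (100 * M) ≤ M * (100 * M) := Nat.mul_le_mul_right _ a₄
  have hm : mainCost M = M * gCost M + M * dCost M + 1500 * (M * M) + expandCost (50 * M) +
    1000 * (M * (5 * stepLength M)) + 1000 * stepLength M + 10000 * M := rfl
  have main : wp prog mainBody Φ.code fun y t =>
      y = (Der.step (.eq (expand [0] [E.bind 𝔡.val])) Θ (𝔡.weak E)).code ∧
        t + 1 ≤ mainCost M := by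
    simp only [mainBody, wp, hd, tl, v, letIn, step, Tree.ofList, Tree.head_nil,
      Tree.head_cons, Tree.tail_nil, Tree.tail_cons, Tree.size, tag, num, app, list, Der.length,
      Fm.enc, ofNat_zero] at *
    refine (cn_runs' hM).use rfl fun t₁ ht₁ => ?_
    refine rd.use rfl fun t₂ ht₂ => ?_
    refine ri.use rfl fun t₃ ht₃ => ?_
    refine rj.use rfl fun t₄ ht₄ => ?_
    refine re.use rfl fun t₅ ht₅ => ?_
    refine rΘ.use rfl fun t₆ ht₆ => ?_
    refine rw'.use rfl fun t₇ ht₇ => ⟨rfl, ?_⟩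
    have := Φ.code.one_le_size
    simp only [Tree.size, Tree.head_cons, Tree.tail_cons] at *
    linarith only [hm, hn, ht₁, ht₂, ht₃, ht₄, ht₅, ht₆, ht₇, a₁, a₂, a₃, a₄, hj', le, lW, lΘ, q₁,
      q₂, q₃, q₄, q₅, q₆, this]
  obtain ⟨_, t, e, rfl, ht⟩ := wp_sound main
  refine ⟨.step (.eq (expand [0] [E.bind 𝔡.val])) Θ (𝔡.weak E), _,
    ⟨⟨dΘ, dW, eq_mem_KS _, ?_⟩, pΘ⟩, cW, .call rfl e, ht, ?_⟩
  · rw [cΘ, pW]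
    exact .eq (eqTrace_refl _)
  · have h₁ := Φ.size_cn_le
    have h₂ : E.size = Φ.cn.size := by rw [← hE, Fm.size_map]
    simp only [Der.size]
    omega

/-! ### Polynomial bounds -/

/-- `f` is bounded by a polynomial. -/
def PolyBounded (f : ℕ → ℕ) : Prop := ∃ p : Polynomial ℕ, ∀ n, f n ≤ p.eval n

/-- The coefficients are natural numbers. Monotonicity is what lets polynomial bounds be composed.
-/
theorem eval_mono (p : Polynomial ℕ) {m n : ℕ} (h : m ≤ n) : p.eval m ≤ p.eval n := by
  rw [Polynomial.eval_eq_sum, Polynomial.eval_eq_sum]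
  exact Finset.sum_le_sum fun i _ => Nat.mul_le_mul_left _ (Nat.pow_le_pow_left h i)

theorem PolyBounded.const (c : ℕ) : PolyBounded fun _ => c := ⟨.C c, fun n => by simp⟩

theorem PolyBounded.id : PolyBounded fun n => n := ⟨.X, fun n => by simp⟩

theorem PolyBounded.add {f g : ℕ → ℕ} : PolyBounded f → PolyBounded g →
    PolyBounded fun n => f n + g n
  | ⟨p, hp⟩, ⟨q, hq⟩ => ⟨p + q, fun n => by
    rw [Polynomial.eval_add]; exact Nat.add_le_add (hp n) (hq n)⟩

theorem PolyBounded.mul {f g : ℕ → ℕ} : PolyBounded f → PolyBounded g →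
    PolyBounded fun n => f n * g n
  | ⟨p, hp⟩, ⟨q, hq⟩ => ⟨p * q, fun n => by
    rw [Polynomial.eval_mul]; exact Nat.mul_le_mul (hp n) (hq n)⟩

theorem PolyBounded.comp {f g : ℕ → ℕ} : PolyBounded f → PolyBounded g →
    PolyBounded fun n => f (g n)
  | ⟨p, hp⟩, ⟨q, hq⟩ => ⟨p.comp q, fun n => by
    rw [Polynomial.eval_comp]; exact (hp _).trans (eval_mono p (hq n))⟩

open PolyBounded in
theorem polyBounded_expandCost : PolyBounded expandCost := by
  have h : PolyBounded fun M => 10 * (M * M) := (const 10).mul (id.mul id)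
  exact h.mul (h.mul ((const 5000).mul h))

open PolyBounded in
theorem polyBounded_meetCost : PolyBounded meetCost :=
  (((const 2).mul (polyBounded_expandCost.comp ((const 50).mul id))).add
    (id.mul ((const 1000).mul id))).add ((const 5000).mul id)

open PolyBounded in
theorem polyBounded_stepLength : PolyBounded stepLength := by
  have h₁ : PolyBounded meetLength :=
    (((const 50).mul (id.mul id)).add ((const 200).mul id)).add (const 400)
  have h₂ : PolyBounded fun M => 2 * M := (const 2).mul id
  have h₃ : PolyBounded fun M => 2 * M + 2 := h₂.add (const 2)
  exact (((h₂.mul (h₃.mul h₁)).add (h₂.mul (((const 3).mul id).add (const 60)))).add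
    ((const 20).add (id.mul h₃))).add (const 500)

open PolyBounded in
theorem polyBounded_traceCost : PolyBounded traceCost := by
  have h : PolyBounded fun M => 2 * M := (const 2).mul id
  exact h.mul (h.mul ((const 3000).mul h))

open PolyBounded in
theorem polyBounded_locCost : PolyBounded locCost := by
  have h : PolyBounded fun M => stepLength M + 50 * M :=
    polyBounded_stepLength.add ((const 50).mul id)
  have hb : PolyBounded builderCost :=
    (h.mul (h.mul ((const 4).mul (polyBounded_meetCost.comp h)))).add
      (h.mul ((const 1000).mul h))
  exact (((hb.add ((const 3).mul (polyBounded_expandCost.comp ((const 50).mul id)))).add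
    polyBounded_traceCost).add (id.mul ((const 200).mul id))).add ((const 10000).mul h)

open PolyBounded in
theorem polyBounded_mainCost : PolyBounded mainCost := by
  have h₁ : PolyBounded fun M => M * (100 * M) := id.mul ((const 100).mul id)
  have h₂ : PolyBounded fun M => 1000 * (M * (5 * stepLength M)) :=
    (const 1000).mul (id.mul ((const 5).mul polyBounded_stepLength))
  have h₃ : PolyBounded fun M => 1000 * stepLength M := (const 1000).mul polyBounded_stepLength
  have hz : PolyBounded zCost := (polyBounded_traceCost.add h₁).add ((const 1000).mul id)
  have hd : PolyBounded dCost :=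
    (((id.mul hz).add ((const 2).mul polyBounded_traceCost)).add h₁).add ((const 5000).mul id)
  have hg : PolyBounded gCost :=
    (((((((id.mul hz).add (id.mul hd)).add ((const 2).mul polyBounded_traceCost)).add
      ((const 2).mul h₁)).add polyBounded_locCost).add h₂).add h₃).add ((const 10000).mul id)
  exact ((((((id.mul hg).add (id.mul hd)).add ((const 1500).mul (id.mul id))).add
    (polyBounded_expandCost.comp ((const 50).mul id))).add h₂).add h₃).add ((const 10000).mul id)

open PolyBounded in
theorem polyBounded_stepSize : PolyBounded stepSize :=
  (((const 96).mul (id.mul ((id.mul id).mul id))).add (((const 3).mul id).mul id)).add id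

end DeepInference

/-! ### The theorem. -/

open DeepInference PolyBounded in
theorem mainTheorem3 :
    ∃ (P : DeepInference.Program) (p : Polynomial ℕ),
      ∀ Φ : DeepInference.Der, Φ.IsProof DeepInference.KSplus →
        ∃ (Ψ : DeepInference.Der) (t : ℕ),
          Ψ.IsProof DeepInference.KS ∧
          Ψ.cn = Φ.cn ∧
          P.Outputs Φ.code Ψ.code t ∧
          t ≤ p.eval (Φ.length + Φ.flow.numOpenAiPaths) ∧
          Ψ.size ≤ p.eval (Φ.size + Φ.flow.numOpenAiPaths) := by
  have hM : PolyBounded fun n => 48 * ((n + 1) * n) :=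
    (const 48).mul ((PolyBounded.id.add (const 1)).mul PolyBounded.id)
  obtain ⟨p, hp⟩ := polyBounded_mainCost.comp hM
  obtain ⟨q, hq⟩ := ((const 3).mul (polyBounded_stepSize.mul PolyBounded.id)).add PolyBounded.id
  -- `p` bounds the time and `q` the size; their sum serves for both.
  refine ⟨prog, p + q, fun Φ hΦ => ?_⟩
  set N := Φ.flow.numOpenAiPaths with hN
  -- Both the length and the number of paths are replaced by their sum, the single variable of the
  -- polynomial.
  have hb : 48 * ((N + 1) * Φ.length) ≤ 48 * ((Φ.length + N + 1) * (Φ.length + N)) :=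
    Nat.mul_le_mul_left _ (Nat.mul_le_mul (by omega) (by omega))
  obtain ⟨Ψ, t, h₁, h₂, h₃, h₄, h₅⟩ := hΦ.exists_KS hb
  rw [← hN] at h₅
  refine ⟨Ψ, t, h₁, h₂, h₃, ?_, ?_⟩ <;> rw [Polynomial.eval_add]
  · exact (h₄.trans (hp _)).trans (Nat.le_add_right _ _)
  · have h₆ : 3 * (stepSize (Φ.size + N) * (Φ.size + N)) + (Φ.size + N) ≤ _ := hq (Φ.size + N)
    have h₇ : stepSize N ≤ stepSize (Φ.size + N) := by
      unfold stepSize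
      gcongr <;> omega
    have h₈ := Nat.mul_le_mul h₇ (by omega : Φ.size ≤ Φ.size + N)
    omega
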